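/- Let $n\ge 3$ and fix a pole $\bar e\in\mathbb S^{n-1}\subset\mathbb R^n$; $du$ denotes the surface area measure on $\mathbb S^{n-1}$. A signed measure or $L^1$ function on $\mathbb S^{n-1}$ is called zonal if it is invariant under all rotations in $SO(n)$ fixing $\bar e$. For $k\ge 0$ let $P^n_k$ be the Legendre polynomial of dimension $n$ and degree $k$, normalized by $P^n_k(1)=1$, that is, $P^n_0=1$, $P^n_1(t)=t$ and $(k+n-2)P^n_{k+1}(t)=(2k+n-2)\,t\,P^n_k(t)-k\,P^n_{k-1}(t)$ for $k\ge1$. The multipliers of a zonal distribution $\nu$ on $\mathbb S^{n-1}$ are $a^n_k[\nu]=\langle P^n_k(\langle\bar e,\cdot\rangle),\nu\rangle$; for a signed measure, $a^n_k[\nu]=\int_{\mathbb S^{n-1}}P^n_k(\langle\bar e,u\rangle)\,\nu(du)$. (1) Let $\mu$ be a finite zonal signed measure on $\mathbb S^{n-1}$ with total variation $|\mu|$, and suppose that there exist $C>0$ and $\alpha\ge0$ such that $$|\mu|\big(\{u\in\mathbb S^{n-1}:|\langle\bar e,u\rangle|>\cos r\}\big)\le C r^{\alpha}\qquad\text{for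 all } r\ge 0 .$$ Then, as $k\to\infty$, $$a^n_k[\mu]\in\begin{cases}O(k^{-\alpha}),&\alpha<\frac{n-2}{2},\\ O(k^{-\frac{n-2}{2}}\ln k),&\alpha=\frac{n-2}{2},\\ O(k^{-\frac{n-2}{2}}),&\alpha>\frac{n-2}{2}.\end{cases}$$ (2) Let $1<i\le n-1$, and let $\Phi$ be a continuous (in the Hausdorff metric), translation invariant map from the space of convex bodies (non-empty compact convex sets) in $\mathbb R^n$ into itself that satisfies $\Phi K+\Phi L=\Phi(K\cup L)+\Phi(K\cap L)$ whenever $K\cup L$ is convex, intertwines the rotations in $SO(n)$, and is homogeneous of degree $i$, that is, $\Phi(\lambda K)=\lambda^i\Phi K$ for $\lambda\ge0$. Suppose that $\Phi$ is weakly monotone: $\Phi K\subseteq\Phi L$ whenever $K\subseteq L$ and the Steiner points of $K$ and $L$ are at the origin. Let $f\in L^1(\mathbb S^{n-1})$ be the generating function of $\Phi$, that is, $f$ is zonal, orthogonal to all linear functions, and $h(\Phi K,\cdot)=S_i(K,\cdot)\ast f$ for every convex body $K$. Here $h(K,u)=\max_{y\in K}\langle u,y\rangle$ is the support function; the area measures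 $S_0(K,\cdot),\dots,S_{n-1}(K,\cdot)$ are the finite measures on $\mathbb S^{n-1}$ such that for all $t>0$ and all Borel sets $A\subseteq\mathbb S^{n-1}$ the set of points $x$ whose distance $s$ to $K$ satisfies $0<s\le t$ and whose nearest point $p\in K$ satisfies $(x-p)/s\in A$ has volume $\frac1n\sum_{j=0}^{n-1}\binom nj t^{n-j}S_j(K,A)$; and the convolution is the distribution given by $\langle\varphi,S_i(K,\cdot)\ast f\rangle=\int(\varphi\ast f)\,dS_i(K,\cdot)$ for $\varphi\in C^\infty(\mathbb S^{n-1})$, where $(\varphi\ast f)(\vartheta\bar e)=\int_{\mathbb S^{n-1}}\varphi(\vartheta v)f(v)\,dv$ for $\vartheta\in SO(n)$. Let $\square_nf=\frac1{n-1}\Delta_{\mathbb S}f+f$ in the sense of distributions, where $\Delta_{\mathbb S}$ is the spherical Laplacian. Then $$a^n_k[\square_nf]\in O(k^{-1/2})\qquad\text{as } k\to\infty .$$ -/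

import Mathlib

open MeasureTheory Filter Asymptotics
open scoped ContDiff RealInnerProductSpace

noncomputable section

namespace ZonalMultipliers

/-- Euclidean space `ℝⁿ`. -/
abbrev Euc (n : ℕ) : Type := EuclideanSpace ℝ (Fin n)

/-- The unit sphere `𝕊ⁿ⁻¹` in `ℝⁿ`. -/
abbrev Sph (n : ℕ) : Type := Metric.sphere (0 : Euc n) 1

/-- The surface area measure `du` on the unit sphere. -/
def surf (n : ℕ) : Measure (Sph n) := (volume : Measure (Euc n)).toSphere

/-! ### Rotations -/

/-- `ϑ` belongs to `SO(n)`. -/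
def IsRotation {n : ℕ} (θ : Euc n ≃ₗᵢ[ℝ] Euc n) : Prop :=
  LinearMap.det (θ.toLinearEquiv : Euc n →ₗ[ℝ] Euc n) = 1

/-- The action of a linear isometry on the unit sphere. -/
def rotSph {n : ℕ} (θ : Euc n ≃ₗᵢ[ℝ] Euc n) (u : Sph n) : Sph n :=
  ⟨θ u, by rw [mem_sphere_zero_iff_norm, θ.norm_map, norm_eq_of_mem_sphere]⟩

/-! ### Zonal signed measures and functions -/

/-- A signed measure on the sphere is zonal if it is invariant under all rotations fixing `e`. -/
def ZonalMeasure {n : ℕ} (e : Sph n) (μ : SignedMeasure (Sph n)) : Prop :=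
  ∀ θ : Euc n ≃ₗᵢ[ℝ] Euc n, IsRotation θ → rotSph θ e = e →
    ∀ A : Set (Sph n), MeasurableSet A → μ (rotSph θ ⁻¹' A) = μ A

/-- An (almost everywhere defined) function on the sphere is zonal if it is invariant under all
rotations fixing `e`. -/
def ZonalFun {n : ℕ} (e : Sph n) (f : Sph n → ℝ) : Prop :=
  ∀ θ : Euc n ≃ₗᵢ[ℝ] Euc n, IsRotation θ → rotSph θ e = e →
    ∀ᵐ u ∂(surf n), f (rotSph θ u) = f u

/-- A function on the sphere is centered if it is orthogonal to all linear functions. -/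
def Centered {n : ℕ} (f : Sph n → ℝ) : Prop :=
  ∀ x : Euc n, ∫ u, f u * ⟪x, (u : Euc n)⟫ ∂(surf n) = 0

/-! ### Smooth functions, the spherical Laplacian and the box operator -/

/-- The `0`-homogeneous extension `x ↦ φ (x / |x|)` of a function on the sphere. -/
def homExt {n : ℕ} (φ : Sph n → ℝ) (x : Euc n) : ℝ :=
  if hx : x ≠ 0 then
    φ ⟨‖x‖⁻¹ • x, by
      rw [mem_sphere_zero_iff_norm, norm_smul, norm_inv, norm_norm,
        inv_mul_cancel₀ (norm_ne_zero_iff.mpr hx)]⟩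
  else 0

/-- `φ ∈ C^∞(𝕊ⁿ⁻¹)`. -/
def SmoothSph {n : ℕ} (φ : Sph n → ℝ) : Prop :=
  ContDiffOn ℝ ∞ (homExt φ) {0}ᶜ

/-- The spherical Laplacian of a smooth function: the restriction to the sphere of the Euclidean
Laplacian of its `0`-homogeneous extension. -/
def sphLaplacian {n : ℕ} (φ : Sph n → ℝ) (u : Sph n) : ℝ :=
  Laplacian.laplacian (homExt φ) (u : Euc n)

/-- The box operator `□_n = (n-1)⁻¹ Δ_𝕊 + Id` on smooth functions. -/
def boxOp {n : ℕ} (φ : Sph n → ℝ) (u : Sph n) : ℝ :=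
  1 / ((n : ℝ) - 1) * sphLaplacian φ u + φ u

/-! ### Pairings of test functions with signed measures and distributions -/

/-- The distribution `φ ↦ ∫ φ dμ` given by a signed measure `μ`. -/
def measurePairing {n : ℕ} (μ : SignedMeasure (Sph n)) (φ : Sph n → ℝ) : ℝ :=
  ∫ u, φ u ∂μ.toJordanDecomposition.posPart - ∫ u, φ u ∂μ.toJordanDecomposition.negPart

/-- The distribution `□_n f` of an integrable function `f`: `⟨φ, □_n f⟩ = ∫ (□_n φ) f du`. -/
def boxPairing {n : ℕ} (f : Sph n → ℝ) (φ : Sph n → ℝ) : ℝ :=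
  ∫ u, boxOp φ u * f u ∂(surf n)

/-! ### Legendre polynomials and multipliers -/

/-- The Legendre polynomial `P^n_k` of dimension `n` and degree `k`, normalized by `P^n_k(1) = 1`:
`(k + n - 1) P_{k+2} = (2 k + n) t P_{k+1} - (k + 1) P_k`. -/
def legendre (n : ℕ) : ℕ → ℝ → ℝ
  | 0, _ => 1
  | 1, t => t
  | k + 2, t =>
      ((2 * (k : ℝ) + n) * t * legendre n (k + 1) t - ((k : ℝ) + 1) * legendre n k t)
        / ((k : ℝ) + n - 1)

/-- The multiplier `a^n_k[ν] = ⟨P^n_k(⟨e, ·⟩), ν⟩` of a zonal distribution `ν`, given through its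
pairing with test functions. -/
def multiplier {n : ℕ} (e : Sph n) (ν : (Sph n → ℝ) → ℝ) (k : ℕ) : ℝ :=
  ν fun u => legendre n k ⟪(e : Euc n), (u : Euc n)⟫

/-! ### Convex bodies -/

/-- The support function `h(K, x) = max {⟨x, y⟩ : y ∈ K}`. -/
def supp {n : ℕ} (K : ConvexBody (Euc n)) (x : Euc n) : ℝ :=
  sSup ((fun y : Euc n => ⟪x, y⟫) '' (K : Set (Euc n)))

/-- The Steiner point, up to normalization: `s(K) = ∫ h(K, u) u du`. -/
def steinerPoint {n : ℕ} (K : ConvexBody (Euc n)) : Euc n :=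
  ∫ u : Sph n, supp K (u : Euc n) • (u : Euc n) ∂(surf n)

/-- The convex body `{x}`. -/
def pointBody {n : ℕ} (x : Euc n) : ConvexBody (Euc n) :=
  ⟨{x}, convex_singleton x, isCompact_singleton, Set.singleton_nonempty x⟩

/-- The image `ϑ K` of a convex body under a linear isometry. -/
def rotBody {n : ℕ} (θ : Euc n ≃ₗᵢ[ℝ] Euc n) (K : ConvexBody (Euc n)) : ConvexBody (Euc n) :=
  ⟨θ '' K, K.convex.linear_image (θ.toLinearEquiv : Euc n →ₗ[ℝ] Euc n),
    K.isCompact.image θ.continuous, K.nonempty.image θ⟩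

/-- The local parallel set: all points `x` at distance `s ∈ (0, t]` from `K` for which the unit
vector pointing to `x` from its nearest point `p` in `K` belongs to `A`. -/
def localParallelSet {n : ℕ} (K : ConvexBody (Euc n)) (t : ℝ) (A : Set (Sph n)) : Set (Euc n) :=
  {x | ∃ p ∈ K, ∃ u ∈ A, ∃ s : ℝ, 0 < s ∧ s ≤ t ∧ x = p + s • (u : Euc n) ∧
    Metric.infDist x (K : Set (Euc n)) = s}

/-- The finite measures `S_0, …, S_{n-1}` are the area measures of `K`, that is, the coefficients
in the local Steiner formula. -/
structure IsAreaMeasures {n : ℕ} (K : ConvexBody (Euc n)) (S : ℕ → Measure (Sph n)) : Prop where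
  finite : ∀ j, IsFiniteMeasure (S j)
  steiner : ∀ t : ℝ, 0 < t → ∀ A : Set (Sph n), MeasurableSet A →
    (n : ENNReal) * volume (localParallelSet K t A)
      = ∑ j ∈ Finset.range n, (n.choose j : ENNReal) * ENNReal.ofReal (t ^ (n - j)) * S j A

open Classical in
/-- The `i`-th area measure `S_i(K, ·)`, `0 ≤ i ≤ n - 1`. -/
def areaMeasure {n : ℕ} (K : ConvexBody (Euc n)) (i : ℕ) : Measure (Sph n) :=
  if h : ∃ S : ℕ → Measure (Sph n), IsAreaMeasures K S then h.choose i else 0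

/-! ### Convolution -/

open Classical in
/-- The convolution `φ ∗ f` of a smooth function `φ` with a zonal integrable function `f`:
`(φ ∗ f)(ϑ e) = ∫ φ(ϑ v) f(v) dv` for `ϑ ∈ SO(n)`. The right-hand side does not depend on the
choice of `ϑ` as `f` is zonal. -/
def sphConv {n : ℕ} (e : Sph n) (φ f : Sph n → ℝ) (u : Sph n) : ℝ :=
  if h : ∃ θ : Euc n ≃ₗᵢ[ℝ] Euc n, IsRotation θ ∧ rotSph θ e = u then
    ∫ v, φ (rotSph h.choose v) * f v ∂(surf n)
  else 0

/-! ### Minkowski valuations -/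

/-- `Φ` is a continuous, translation invariant Minkowski valuation on `ℝⁿ` that intertwines
rotations and is homogeneous of degree `i`. -/
structure IsMVal {n : ℕ} (i : ℕ) (Φ : ConvexBody (Euc n) → ConvexBody (Euc n)) : Prop where
  continuous : Continuous Φ
  valuation : ∀ K L U I : ConvexBody (Euc n),
    (U : Set (Euc n)) = (K : Set (Euc n)) ∪ L → (I : Set (Euc n)) = (K : Set (Euc n)) ∩ L →
      Φ K + Φ L = Φ U + Φ I
  translation : ∀ (K : ConvexBody (Euc n)) (x : Euc n), Φ (K + pointBody x) = Φ K
  rotation : ∀ (K : ConvexBody (Euc n)) (θ : Euc n ≃ₗᵢ[ℝ] Euc n), IsRotation θ →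
    Φ (rotBody θ K) = rotBody θ (Φ K)
  homogeneous : ∀ (K : ConvexBody (Euc n)) (c : ℝ), 0 ≤ c → Φ (c • K) = c ^ i • Φ K

/-- `Φ K ⊆ Φ L` whenever `K ⊆ L` and the Steiner points of `K` and `L` are at the origin. -/
def WeaklyMonotone {n : ℕ} (Φ : ConvexBody (Euc n) → ConvexBody (Euc n)) : Prop :=
  ∀ K L : ConvexBody (Euc n), (K : Set (Euc n)) ⊆ L → steinerPoint K = 0 → steinerPoint L = 0 →
    (Φ K : Set (Euc n)) ⊆ Φ L

/-- `f ∈ L¹(𝕊ⁿ⁻¹)` is the generating function of `Φ`: it is centered and zonal, and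
`h(Φ K, ·) = S_i(K, ·) ∗ f` for every convex body `K`, as an identity of distributions, where
`⟨φ, S_i(K, ·) ∗ f⟩ = ∫ (φ ∗ f) dS_i(K, ·)`. -/
structure IsGeneratingFunction {n : ℕ} (e : Sph n) (i : ℕ)
    (Φ : ConvexBody (Euc n) → ConvexBody (Euc n)) (f : Sph n → ℝ) : Prop where
  integrable : Integrable f (surf n)
  zonal : ZonalFun e f
  centered : Centered f
  representation : ∀ (K : ConvexBody (Euc n)) (φ : Sph n → ℝ), SmoothSph φ →
    ∫ u, φ u * supp (Φ K) (u : Euc n) ∂(surf n) = ∫ u, sphConv e φ f u ∂(areaMeasure K i)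

end ZonalMultipliers

end

namespace ZonalMultipliers

/-! ### Legendre polynomials -/

section Legendre

/-! Put `λ = (n-2)/2`. Both parts rest on one pointwise estimate, `|P_k(t)| ≤ C min(1, (k
√(1-t²))^(-λ))`. With `t = cos θ`, the function `v = sin^λ θ · P_k(cos θ)` solves `v'' + Q v = 0`,
where `Q = (k+λ)² + λ(1-λ)/sin² θ`. The energy `v'² + Q v²`, or its quotient by `Q`, decreases from
the equator towards the poles, and at the equator it is computed from the recurrence
(`exists_legendre_decay`). Cutting the sphere into dyadic polar caps of radius `2^j/k` turns this
into `|P_k| ≤ C (∑_j 2^(-bj) 1_{cap_j} + 2^(-bJ))` with `2^J` comparable to `k`, for any `0 ≤ b ≤ λ`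
(`exists_legendre_majorant`).

Part (1): integrating the majorant with `b = λ` against `|μ|`, whose mass on the `j`-th cap is
`O((2^j/k)^α)`, leaves a geometric sum of ratio `2^(α-λ)`. The three cases are ratio below, equal to
and above `1`.

Part (2): the same scheme applies with `□_n f` in place of `μ`, once two facts are known. First,
`□_n f` is nonnegative on nonnegative centered zonal `C²` functions. Indeed, if `p ≥ 0`, the body
with support function `1 + ε p` contains the unit ball, and the derivative at `ε = 0` of its `i`-th
area density is a positive multiple of `□_n p`; weak monotonicity gives the sign
(`integral_mul_box_nonneg`).

Second, `□_n f` has mass `O(r)` on polar caps of radius `r`. The test body is a lens inside a ball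
of fixed size whose principal radii of curvature near the poles all equal `R ~ 1/r`. Let `q` be its
support function and `p ≤ q` a cutoff of the cap. Comparing `q + ε p` with `(1+ε) q` gives `R^(i-1)
⟨p, □_n f⟩ ≤ C`, and `i > 1` gives the bound (`exists_integral_mul_box_cap_le`). Summing over dyadic
caps with `α = 1` and `b = 1/2 ≤ λ` gives `O(k^(-1/2))`.

To test against bodies of revolution, their area measures are computed from the local Steiner
formula: the parallel set is the image of a cone under `y ↦ y + ∇h(y)`, whose Jacobian is a product
in the principal radii. Since `Φ` is evaluated only through its convolution with smooth test
functions, an approximate identity passes from `h(Φ K) ≤ h(Φ L)` to the integrals of `f` against the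
area densities (`integral_mul_curv_mono`). -/

theorem legendre_succ_succ (n k : ℕ) (t : ℝ) (hn : 2 ≤ n) :
    ((k : ℝ) + n - 1) * legendre n (k + 2) t
      = (2 * (k : ℝ) + n) * t * legendre n (k + 1) t - ((k : ℝ) + 1) * legendre n k t := by
  have h : (k : ℝ) + n - 1 ≠ 0 := by
    have : (2 : ℝ) ≤ n := by exact_mod_cast hn
    have : (0 : ℝ) ≤ k := k.cast_nonneg
    linarith
  rw [legendre]
  field_simp

theorem contDiff_legendre (n k : ℕ) : ContDiff ℝ ∞ (legendre n k) := by
  induction k using Nat.strong_induction_on with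
  | _ k ih =>
    match k with
    | 0 => rw [show legendre n 0 = fun _ => (1 : ℝ) by funext t; simp [legendre]]
           exact contDiff_const
    | 1 => rw [show legendre n 1 = id by funext t; simp [legendre]]
           exact contDiff_id
    | k + 2 =>
      have h1 := ih (k + 1) (by omega)
      have h0 := ih k (by omega)
      have : ContDiff ℝ ∞ fun t : ℝ =>
          ((2 * (k : ℝ) + n) * t * legendre n (k + 1) t - ((k : ℝ) + 1) * legendre n k t)
            / ((k : ℝ) + n - 1) := by fun_prop
      rwa [show legendre n (k + 2) = _ from funext fun t => by rw [legendre]]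

theorem hasDerivAt_legendre (n k : ℕ) (t : ℝ) :
    HasDerivAt (legendre n k) (deriv (legendre n k) t) t :=
  ((contDiff_legendre n k).differentiable (by simp) t).hasDerivAt

theorem contDiff_deriv_legendre (n k : ℕ) : ContDiff ℝ ∞ (deriv (legendre n k)) :=
  ((contDiff_infty_iff_deriv).1 (contDiff_legendre n k)).2

theorem hasDerivAt_deriv_legendre (n k : ℕ) (t : ℝ) :
    HasDerivAt (deriv (legendre n k)) (deriv (deriv (legendre n k)) t) t :=
  ((contDiff_deriv_legendre n k).differentiable (by simp) t).hasDerivAt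

theorem legendre_one (n k : ℕ) (hn : 2 ≤ n) : legendre n k 1 = 1 := by
  induction k using Nat.strong_induction_on with
  | _ k ih =>
    match k with
    | 0 => simp [legendre]
    | 1 => simp [legendre]
    | k + 2 =>
      have h : (k : ℝ) + n - 1 ≠ 0 := by
        have : (2 : ℝ) ≤ n := by exact_mod_cast hn
        have : (0 : ℝ) ≤ k := k.cast_nonneg
        linarith
      have := legendre_succ_succ n k 1 hn
      rw [ih (k + 1) (by omega), ih k (by omega)] at this
      apply mul_left_cancel₀ h
      linarith

theorem legendre_neg (n k : ℕ) (t : ℝ) : legendre n k (-t) = (-1) ^ k * legendre n k t := by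
  induction k using Nat.strong_induction_on with
  | _ k ih =>
    match k with
    | 0 => simp [legendre]
    | 1 => simp [legendre]
    | k + 2 =>
      rw [legendre, legendre, ih (k + 1) (by omega), ih k (by omega)]
      ring

/-- The two first order differential relations between consecutive Legendre polynomials. -/
theorem deriv_legendre_relations (n k : ℕ) (hn : 2 ≤ n) (t : ℝ) :
    (1 - t ^ 2) * deriv (legendre n (k + 1)) t
        = ((k : ℝ) + 1) * (legendre n k t - t * legendre n (k + 1) t) ∧
      (1 - t ^ 2) * deriv (legendre n k) t
        = ((k : ℝ) + n - 2) * (t * legendre n k t - legendre n (k + 1) t) := by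
  have hn' : (2 : ℝ) ≤ n := by exact_mod_cast hn
  induction k with
  | zero =>
    have h0 : legendre n 0 = fun _ => (1 : ℝ) := by funext s; simp [legendre]
    have h1 : legendre n (0 + 1) = fun s : ℝ => s := by funext s; simp [legendre]
    rw [h0, h1]
    simp
    ring
  | succ k ih =>
    obtain ⟨ih1, ih2⟩ := ih
    have hk : (0 : ℝ) ≤ k := k.cast_nonneg
    have h : (k : ℝ) + n - 1 ≠ 0 := by linarith
    have hr := legendre_succ_succ n k t hn
    have hd : ((k : ℝ) + n - 1) * deriv (legendre n (k + 2)) t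
        = (2 * (k : ℝ) + n) * (legendre n (k + 1) t + t * deriv (legendre n (k + 1)) t)
          - ((k : ℝ) + 1) * deriv (legendre n k) t := by
      have e1 := (hasDerivAt_legendre n (k + 2) t).const_mul ((k : ℝ) + n - 1)
      have e2 := ((((hasDerivAt_id t).const_mul (2 * (k : ℝ) + n)).mul
        (hasDerivAt_legendre n (k + 1) t)).sub
          ((hasDerivAt_legendre n k t).const_mul ((k : ℝ) + 1)))
      have e3 := e1.unique (e2.congr_of_eventuallyEq
        (Eventually.of_forall fun s => by
          simpa using legendre_succ_succ n k s hn))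
      rw [e3]
      simp
      ring
    constructor
    -- After multiplication by `k + n - 1` the first relation at `k + 1` is a combination of both
    -- relations at `k` and the recurrence, which is why the two are proved by a common induction.
    · apply mul_left_cancel₀ h
      push_cast
      have : ((k : ℝ) + n - 1) * ((1 - t ^ 2) * deriv (legendre n (k + 2)) t)
          = (1 - t ^ 2) * (((k : ℝ) + n - 1) * deriv (legendre n (k + 2)) t) := by ring
      rw [show k + 1 + 1 = k + 2 from rfl, this, hd]
      linear_combination (2 * (k : ℝ) + n) * t * ih1 - ((k : ℝ) + 1) * ih2 + ((k : ℝ) + 2) * t * hr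
    · push_cast
      rw [ih1]
      linear_combination hr

/-- The Legendre differential equation. -/
theorem legendre_ode (n k : ℕ) (hn : 2 ≤ n) {t : ℝ} (ht : 1 - t ^ 2 ≠ 0) :
    (1 - t ^ 2) * deriv (deriv (legendre n k)) t
      = ((n : ℝ) - 1) * t * deriv (legendre n k) t - k * ((k : ℝ) + n - 2) * legendre n k t := by
  have hw : HasDerivAt (fun s : ℝ => 1 - s ^ 2) (-(2 * t)) t := by
    simpa using ((hasDerivAt_pow 2 t).const_sub 1)
  have e1 := hw.mul (hasDerivAt_deriv_legendre n k t)
  have e2 := ((((hasDerivAt_id t).mul (hasDerivAt_legendre n k t)).sub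
    (hasDerivAt_legendre n (k + 1) t)).const_mul ((k : ℝ) + n - 2))
  have e3 := e1.unique (e2.congr_of_eventuallyEq
    (Eventually.of_forall fun s => by simpa using (deriv_legendre_relations n k hn s).2))
  simp only [id] at e3
  obtain ⟨r1, r2⟩ := deriv_legendre_relations n k hn t
  -- The derivative of the second relation still contains `P_{k+1}` and `P_{k+1}'`; both relations,
  -- multiplied by `1 - t²`, eliminate them.
  apply mul_left_cancel₀ ht
  linear_combination (1 - t ^ 2) * e3 - ((k : ℝ) + n - 2) * r1 + ((k : ℝ) + 1) * t * r2

end Legendre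

/-! ### Uniform bound, equatorial values and energy of Legendre polynomials -/

section LegendreBounds

theorem sq_legendre_neg (n k : ℕ) (t : ℝ) : legendre n k (-t) ^ 2 = legendre n k t ^ 2 := by
  rw [legendre_neg, mul_pow, ← pow_mul, mul_comm k 2, pow_mul]
  simp

theorem sq_legendre_abs (n k : ℕ) (t : ℝ) : legendre n k |t| ^ 2 = legendre n k t ^ 2 := by
  rcases abs_choice t with h | h <;> rw [h]
  exact sq_legendre_neg n k t

/-- Sonine's argument: `S = N P² + (1-s²) P'²` with `N = k(k+n-2)` has derivative `2(n-2) s P'² ≥ 0`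
on `[0,1]` by the differential equation, so `N P(t)² ≤ S(t) ≤ S(1) = N`. Parity reduces to `t ≥ 0`.
-/
theorem abs_legendre_le_one (n k : ℕ) (hn : 2 ≤ n) {t : ℝ} (ht : |t| ≤ 1) :
    |legendre n k t| ≤ 1 := by
  rcases Nat.eq_zero_or_pos k with rfl | hk
  · simp [legendre]
  have hn' : (2 : ℝ) ≤ n := by exact_mod_cast hn
  have hk' : (1 : ℝ) ≤ k := by exact_mod_cast hk
  set N : ℝ := k * ((k : ℝ) + n - 2) with hN
  have hNpos : 0 < N := by apply mul_pos <;> linarith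
  rw [← sq_le_one_iff_abs_le_one, ← sq_legendre_abs]
  set P := legendre n k
  set S : ℝ → ℝ := fun s => N * P s ^ 2 + (1 - s ^ 2) * deriv P s ^ 2 with hS
  have hder : ∀ s, HasDerivAt S (N * (2 * P s * deriv P s) + (-(2 * s) * deriv P s ^ 2
      + (1 - s ^ 2) * (2 * deriv P s * deriv (deriv P) s))) s := by
    intro s
    have hw : HasDerivAt (fun s : ℝ => 1 - s ^ 2) (-(2 * s)) s := by
      simpa using ((hasDerivAt_pow 2 s).const_sub 1)
    have h1 := (hasDerivAt_legendre n k s).pow 2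
    have h2 := (hasDerivAt_deriv_legendre n k s).pow 2
    refine ((h1.const_mul N).add (hw.mul h2)).congr_deriv ?_
    simp [P]
  have hmono : MonotoneOn S (Set.Icc 0 1) := by
    apply monotoneOn_of_deriv_nonneg (convex_Icc 0 1)
    · exact fun s _ => (hder s).continuousAt.continuousWithinAt
    · exact fun s _ => (hder s).differentiableAt.differentiableWithinAt
    · intro s hs
      rw [interior_Icc] at hs
      rw [(hder s).deriv]
      have hw : 1 - s ^ 2 ≠ 0 := by nlinarith [hs.1, hs.2]
      have ode := legendre_ode n k hn hw
      have : N * (2 * P s * deriv P s) + (-(2 * s) * deriv P s ^ 2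
          + (1 - s ^ 2) * (2 * deriv P s * deriv (deriv P) s))
          = 2 * ((n : ℝ) - 2) * s * deriv P s ^ 2 := by
        linear_combination 2 * deriv P s * ode
      rw [this]
      have := hs.1
      have : 0 ≤ (n : ℝ) - 2 := by linarith
      positivity
  have h := hmono ⟨abs_nonneg t, ht⟩ ⟨zero_le_one, le_rfl⟩ ht
  have h1 : S 1 = N := by simp [hS, P, legendre_one n k hn]
  rw [h1] at h
  have h2 : 0 ≤ (1 - |t| ^ 2) * deriv P |t| ^ 2 := by
    have : |t| ^ 2 ≤ 1 := pow_le_one₀ (abs_nonneg t) ht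
    have : 0 ≤ 1 - |t| ^ 2 := by linarith
    positivity
  have h3 : N * P |t| ^ 2 ≤ N * 1 := by
    simp only [hS] at h
    linarith
  exact le_of_mul_le_mul_left h3 hNpos

/-- At `0` the recurrence is `P_{k+2}(0) = -(k+1)/(k+s) P_k(0)` with `s = n-1`. The factor is `1 -
2λ/(k+s) ≤ exp(-2/(k+s))^λ ≤ ((k+s)/(k+2+s))^λ`, and the last expression telescopes along the parity
class. -/
theorem abs_legendre_zero_le (n k : ℕ) (hn : 2 ≤ n) :
    |legendre n k 0| ≤ (((n : ℝ) - 1) / (k + ((n : ℝ) - 1))) ^ (((n : ℝ) - 2) / 2) := by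
  have hn' : (2 : ℝ) ≤ n := by exact_mod_cast hn
  induction k using Nat.strong_induction_on with
  | _ k ih =>
    match k with
    | 0 =>
      have : (n : ℝ) - 1 ≠ 0 := by linarith
      simp [legendre, this]
    | 1 =>
      simp only [legendre, abs_zero]
      apply Real.rpow_nonneg
      have : 0 ≤ (n : ℝ) - 1 := by linarith
      positivity
    | k + 2 =>
      have hk : (0 : ℝ) ≤ k := k.cast_nonneg
      have h0 := ih k (by omega)
      set lam := ((n : ℝ) - 2) / 2 with hlam
      set s := (n : ℝ) - 1 with hs
      have hs0 : 0 < s := by linarith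
      have hks : 0 < (k : ℝ) + s := by linarith
      have hrec : legendre n (k + 2) 0 = -(((k : ℝ) + 1) / (k + s)) * legendre n k 0 := by
        have := legendre_succ_succ n k 0 hn
        have e : (k : ℝ) + n - 1 = k + s := by rw [hs]; ring
        rw [e] at this
        field_simp
        linarith
      have hlam0 : 0 ≤ lam := by rw [hlam]; linarith
      have e1 : ((k : ℝ) + 1) / (k + s) ≤ Real.exp (-(2 / (k + s)) * lam) := by
        have : ((k : ℝ) + 1) / (k + s) = -(2 / (k + s)) * lam + 1 := by
          field_simp
          rw [hlam, hs]; ring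
        rw [this]
        exact Real.add_one_le_exp _
      have e2 : Real.exp (-(2 / (k + s))) ≤ (k + s) / (k + 2 + s) := by
        rw [Real.exp_neg]
        have h3 := Real.add_one_le_exp (2 / (k + s))
        have h4 : (k + s) / (k + 2 + s) = (2 / (k + s) + 1)⁻¹ := by
          field_simp
          ring
        rw [h4]
        exact inv_anti₀ (by positivity) h3
      have e3 : ((k : ℝ) + 1) / (k + s) ≤ ((k + s) / (k + 2 + s)) ^ lam := by
        refine e1.trans ?_
        rw [Real.exp_mul]
        exact Real.rpow_le_rpow (Real.exp_nonneg _) e2 hlam0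
      rw [hrec, abs_mul, abs_neg, abs_of_nonneg (by positivity)]
      calc ((k : ℝ) + 1) / (k + s) * |legendre n k 0|
          ≤ ((k + s) / (k + 2 + s)) ^ lam * (s / (k + s)) ^ lam :=
            mul_le_mul e3 h0 (abs_nonneg _) (by positivity)
        _ = (s / ((k + 2 : ℕ) + s)) ^ lam := by
            rw [← Real.mul_rpow (by positivity) (by positivity)]
            congr 1
            push_cast
            field_simp

/-- The energy of the Legendre differential equation in Liouville normal form. -/
noncomputable def legendreEnergy (n k : ℕ) (t : ℝ) : ℝ :=
  (1 - t ^ 2) ^ (((n : ℝ) - 2) / 2 - 1) *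
    ((1 - t ^ 2) ^ 2 * deriv (legendre n k) t ^ 2
      - ((n : ℝ) - 2) * t * (1 - t ^ 2) * legendre n k t * deriv (legendre n k) t
      + (((n : ℝ) - 2) / 2 + k * ((k : ℝ) + n - 2) * (1 - t ^ 2)) * legendre n k t ^ 2)

/-- In the variable `θ` the energy is `v'² + Q v²` for a solution of `v'' + Q v = 0`, so its
derivative is `Q' v²`: only the explicit dependence of `Q` on the position survives. Its sign on `t
≥ 0` is that of `λ(1-λ)`. -/
theorem hasDerivAt_legendreEnergy (n k : ℕ) (hn : 2 ≤ n) {t : ℝ} (ht : 0 < 1 - t ^ 2) :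
    HasDerivAt (legendreEnergy n k)
      (2 * (((n : ℝ) - 2) / 2) * (1 - ((n : ℝ) - 2) / 2) * t
        * (1 - t ^ 2) ^ (((n : ℝ) - 2) / 2 - 2) * legendre n k t ^ 2) t := by
  set lam := ((n : ℝ) - 2) / 2 with hlam
  have hnl : (n : ℝ) = 2 * lam + 2 := by rw [hlam]; ring
  have hw : HasDerivAt (fun s : ℝ => 1 - s ^ 2) (-(2 * t)) t := by
    simpa using ((hasDerivAt_pow 2 t).const_sub 1)
  have hP := hasDerivAt_legendre n k t
  have hD := hasDerivAt_deriv_legendre n k t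
  have ode := legendre_ode n k hn ht.ne'
  have hpow := hw.rpow_const (p := lam - 1) (Or.inl ht.ne')
  have h1 := (hw.pow 2).mul (hD.pow 2)
  have h2 := (((((hasDerivAt_id t).const_mul ((n : ℝ) - 2)).mul hw).mul hP).mul hD)
  have h3 := ((hw.const_mul ((k : ℝ) * ((k : ℝ) + n - 2))).const_add lam).mul (hP.pow 2)
  have h := hpow.mul ((h1.sub h2).add h3)
  have e : lam - 1 - 1 = lam - 2 := by ring
  refine (h.congr_of_eventuallyEq (Eventually.of_forall fun s => ?_)).congr_deriv ?_
  · simp [legendreEnergy, hlam]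
  · have e2 : (1 - t ^ 2) ^ (lam - 1) = (1 - t ^ 2) ^ (lam - 2) * (1 - t ^ 2) := by
      rw [← Real.rpow_add_one ht.ne']
      congr 1
      ring
    simp only [Pi.mul_apply, Pi.sub_apply, Pi.add_apply, Pi.pow_apply, id, e, e2]
    set W := (1 - t ^ 2) ^ (lam - 2)
    rw [hnl] at ode ⊢
    push_cast
    linear_combination W * (1 - t ^ 2) * (2 * (1 - t ^ 2) * deriv (legendre n k) t
      - 2 * lam * t * legendre n k t) * ode

end LegendreBounds

/-! ### Decay of Legendre polynomials away from the poles -/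

section LegendreDecay

/-- Completing the square exhibits the two terms `v'²` and `Q v²`; the latter controls `P²` wherever
`Q` is positive. -/
theorem legendreEnergy_eq (n k : ℕ) (t : ℝ) :
    legendreEnergy n k t = (1 - t ^ 2) ^ (((n : ℝ) - 2) / 2 - 1) *
      (((1 - t ^ 2) * deriv (legendre n k) t - ((n : ℝ) - 2) / 2 * t * legendre n k t) ^ 2
        + (((k : ℝ) + ((n : ℝ) - 2) / 2) ^ 2 * (1 - t ^ 2)
          + ((n : ℝ) - 2) / 2 * (1 - ((n : ℝ) - 2) / 2)) * legendre n k t ^ 2) := by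
  rw [legendreEnergy]
  ring

/-- At the equator `P_k(0)` is `O(k^(-λ))`, and the first derivative relation gives `P_k'(0) = k
P_{k-1}(0)`, so the energy is `O(k² k^(-2λ))`. -/
theorem legendreEnergy_zero_le (n k : ℕ) (hn : 2 ≤ n) (hk : 1 ≤ k) :
    legendreEnergy n k 0 ≤ (2 + 3 * (((n : ℝ) - 2) / 2)) * (k : ℝ) ^ 2
      * ((((n : ℝ) - 1) / k) ^ (((n : ℝ) - 2) / 2)) ^ 2 := by
  have hn' : (2 : ℝ) ≤ n := by exact_mod_cast hn
  have hk' : (1 : ℝ) ≤ k := by exact_mod_cast hk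
  set lam := ((n : ℝ) - 2) / 2 with hlam
  have hlam0 : 0 ≤ lam := by rw [hlam]; linarith
  set X := (((n : ℝ) - 1) / k) ^ lam with hX
  have hX0 : 0 ≤ X := Real.rpow_nonneg (div_nonneg (by linarith) (by linarith)) _
  have hP : |legendre n k 0| ≤ X := by
    refine (abs_legendre_zero_le n k hn).trans ?_
    apply Real.rpow_le_rpow (div_nonneg (by linarith) (by linarith)) _ hlam0
    apply div_le_div_of_nonneg_left <;> linarith
  have hD : |deriv (legendre n k) 0| ≤ k * X := by
    obtain ⟨j, rfl⟩ : ∃ j, k = j + 1 := ⟨k - 1, by omega⟩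
    have h := (deriv_legendre_relations n j hn 0).1
    have h' : deriv (legendre n (j + 1)) 0 = ((j : ℝ) + 1) * legendre n j 0 := by
      simpa using h
    have hj : |legendre n j 0| ≤ X := by
      refine (abs_legendre_zero_le n j hn).trans ?_
      apply Real.rpow_le_rpow (div_nonneg (by linarith) ?_) _ hlam0
      · have : (0 : ℝ) ≤ j := j.cast_nonneg
        linarith
      · push_cast
        apply div_le_div_of_nonneg_left
        · linarith
        · have : (0 : ℝ) ≤ j := j.cast_nonneg
          linarith
        · linarith
    rw [h', abs_mul, abs_of_nonneg (by positivity)]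
    push_cast
    gcongr
  have hP2 : legendre n k 0 ^ 2 ≤ X ^ 2 := by
    rw [← sq_abs]; gcongr
  have hD2 : deriv (legendre n k) 0 ^ 2 ≤ (k * X) ^ 2 := by
    rw [← sq_abs]; gcongr
  have hE : legendreEnergy n k 0 = deriv (legendre n k) 0 ^ 2
      + (lam + k * ((k : ℝ) + 2 * lam)) * legendre n k 0 ^ 2 := by
    have : (n : ℝ) = 2 * lam + 2 := by rw [hlam]; ring
    rw [legendreEnergy]
    simp only [← hlam]
    have e : (k : ℝ) + n - 2 = k + 2 * lam := by rw [this]; ring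
    rw [e]
    norm_num
  rw [hE]
  have hN : lam + k * ((k : ℝ) + 2 * lam) ≤ (1 + 3 * lam) * (k : ℝ) ^ 2 := by
    have h1 : lam * 1 ≤ lam * (k : ℝ) ^ 2 := by gcongr; exact one_le_pow₀ hk'
    have h2 : lam * (k : ℝ) ≤ lam * (k : ℝ) ^ 2 := by
      gcongr; exact le_self_pow₀ hk' (by norm_num)
    linarith
  calc deriv (legendre n k) 0 ^ 2 + (lam + k * ((k : ℝ) + 2 * lam)) * legendre n k 0 ^ 2
      ≤ (k * X) ^ 2 + (1 + 3 * lam) * (k : ℝ) ^ 2 * X ^ 2 := by gcongr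
    _ = _ := by ring

/-- The left side is `k² v²`. For `λ ≤ 1` the potential `Q` is at least `k²` and grows towards the
pole, so that `v² + v'²/Q` decreases. For `λ > 1` the energy itself decreases, but `Q` becomes
negative close to the pole; the hypothesis keeps `t` where `Q ≥ k²/2`. -/
theorem rpow_mul_sq_legendre_le (n k : ℕ) (hn : 3 ≤ n) (hk : 1 ≤ k) {t : ℝ} (ht0 : 0 ≤ t)
    (ht1 : t < 1) (h : ((n : ℝ) - 2) / 2 ≤ 1 ∨ 2 * (((n : ℝ) - 2) / 2) ^ 2 ≤ k ^ 2 * (1 - t ^ 2)) :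
    (1 - t ^ 2) ^ (((n : ℝ) - 2) / 2) * legendre n k t ^ 2 * (k : ℝ) ^ 2
      ≤ 2 * legendreEnergy n k 0 := by
  have hn2 : 2 ≤ n := by omega
  have hn' : (3 : ℝ) ≤ n := by exact_mod_cast hn
  have hk' : (1 : ℝ) ≤ k := by exact_mod_cast hk
  have hE := legendreEnergy_eq n k t
  have hder := fun s hs => hasDerivAt_legendreEnergy n k hn2 (t := s) hs
  have hE0 : 0 ≤ legendreEnergy n k 0 ∨ 1 ≤ ((n : ℝ) - 2) / 2 := by
    by_cases h1 : 1 ≤ ((n : ℝ) - 2) / 2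
    · exact Or.inr h1
    · left
      rw [legendreEnergy_eq]
      norm_num
      apply add_nonneg (sq_nonneg _)
      apply mul_nonneg _ (sq_nonneg _)
      apply add_nonneg (sq_nonneg _)
      apply mul_nonneg <;> linarith
  set lam := ((n : ℝ) - 2) / 2 with hlam
  have hlam0 : 0 < lam := by rw [hlam]; linarith
  have hw : ∀ s ∈ Set.Icc 0 t, 0 < 1 - s ^ 2 := fun s hs => by nlinarith [hs.1, hs.2]
  have hwt := hw t ⟨ht0, le_rfl⟩
  have hpow : (1 - t ^ 2) ^ lam = (1 - t ^ 2) ^ (lam - 1) * (1 - t ^ 2) := by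
    rw [← Real.rpow_add_one hwt.ne']
    congr 1
    ring
  set P := legendre n k
  by_cases hl : lam ≤ 1
  · have hE0' : 0 ≤ legendreEnergy n k 0 := by
      rcases hE0 with h0 | h0
      · exact h0
      · rw [legendreEnergy_eq]
        norm_num
        apply add_nonneg (sq_nonneg _)
        apply mul_nonneg _ (sq_nonneg _)
        apply add_nonneg (sq_nonneg _)
        apply mul_nonneg <;> linarith
    -- The potential of the normal form as a function of `s = cos θ`. The derivative of `E/Q` is a
    -- negative multiple of `Q' v'²/Q²`, since the `v²` terms cancel.
    set Q : ℝ → ℝ := fun s => (k + lam) ^ 2 + lam * (1 - lam) * (1 - s ^ 2)⁻¹ with hQ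
    have hQpos : ∀ s ∈ Set.Icc 0 t, 0 < Q s := fun s hs => by
      have := hw s hs
      have h1 : 0 ≤ 1 - lam := by linarith
      simp only [hQ]
      positivity
    have hQder : ∀ s ∈ Set.Icc 0 t, HasDerivAt Q
        (lam * (1 - lam) * (2 * s / (1 - s ^ 2) ^ 2)) s := by
      intro s hs
      have hw' : HasDerivAt (fun s : ℝ => 1 - s ^ 2) (-(2 * s)) s := by
        simpa using ((hasDerivAt_pow 2 s).const_sub 1)
      refine (((hw'.inv (hw s hs).ne').const_mul (lam * (1 - lam))).const_add _).congr_deriv ?_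
      simp
    have hquot : ∀ s ∈ Set.Icc 0 t, HasDerivAt (fun s => legendreEnergy n k s / Q s) _ s :=
      fun s hs => (hder s (hw s hs)).div (hQder s hs) (hQpos s hs).ne'
    have hanti : AntitoneOn (fun s => legendreEnergy n k s / Q s) (Set.Icc 0 t) := by
      apply antitoneOn_of_deriv_nonpos (convex_Icc 0 t)
      · exact fun s hs => (hquot s hs).continuousAt.continuousWithinAt
      · intro s hs
        rw [interior_Icc] at hs
        exact (hquot s (Set.Ioo_subset_Icc_self hs)).differentiableAt.differentiableWithinAt
      · intro s hs
        rw [interior_Icc] at hs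
        have hs' := Set.Ioo_subset_Icc_self hs
        have hws := hw s hs'
        rw [(hquot s hs').deriv]
        apply div_nonpos_of_nonpos_of_nonneg _ (sq_nonneg _)
        have e2 : (1 - s ^ 2) ^ (lam - 1) = (1 - s ^ 2) ^ (lam - 2) * (1 - s ^ 2) := by
          rw [← Real.rpow_add_one hws.ne']
          congr 1
          ring
        rw [legendreEnergy_eq, e2]
        simp only [hQ, ← hlam]
        have h1 : 0 ≤ 1 - lam := by linarith
        have hs0 := hs.1.le
        have key : 2 * lam * (1 - lam) * s * (1 - s ^ 2) ^ (lam - 2) * P s ^ 2 *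
            ((k + lam) ^ 2 + lam * (1 - lam) * (1 - s ^ 2)⁻¹) -
            (1 - s ^ 2) ^ (lam - 2) * (1 - s ^ 2) *
              (((1 - s ^ 2) * deriv P s - lam * s * P s) ^ 2 +
                ((k + lam) ^ 2 * (1 - s ^ 2) + lam * (1 - lam)) * P s ^ 2) *
              (lam * (1 - lam) * (2 * s / (1 - s ^ 2) ^ 2))
            = -((1 - s ^ 2) ^ (lam - 2) * ((1 - s ^ 2) * deriv P s - lam * s * P s) ^ 2
              * (lam * (1 - lam) * (2 * s)) * (1 - s ^ 2)⁻¹) := by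
          field_simp
          ring
        rw [key, neg_nonpos]
        positivity
    have hfin := hanti ⟨le_rfl, ht0⟩ ⟨ht0, le_rfl⟩ ht0
    have hQt := hQpos t ⟨ht0, le_rfl⟩
    have hQ0 := hQpos 0 ⟨le_rfl, ht0⟩
    simp only at hfin
    have h1 : (1 - t ^ 2) ^ lam * P t ^ 2 ≤ legendreEnergy n k t / Q t := by
      rw [le_div_iff₀ hQt, hE, hpow]
      have : (1 - t ^ 2) * Q t = (k + lam) ^ 2 * (1 - t ^ 2) + lam * (1 - lam) := by
        simp only [hQ]
        field_simp
      have e : (1 - t ^ 2) ^ (lam - 1) * (1 - t ^ 2) * P t ^ 2 * Q t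
          = (1 - t ^ 2) ^ (lam - 1) * (((k + lam) ^ 2 * (1 - t ^ 2) + lam * (1 - lam))
            * P t ^ 2) := by rw [← this]; ring
      rw [e]
      gcongr
      linarith [sq_nonneg ((1 - t ^ 2) * deriv P t - lam * t * P t)]
    have h2 := h1.trans hfin
    rw [le_div_iff₀ hQ0] at h2
    have h3 : (k : ℝ) ^ 2 ≤ Q 0 := by
      simp only [hQ]
      norm_num
      nlinarith
    have h4 : (1 - t ^ 2) ^ lam * P t ^ 2 * (k : ℝ) ^ 2 ≤ (1 - t ^ 2) ^ lam * P t ^ 2 * Q 0 := by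
      gcongr
    linarith
  · push Not at hl
    have hcond := h.resolve_left (by linarith)
    have hanti : AntitoneOn (legendreEnergy n k) (Set.Icc 0 t) := by
      apply antitoneOn_of_deriv_nonpos (convex_Icc 0 t)
      · exact fun s hs => (hder s (hw s hs)).continuousAt.continuousWithinAt
      · intro s hs
        rw [interior_Icc] at hs
        exact (hder s (hw s (Set.Ioo_subset_Icc_self hs))).differentiableAt.differentiableWithinAt
      · intro s hs
        rw [interior_Icc] at hs
        have hws := hw s (Set.Ioo_subset_Icc_self hs)
        rw [(hder s hws).deriv]
        have hs0 := hs.1.le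
        have h1 : 0 ≤ lam - 1 := by linarith
        have : 0 ≤ 2 * lam * (lam - 1) * s * (1 - s ^ 2) ^ (lam - 2) * legendre n k s ^ 2 := by
          positivity
        linarith
    have hfin := hanti ⟨le_rfl, ht0⟩ ⟨ht0, le_rfl⟩ ht0
    have h1 : (1 - t ^ 2) ^ lam * P t ^ 2 * (k : ℝ) ^ 2 ≤ 2 * legendreEnergy n k t := by
      rw [hE, hpow]
      -- This is `k² ≤ 2 Q(t)` multiplied by `1 - t²`: the negative term `λ(1-λ)` is absorbed
      -- because `λ² ≤ k²(1-t²)/2`.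
      have hq : (1 - t ^ 2) * (k : ℝ) ^ 2
          ≤ 2 * ((k + lam) ^ 2 * (1 - t ^ 2) + lam * (1 - lam)) := by
        have : (k : ℝ) ^ 2 ≤ (k + lam) ^ 2 := by gcongr; linarith
        nlinarith
      calc (1 - t ^ 2) ^ (lam - 1) * (1 - t ^ 2) * P t ^ 2 * (k : ℝ) ^ 2
          = (1 - t ^ 2) ^ (lam - 1) * (((1 - t ^ 2) * (k : ℝ) ^ 2) * P t ^ 2) := by ring
        _ ≤ (1 - t ^ 2) ^ (lam - 1) *
            ((2 * ((k + lam) ^ 2 * (1 - t ^ 2) + lam * (1 - lam))) * P t ^ 2) := by gcongr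
        _ ≤ (1 - t ^ 2) ^ (lam - 1) * (2 * (((1 - t ^ 2) * deriv P t - lam * t * P t) ^ 2
            + ((k + lam) ^ 2 * (1 - t ^ 2) + lam * (1 - lam)) * P t ^ 2)) := by
            refine mul_le_mul_of_nonneg_left ?_ (Real.rpow_nonneg hwt.le _)
            linarith [sq_nonneg ((1 - t ^ 2) * deriv P t - lam * t * P t)]
        _ = _ := by ring
    linarith

/-- Decay of the Legendre polynomials away from the poles. -/
theorem exists_legendre_decay (n : ℕ) (hn : 3 ≤ n) :
    ∃ C : ℝ, 0 < C ∧ ∀ (k : ℕ) (t : ℝ), 1 ≤ k → |t| ≤ 1 →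
      ((k : ℝ) ^ 2 * (1 - t ^ 2)) ^ (((n : ℝ) - 2) / 2) * legendre n k t ^ 2 ≤ C := by
  have hn' : (3 : ℝ) ≤ n := by exact_mod_cast hn
  set lam := ((n : ℝ) - 2) / 2 with hlam
  have hlam0 : 0 < lam := by rw [hlam]; linarith
  -- The first summand is the energy bound, used where `k²(1-t²) ≥ 2λ²`; the second covers the polar
  -- region, where `|P_k| ≤ 1` is used instead.
  refine ⟨2 * (2 + 3 * lam) * (((n : ℝ) - 1) ^ lam) ^ 2 + (2 * lam ^ 2) ^ lam, ?_, ?_⟩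
  · have : 0 < (n : ℝ) - 1 := by linarith
    positivity
  intro k t hk ht
  have hk' : (1 : ℝ) ≤ k := by exact_mod_cast hk
  have hwt : 0 ≤ 1 - t ^ 2 := by
    have := (sq_le_one_iff_abs_le_one t).2 ht
    linarith
  have hnn : 0 < (n : ℝ) - 1 := by linarith
  by_cases hc : 2 * lam ^ 2 ≤ k ^ 2 * (1 - t ^ 2)
  · have ht1 : |t| < 1 := by
      refine lt_of_le_of_ne ht fun h1 => ?_
      have : t ^ 2 = 1 := by rw [← sq_abs, h1]; norm_num
      rw [this] at hc
      have : 0 < lam ^ 2 := by positivity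
      linarith
    have h := rpow_mul_sq_legendre_le n k hn hk (abs_nonneg t) ht1
      (Or.inr (by rw [sq_abs]; exact hc))
    have h0 := legendreEnergy_zero_le n k (by omega) hk
    rw [sq_abs, sq_legendre_abs, ← hlam] at h
    rw [← hlam] at h0
    have hkp : 0 < (k : ℝ) := by linarith
    rw [Real.div_rpow hnn.le hkp.le] at h0
    have e : ((k : ℝ) ^ 2 * (1 - t ^ 2)) ^ lam = ((k : ℝ) ^ lam) ^ 2 * (1 - t ^ 2) ^ lam := by
      rw [Real.mul_rpow (by positivity) hwt, Real.rpow_pow_comm hkp.le]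
    rw [e]
    set X := (k : ℝ) ^ lam
    have hX : 0 < X := Real.rpow_pos_of_pos hkp _
    set Y := ((n : ℝ) - 1) ^ lam
    set A := (1 - t ^ 2) ^ lam * legendre n k t ^ 2
    have h1 : A * (k : ℝ) ^ 2 ≤ (2 * (2 + 3 * lam) * Y ^ 2 / X ^ 2) * (k : ℝ) ^ 2 := by
      refine (h.trans (mul_le_mul_of_nonneg_left h0 (by norm_num))).trans (le_of_eq ?_)
      field_simp
    have h2 := le_of_mul_le_mul_right h1 (by positivity)
    rw [le_div_iff₀ (by positivity)] at h2
    have : 0 ≤ (2 * lam ^ 2) ^ lam := by positivity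
    calc X ^ 2 * (1 - t ^ 2) ^ lam * legendre n k t ^ 2 = A * X ^ 2 := by simp only [A]; ring
      _ ≤ _ := by linarith
  · push Not at hc
    have h1 : legendre n k t ^ 2 ≤ 1 :=
      (sq_le_one_iff_abs_le_one _).2 (abs_legendre_le_one n k (by omega) ht)
    have h2 : ((k : ℝ) ^ 2 * (1 - t ^ 2)) ^ lam ≤ (2 * lam ^ 2) ^ lam := by
      apply Real.rpow_le_rpow (by positivity) hc.le hlam0.le
    have h3 : 0 ≤ 2 * (2 + 3 * lam) * (((n : ℝ) - 1) ^ lam) ^ 2 := by positivity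
    calc _ ≤ (2 * lam ^ 2) ^ lam * 1 := by gcongr
      _ ≤ _ := by linarith

end LegendreDecay

/-! ### Dyadic majorant and the resulting geometric sums -/

section Dyadic

/-- Used with `x = k²(1-t²)` and `y = |P_k(t)|`. Take the least `j` with `x < 4^j`, stopped at `J`.
If `j ≥ 1`, then `x ≥ 4^(j-1)`, so the decay gives `y ≤ √C 2^λ 2^(-λj)`; if `j = 0`, the bound `y ≤
1` suffices. -/
theorem exists_dyadic_le {lam C x y : ℝ} (hlam : 0 ≤ lam) (hy1 : y ≤ 1)
    (h : x ^ lam * y ^ 2 ≤ C) (J : ℕ) :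
    ∃ j ≤ J, (j < J → x < 4 ^ j) ∧ y ≤ (1 + √C * 2 ^ lam) * ((2 : ℝ) ^ (-lam)) ^ j := by
  have hex : ∃ j, j = J ∨ x < 4 ^ j := ⟨J, Or.inl rfl⟩
  classical
  set j := Nat.find hex with hj
  have hspec : j = J ∨ x < 4 ^ j := Nat.find_spec hex
  have hle : j ≤ J := Nat.find_min' hex (Or.inl rfl)
  refine ⟨j, hle, fun hlt => hspec.resolve_left hlt.ne, ?_⟩
  have ha : 0 < (2 : ℝ) ^ (-lam) := by positivity
  rcases Nat.eq_zero_or_pos j with h0 | hpos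
  · rw [h0, pow_zero, mul_one]
    have : 0 ≤ √C * (2 : ℝ) ^ lam := by positivity
    linarith
  · obtain ⟨i, hi⟩ : ∃ i, j = i + 1 := ⟨j - 1, by omega⟩
    have hmin := Nat.find_min hex (m := i) (by omega)
    push Not at hmin
    have hx : (4 : ℝ) ^ i ≤ x := hmin.2
    have h4 : ((4 : ℝ) ^ i) ^ lam = (((2 : ℝ) ^ lam) ^ i) ^ 2 := by
      rw [show (4 : ℝ) = 2 ^ 2 by norm_num, ← pow_mul, Real.rpow_pow_comm (by norm_num),
        Real.rpow_pow_comm (by positivity), ← pow_mul]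
      ring_nf
    have h1 : ((((2 : ℝ) ^ lam) ^ i) * y) ^ 2 ≤ C := by
      rw [mul_pow, ← h4]
      refine le_trans ?_ h
      gcongr
    have h2 : (((2 : ℝ) ^ lam) ^ i) * y ≤ √C := Real.le_sqrt_of_sq_le h1
    rw [hi, Real.rpow_neg (by norm_num)]
    have hp : 0 < (2 : ℝ) ^ lam := by positivity
    calc y = (((2 : ℝ) ^ lam)⁻¹) ^ i * ((((2 : ℝ) ^ lam) ^ i) * y) := by
          rw [inv_pow]
          field_simp
      _ ≤ (((2 : ℝ) ^ lam)⁻¹) ^ i * √C := by gcongr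
      _ = (√C * 2 ^ lam) * (((2 : ℝ) ^ lam)⁻¹) ^ (i + 1) := by
          rw [inv_pow, inv_pow, pow_succ]
          field_simp
      _ ≤ _ := by gcongr; linarith

/-- A majorant of the Legendre polynomials by a sum of functions that dominate the indicator
functions of dyadic polar caps. -/
theorem exists_legendre_majorant (n : ℕ) (hn : 3 ≤ n) {b : ℝ} (hb0 : 0 ≤ b)
    (hb : b ≤ ((n : ℝ) - 2) / 2) :
    ∃ C : ℝ, 0 < C ∧ ∀ (k : ℕ) (t : ℝ) (J : ℕ) (c : ℕ → ℝ), 1 ≤ k → |t| ≤ 1 → (∀ j, 0 ≤ c j) →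
      (∀ j, (k : ℝ) ^ 2 * (1 - t ^ 2) < 4 ^ j → 1 ≤ c j) →
      |legendre n k t| ≤ C * (∑ j ∈ Finset.range J, ((2 : ℝ) ^ (-b)) ^ j * c j
        + ((2 : ℝ) ^ (-b)) ^ J) := by
  obtain ⟨C, hC, hdec⟩ := exists_legendre_decay n hn
  set lam := ((n : ℝ) - 2) / 2 with hlam
  refine ⟨1 + √C * 2 ^ lam, by positivity, fun k t J c hk ht hc0 hc1 => ?_⟩
  obtain ⟨j, hjJ, hjx, hy⟩ := exists_dyadic_le (lam := lam) (C := C) (hb0.trans hb)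
    (abs_legendre_le_one n k (by omega) ht)
    (by rw [sq_abs]; exact hdec k t hk ht) J
  refine hy.trans ?_
  have h1 : ((2 : ℝ) ^ (-lam)) ^ j ≤ ((2 : ℝ) ^ (-b)) ^ j := by
    gcongr
    norm_num
  -- Either `j < J`, and the `j`-th summand alone dominates because the point lies in that cap, or
  -- `j = J`, and the last term does. Only a lower bound for `c` on the caps enters, so `c` may be
  -- an indicator function or a smooth cutoff.
  have h2 : ((2 : ℝ) ^ (-b)) ^ j ≤ ∑ j ∈ Finset.range J, ((2 : ℝ) ^ (-b)) ^ j * c j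
        + ((2 : ℝ) ^ (-b)) ^ J := by
    have hnn : ∀ i ∈ Finset.range J, 0 ≤ ((2 : ℝ) ^ (-b)) ^ i * c i :=
      fun i _ => mul_nonneg (by positivity) (hc0 i)
    rcases hjJ.eq_or_lt with rfl | hlt
    · have := Finset.sum_nonneg hnn
      linarith
    · have h3 := Finset.single_le_sum hnn (Finset.mem_range.2 hlt)
      have h4 : ((2 : ℝ) ^ (-b)) ^ j * 1 ≤ ((2 : ℝ) ^ (-b)) ^ j * c j := by
        gcongr
        exact hc1 j (hjx hlt)
      have h5 : 0 ≤ ((2 : ℝ) ^ (-b)) ^ J := by positivity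
      linarith
  gcongr
  exact h1.trans h2

theorem exists_two_pow_between {k : ℕ} (hk : 1 ≤ k) : ∃ J : ℕ, k ≤ 2 ^ J ∧ 2 ^ J < 2 * k := by
  refine ⟨Nat.clog 2 k, Nat.le_pow_clog (by norm_num) k, ?_⟩
  rcases hk.eq_or_lt with rfl | h
  · simp
  · have h1 := Nat.pow_pred_clog_lt_self (b := 2) (by norm_num) h
    have h2 := Nat.clog_pos (b := 2) (by norm_num) h
    obtain ⟨m, hm⟩ : ∃ m, Nat.clog 2 k = m + 1 := ⟨Nat.clog 2 k - 1, by omega⟩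
    rw [hm] at h1 ⊢
    simp only [Nat.pred_eq_sub_one, Nat.add_sub_cancel] at h1
    rw [pow_succ]
    omega

/-- The dyadic sum that bounds the multipliers of a measure. -/
noncomputable def dyadicSum (b α : ℝ) (k J : ℕ) : ℝ :=
  ∑ j ∈ Finset.range J, ((2 : ℝ) ^ (-b)) ^ j * ((2 : ℝ) ^ j / k) ^ α + ((2 : ℝ) ^ (-b)) ^ J

/-- Factoring out `k^(-α)` leaves a geometric sum of ratio `ρ = 2^(α-b)`, and `2^J ≥ k` bounds the
last term by `k^(-b)`. -/
theorem dyadicSum_le {b α : ℝ} (hb : 0 ≤ b) {k J : ℕ} (hk : 1 ≤ k) (hJ : k ≤ 2 ^ J) :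
    dyadicSum b α k J
      ≤ (k : ℝ) ^ (-α) * ∑ j ∈ Finset.range J, ((2 : ℝ) ^ (α - b)) ^ j + (k : ℝ) ^ (-b) := by
  have hk' : (0 : ℝ) < k := by exact_mod_cast hk
  rw [dyadicSum, Finset.mul_sum]
  apply add_le_add
  · refine le_of_eq (Finset.sum_congr rfl fun j _ => ?_)
    rw [Real.div_rpow (by positivity) hk'.le, ← Real.rpow_pow_comm (by norm_num),
      Real.rpow_neg hk'.le, Real.rpow_sub (by norm_num), Real.rpow_neg (by norm_num), div_pow,
      inv_pow]
    field_simp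
  · rw [Real.rpow_pow_comm (by norm_num)]
    apply Real.rpow_le_rpow_of_nonpos hk' _ (by linarith)
    exact_mod_cast hJ

/-- Here `ρ < 1`: the sum is bounded by the full geometric series, and `k^(-b) ≤ k^(-α)`. -/
theorem exists_dyadicSum_le_of_lt {b α : ℝ} (hb : 0 ≤ b) (h : α < b) :
    ∃ C : ℝ, ∀ k J : ℕ, 1 ≤ k → k ≤ 2 ^ J → dyadicSum b α k J ≤ C * (k : ℝ) ^ (-α) := by
  set ρ := (2 : ℝ) ^ (α - b) with hρ
  have hρ1 : ρ < 1 := Real.rpow_lt_one_of_one_lt_of_neg (by norm_num) (by linarith)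
  have hρ0 : 0 ≤ ρ := by positivity
  refine ⟨(1 - ρ)⁻¹ + 1, fun k J hk hJ => (dyadicSum_le hb hk hJ).trans ?_⟩
  have hk' : (1 : ℝ) ≤ k := by exact_mod_cast hk
  have h1 : ∑ j ∈ Finset.range J, ρ ^ j ≤ (1 - ρ)⁻¹ := by
    rw [← tsum_geometric_of_lt_one hρ0 hρ1]
    exact (summable_geometric_of_lt_one hρ0 hρ1).sum_le_tsum _ fun i _ => by positivity
  have h2 : (k : ℝ) ^ (-b) ≤ (k : ℝ) ^ (-α) :=
    Real.rpow_le_rpow_of_exponent_le hk' (by linarith)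
  have h3 : 0 ≤ (k : ℝ) ^ (-α) := by positivity
  nlinarith

/-- Here `ρ = 1`: the sum counts `J` terms, and `2^J < 2k` makes `J` of order `log k`. The condition
`k ≥ 2` keeps `log k` away from zero. -/
theorem exists_dyadicSum_le_of_eq {b : ℝ} (hb : 0 ≤ b) :
    ∃ C : ℝ, ∀ k J : ℕ, 2 ≤ k → k ≤ 2 ^ J → 2 ^ J < 2 * k →
      dyadicSum b b k J ≤ C * ((k : ℝ) ^ (-b) * Real.log k) := by
  have hl2 : 0 < Real.log 2 := Real.log_pos (by norm_num)
  refine ⟨3 / Real.log 2, fun k J hk hJ hJ' => (dyadicSum_le hb (by omega) hJ).trans ?_⟩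
  have hk' : (2 : ℝ) ≤ k := by exact_mod_cast hk
  have hlk : Real.log 2 ≤ Real.log k := Real.log_le_log (by norm_num) hk'
  have hJlog : J * Real.log 2 ≤ Real.log 2 + Real.log k := by
    rw [← Real.log_pow, ← Real.log_mul (by norm_num) (by linarith)]
    apply Real.log_le_log (by positivity)
    exact_mod_cast hJ'.le
  simp only [sub_self, Real.rpow_zero, one_pow, Finset.sum_const, Finset.card_range, nsmul_eq_mul,
    mul_one]
  have h0 : 0 ≤ (k : ℝ) ^ (-b) := by positivity
  have h1 : (J : ℝ) + 1 ≤ 3 / Real.log 2 * Real.log k := by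
    rw [div_mul_eq_mul_div, le_div_iff₀ hl2]
    linarith
  calc (k : ℝ) ^ (-b) * J + (k : ℝ) ^ (-b) = (k : ℝ) ^ (-b) * (J + 1) := by ring
    _ ≤ (k : ℝ) ^ (-b) * (3 / Real.log 2 * Real.log k) := by gcongr
    _ = _ := by ring

/-- Here `ρ > 1`: the sum is comparable to its last terms, that is to `ρ^J ≤ (2k)^(α-b)`, which
turns `k^(-α)` into `k^(-b)`. -/
theorem exists_dyadicSum_le_of_gt {b α : ℝ} (hb : 0 ≤ b) (h : b < α) :
    ∃ C : ℝ, ∀ k J : ℕ, 1 ≤ k → k ≤ 2 ^ J → 2 ^ J < 2 * k →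
      dyadicSum b α k J ≤ C * (k : ℝ) ^ (-b) := by
  set ρ := (2 : ℝ) ^ (α - b) with hρ
  have hρ1 : 1 < ρ := Real.one_lt_rpow (by norm_num) (by linarith)
  have hρ0 : 0 < ρ - 1 := by linarith
  refine ⟨ρ / (ρ - 1) + 1, fun k J hk hJ hJ' => (dyadicSum_le hb hk hJ).trans ?_⟩
  have hk' : (1 : ℝ) ≤ k := by exact_mod_cast hk
  have h1 : ∑ j ∈ Finset.range J, ρ ^ j ≤ ρ * (k : ℝ) ^ (α - b) / (ρ - 1) := by
    rw [geom_sum_eq hρ1.ne']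
    have : ρ ^ J ≤ ρ * (k : ℝ) ^ (α - b) := by
      rw [hρ, Real.rpow_pow_comm (by norm_num), ← Real.mul_rpow (by norm_num) (by linarith)]
      apply Real.rpow_le_rpow (by positivity) _ (by linarith)
      exact_mod_cast hJ'.le
    gcongr
    linarith
  have h2 : (k : ℝ) ^ (-α) * (k : ℝ) ^ (α - b) = (k : ℝ) ^ (-b) := by
    rw [← Real.rpow_add (by linarith)]
    congr 1
    ring
  calc (k : ℝ) ^ (-α) * ∑ j ∈ Finset.range J, ρ ^ j + (k : ℝ) ^ (-b)
      ≤ (k : ℝ) ^ (-α) * (ρ * (k : ℝ) ^ (α - b) / (ρ - 1)) + (k : ℝ) ^ (-b) := by gcongr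
    _ = ρ / (ρ - 1) * ((k : ℝ) ^ (-α) * (k : ℝ) ^ (α - b)) + (k : ℝ) ^ (-b) := by ring
    _ = _ := by rw [h2]; ring

end Dyadic

/-! ### Integrals of Legendre polynomials against measures with small polar caps -/

section PolarCaps

variable {n : ℕ}

theorem abs_inner_sph_le_one (e u : Sph n) : |⟪(e : Euc n), (u : Euc n)⟫| ≤ 1 := by
  have := abs_real_inner_le_norm (e : Euc n) (u : Euc n)
  rwa [norm_eq_of_mem_sphere, norm_eq_of_mem_sphere, one_mul] at this

/-- The pair of opposite polar caps of the sphere of chordal radius `r`. -/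
def polarCaps (e : Sph n) (r : ℝ) : Set (Sph n) :=
  {u | 1 - ⟪(e : Euc n), (u : Euc n)⟫ ^ 2 < r ^ 2}

theorem measurableSet_polarCaps (e : Sph n) (r : ℝ) : MeasurableSet (polarCaps e r) :=
  (isOpen_lt (by fun_prop) continuous_const).measurableSet

theorem continuous_comp_inner {g : ℝ → ℝ} (hg : Continuous g) (e : Sph n) :
    Continuous fun u : Sph n => g ⟪(e : Euc n), (u : Euc n)⟫ := by
  fun_prop

theorem integrable_of_continuous {E : Type*} [NormedAddCommGroup E] (ν : Measure (Sph n))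
    [IsFiniteMeasure ν] {g : Sph n → E} (hg : Continuous g) : Integrable g ν :=
  hg.integrable_of_hasCompactSupport (HasCompactSupport.of_compactSpace g)

/-- The dyadic majorant is integrated term by term: the `j`-th indicator contributes `ν(cap_j) ≤ C
(2^j/k)^α` and the constant term contributes the total mass. Besides `|μ|` in part (1), it is
applied to the surface measure in part (2). -/
theorem exists_integral_abs_legendre_le (hn : 3 ≤ n) (e : Sph n) (ν : Measure (Sph n))
    [IsFiniteMeasure ν] {b C α : ℝ} (hb0 : 0 ≤ b) (hb : b ≤ ((n : ℝ) - 2) / 2)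
    (hν : ∀ r : ℝ, 0 < r → ν.real (polarCaps e r) ≤ C * r ^ α) :
    ∃ D : ℝ, 0 ≤ D ∧ ∀ k J : ℕ, 1 ≤ k →
      ∫ u, |legendre n k ⟪(e : Euc n), (u : Euc n)⟫| ∂ν ≤ D * dyadicSum b α k J := by
  obtain ⟨A, hA, hmaj⟩ := exists_legendre_majorant n hn hb0 hb
  refine ⟨A * (|C| + ν.real Set.univ), by positivity, fun k J hk => ?_⟩
  have hk' : (0 : ℝ) < k := by exact_mod_cast hk
  set a := (2 : ℝ) ^ (-b) with ha
  have ha0 : 0 < a := by positivity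
  set cap : ℕ → Set (Sph n) := fun j => polarCaps e ((2 : ℝ) ^ j / k) with hcap
  have hind : ∀ j, Integrable ((cap j).indicator fun _ => (1 : ℝ)) ν := fun j =>
    (integrable_const (1 : ℝ)).indicator (measurableSet_polarCaps e _)
  have hpt : ∀ u : Sph n, |legendre n k ⟪(e : Euc n), (u : Euc n)⟫|
      ≤ A * (∑ j ∈ Finset.range J, a ^ j * (cap j).indicator (fun _ => (1 : ℝ)) u + a ^ J) := by
    intro u
    refine hmaj k _ J (fun j => (cap j).indicator (fun _ => (1 : ℝ)) u) hk
      (abs_inner_sph_le_one e u) (fun j => Set.indicator_nonneg (fun _ _ => zero_le_one) u) ?_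
    intro j hj
    rw [Set.indicator_of_mem]
    simp only [hcap, polarCaps, Set.mem_ofPred_eq, div_pow]
    rw [lt_div_iff₀ (by positivity), ← pow_mul, mul_comm j 2, pow_mul]
    norm_num
    linarith
  have hint : Integrable (fun u => A * (∑ j ∈ Finset.range J, a ^ j *
      (cap j).indicator (fun _ => (1 : ℝ)) u + a ^ J)) ν :=
    ((integrable_finsetSum _ fun j _ => (hind j).const_mul _).add (integrable_const _)).const_mul _
  refine (integral_mono (integrable_of_continuous ν
    (continuous_comp_inner (contDiff_legendre n k).continuous e).abs) hint hpt).trans ?_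
  rw [integral_const_mul, integral_add (integrable_finsetSum _ fun j _ => (hind j).const_mul _)
    (integrable_const _), integral_finsetSum _ fun j _ => (hind j).const_mul _]
  simp only [integral_const_mul, hcap, integral_const, smul_eq_mul, dyadicSum]
  rw [mul_assoc]
  gcongr
  rw [mul_add, Finset.mul_sum]
  apply add_le_add
  · apply Finset.sum_le_sum fun j _ => ?_
    have h1 : ∫ u, (polarCaps e ((2 : ℝ) ^ j / k)).indicator (fun _ => (1 : ℝ)) u ∂ν
        = ν.real (polarCaps e ((2 : ℝ) ^ j / k)) :=
      integral_indicator_one (measurableSet_polarCaps e _)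
    rw [h1]
    have h2 := hν ((2 : ℝ) ^ j / k) (by positivity)
    have h3 : C * ((2 : ℝ) ^ j / k) ^ α
        ≤ (|C| + ν.real Set.univ) * ((2 : ℝ) ^ j / k) ^ α := by
      gcongr
      have := le_abs_self C
      have := measureReal_nonneg (μ := ν) (s := Set.univ)
      linarith
    calc a ^ j * ν.real (polarCaps e ((2 : ℝ) ^ j / k))
        ≤ a ^ j * ((|C| + ν.real Set.univ) * ((2 : ℝ) ^ j / k) ^ α) := by
          gcongr; exact h2.trans h3
      _ = _ := by ring
  · gcongr
    linarith [abs_nonneg C]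

end PolarCaps

/-! ### Multipliers of signed measures: part (1) -/

section MeasureMultipliers

variable {n : ℕ}

theorem abs_multiplier_measurePairing_le (e : Sph n) (μ : SignedMeasure (Sph n)) (k : ℕ) :
    |multiplier e (measurePairing μ) k|
      ≤ ∫ u, |legendre n k ⟪(e : Euc n), (u : Euc n)⟫| ∂μ.totalVariation := by
  have hc := continuous_comp_inner (contDiff_legendre n k).continuous e
  rw [SignedMeasure.totalVariation, integral_add_measure (integrable_of_continuous _ hc.abs)
    (integrable_of_continuous _ hc.abs)]
  exact (abs_sub _ _).trans (add_le_add (abs_integral_le_integral_abs)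
    (abs_integral_le_integral_abs))

/-- Translates angles into sines: for `r ≤ 1` the cap is `|⟨e,u⟩| > cos(arcsin r)`, and Jordan's
inequality gives `arcsin r ≤ π r`. -/
theorem measureReal_polarCaps_le (e : Sph n) (ν : Measure (Sph n)) [IsFiniteMeasure ν]
    {C α : ℝ} (hC : 0 < C) (hα : 0 ≤ α)
    (hν : ∀ r : ℝ, 0 ≤ r →
      ν.real {u | Real.cos r < |⟪(e : Euc n), (u : Euc n)⟫|} ≤ C * r ^ α) {r : ℝ} (hr : 0 < r) :
    ν.real (polarCaps e r) ≤ C * Real.pi ^ α * r ^ α := by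
  have hpi := Real.pi_pos
  rcases le_or_gt r 1 with h1 | h1
  · have hs : polarCaps e r ⊆
        {u | Real.cos (Real.arcsin r) < |⟪(e : Euc n), (u : Euc n)⟫|} := by
      intro u hu
      simp only [polarCaps, Set.mem_ofPred_eq] at hu ⊢
      rw [Real.cos_arcsin, Real.sqrt_lt (by nlinarith) (abs_nonneg _), sq_abs]
      linarith
    have h2 : Real.arcsin r ≤ Real.pi * r := by
      have h3 := Real.mul_le_sin (Real.arcsin_nonneg.2 hr.le) (Real.arcsin_le_pi_div_two r)
      rw [Real.sin_arcsin (by linarith) h1, div_mul_eq_mul_div, div_le_iff₀ hpi] at h3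
      have := Real.arcsin_nonneg.2 hr.le
      nlinarith
    calc ν.real (polarCaps e r) ≤ C * (Real.arcsin r) ^ α :=
          (measureReal_mono hs).trans (hν _ (Real.arcsin_nonneg.2 hr.le))
      _ ≤ C * (Real.pi * r) ^ α := by
          gcongr
          exact Real.arcsin_nonneg.2 hr.le
      _ = _ := by rw [Real.mul_rpow hpi.le hr.le]; ring
  -- For `r > 1` the total mass suffices. It is bounded by the hypothesis at angle `π`, where the
  -- condition `-1 < |⟨e,u⟩|` is void.
  · have hs : polarCaps e r ⊆ {u | Real.cos Real.pi < |⟪(e : Euc n), (u : Euc n)⟫|} := by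
      intro u _
      simp only [Set.mem_ofPred_eq, Real.cos_pi]
      linarith [abs_nonneg ⟪(e : Euc n), (u : Euc n)⟫]
    calc ν.real (polarCaps e r) ≤ C * Real.pi ^ α * 1 := by
          rw [mul_one]
          exact (measureReal_mono hs).trans (hν _ hpi.le)
      _ ≤ _ := by
          gcongr
          exact Real.one_le_rpow h1.le hα

theorem multiplier_measurePairing_isBigO (hn : 3 ≤ n) (e : Sph n) (μ : SignedMeasure (Sph n))
    {C α : ℝ} (hC : 0 < C) (hα : 0 ≤ α)
    (hμ : ∀ r : ℝ, 0 ≤ r →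
      μ.totalVariation.real {u | Real.cos r < |⟪(e : Euc n), (u : Euc n)⟫|} ≤ C * r ^ α) :
    (α < ((n : ℝ) - 2) / 2 →
      multiplier e (measurePairing μ) =O[atTop] fun k : ℕ => (k : ℝ) ^ (-α)) ∧
    (α = ((n : ℝ) - 2) / 2 →
      multiplier e (measurePairing μ)
        =O[atTop] fun k : ℕ => (k : ℝ) ^ (-(((n : ℝ) - 2) / 2)) * Real.log k) ∧
    (((n : ℝ) - 2) / 2 < α →
      multiplier e (measurePairing μ) =O[atTop] fun k : ℕ => (k : ℝ) ^ (-(((n : ℝ) - 2) / 2))) := by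
  have hn' : (3 : ℝ) ≤ n := by exact_mod_cast hn
  have hfin : IsFiniteMeasure μ.totalVariation := by
    rw [SignedMeasure.totalVariation]; infer_instance
  have hb0 : 0 ≤ ((n : ℝ) - 2) / 2 := by linarith
  obtain ⟨D, hD, hbound⟩ := exists_integral_abs_legendre_le hn e μ.totalVariation hb0 le_rfl
    (fun r hr => measureReal_polarCaps_le e _ hC hα hμ hr)
  have hbound' : ∀ k J : ℕ, 1 ≤ k →
      |multiplier e (measurePairing μ) k| ≤ D * dyadicSum (((n : ℝ) - 2) / 2) α k J :=
    fun k J hk => (abs_multiplier_measurePairing_le e μ k).trans (hbound k J hk)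
  refine ⟨fun h => ?_, fun h => ?_, fun h => ?_⟩
  · obtain ⟨B, hB⟩ := exists_dyadicSum_le_of_lt hb0 h
    refine IsBigO.of_bound (D * B) ?_
    filter_upwards [eventually_ge_atTop 1] with k hk
    obtain ⟨J, hJ, hJ'⟩ := exists_two_pow_between hk
    rw [Real.norm_eq_abs, Real.norm_of_nonneg (by positivity), mul_assoc]
    exact (hbound' k J hk).trans (mul_le_mul_of_nonneg_left (hB k J hk hJ) hD)
  · subst h
    obtain ⟨B, hB⟩ := exists_dyadicSum_le_of_eq hb0
    refine IsBigO.of_bound (D * B) ?_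
    filter_upwards [eventually_ge_atTop 2] with k hk
    obtain ⟨J, hJ, hJ'⟩ := exists_two_pow_between (k := k) (by omega)
    have hk1 : (1 : ℝ) ≤ k := by exact_mod_cast (by omega : 1 ≤ k)
    rw [Real.norm_eq_abs, Real.norm_of_nonneg (mul_nonneg (by positivity) (Real.log_nonneg hk1)),
      mul_assoc]
    exact (hbound' k J (by omega)).trans (mul_le_mul_of_nonneg_left (hB k J hk hJ hJ') hD)
  · obtain ⟨B, hB⟩ := exists_dyadicSum_le_of_gt hb0 h
    refine IsBigO.of_bound (D * B) ?_
    filter_upwards [eventually_ge_atTop 1] with k hk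
    obtain ⟨J, hJ, hJ'⟩ := exists_two_pow_between hk
    rw [Real.norm_eq_abs, Real.norm_of_nonneg (by positivity), mul_assoc]
    exact (hbound' k J hk).trans (mul_le_mul_of_nonneg_left (hB k J hk hJ hJ') hD)

end MeasureMultipliers

/-! ### Rotations and invariance of the surface measure -/

section Rotations

open scoped Pointwise

variable {n : ℕ}

theorem det_reflection_orthogonal_singleton {v : Euc n} (hv : v ≠ 0) :
    LinearMap.det ((ℝ ∙ v)ᗮ.reflection.toLinearEquiv : Euc n →ₗ[ℝ] Euc n) = -1 := by
  have h := Submodule.det_reflection (𝕜 := ℝ) (ℝ ∙ v)ᗮ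
  rw [Submodule.orthogonal_orthogonal, finrank_span_singleton hv, pow_one] at h
  exact h

theorem exists_ne_zero_orthogonal (hn : 3 ≤ n) (a b : Euc n) :
    ∃ c : Euc n, c ≠ 0 ∧ ⟪c, a⟫ = 0 ∧ ⟪c, b⟫ = 0 := by
  set S : Submodule ℝ (Euc n) := Submodule.span ℝ {a, b} with hS
  have h1 : Module.finrank ℝ S ≤ 2 := by
    classical
    have := finrank_span_finset_le_card (R := ℝ) ({a, b} : Finset (Euc n))
    rw [Finset.coe_pair] at this
    exact this.trans Finset.card_le_two
  have h2 := Submodule.finrank_add_finrank_orthogonal S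
  rw [finrank_euclideanSpace_fin] at h2
  have h3 : Sᗮ ≠ ⊥ := fun h => by
    rw [h, finrank_bot] at h2
    omega
  obtain ⟨c, hc, hc0⟩ := Submodule.exists_mem_ne_zero_of_ne_bot h3
  refine ⟨c, hc0, ?_, ?_⟩
  · exact (Submodule.mem_orthogonal' S c).1 hc a (Submodule.subset_span (by simp))
  · exact (Submodule.mem_orthogonal' S c).1 hc b (Submodule.subset_span (by simp))

theorem reflection_eq_self_of_inner {c x : Euc n} (h : ⟪c, x⟫ = 0) :
    (ℝ ∙ c)ᗮ.reflection x = x :=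
  Submodule.reflection_mem_subspace_eq_self (Submodule.mem_orthogonal_singleton_iff_inner_right.2 h)

/-- Rotations act transitively on the spheres in the fibres of `⟪x, ·⟫`. -/
theorem exists_rotation (hn : 3 ≤ n) {a b x : Euc n} (hab : ‖a‖ = ‖b‖) (hx : ⟪a, x⟫ = ⟪b, x⟫) :
    ∃ θ : Euc n ≃ₗᵢ[ℝ] Euc n, IsRotation θ ∧ θ a = b ∧ θ x = x := by
  by_cases h : a = b
  · refine ⟨LinearIsometryEquiv.refl ℝ _, ?_, h, rfl⟩
    exact LinearMap.det_id
  -- The reflection in `(a-b)^⊥` sends `a` to `b` and fixes `x`, but has determinant `-1`. A second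
  -- reflection along some `c` orthogonal to `b` and `x`, available since `n ≥ 3`, corrects the sign
  -- without moving them.
  · obtain ⟨c, hc0, hcb, hcx⟩ := exists_ne_zero_orthogonal hn b x
    refine ⟨(ℝ ∙ (a - b))ᗮ.reflection.trans (ℝ ∙ c)ᗮ.reflection, ?_, ?_, ?_⟩
    · have e : (((ℝ ∙ (a - b))ᗮ.reflection.trans (ℝ ∙ c)ᗮ.reflection).toLinearEquiv
          : Euc n →ₗ[ℝ] Euc n)
          = ((ℝ ∙ c)ᗮ.reflection.toLinearEquiv : Euc n →ₗ[ℝ] Euc n) ∘ₗ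
            ((ℝ ∙ (a - b))ᗮ.reflection.toLinearEquiv : Euc n →ₗ[ℝ] Euc n) := rfl
      rw [IsRotation, e, LinearMap.det_comp, det_reflection_orthogonal_singleton hc0,
        det_reflection_orthogonal_singleton (sub_ne_zero.2 h)]
      norm_num
    · rw [LinearIsometryEquiv.trans_apply, Submodule.reflection_sub hab]
      exact reflection_eq_self_of_inner hcb
    · have : ⟪a - b, x⟫ = 0 := by rw [inner_sub_left, hx, sub_self]
      rw [LinearIsometryEquiv.trans_apply, reflection_eq_self_of_inner this,
        reflection_eq_self_of_inner hcx]

instance : IsFiniteMeasure (surf n) := inferInstanceAs (IsFiniteMeasure (Measure.toSphere _))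

theorem measurable_rotSph (θ : Euc n ≃ₗᵢ[ℝ] Euc n) : Measurable (rotSph θ) :=
  (Measurable.subtype_mk (θ.continuous.measurable.comp measurable_subtype_coe))

theorem surf_apply {A : Set (Sph n)} (hA : MeasurableSet A) :
    surf n A = n * volume (Set.Ioo (0 : ℝ) 1 • ((↑) '' A : Set (Euc n))) := by
  rw [surf, Measure.toSphere_apply' _ hA, finrank_euclideanSpace_fin]

/-- The surface area measure is invariant under linear isometries. -/
theorem measurePreserving_rotSph (θ : Euc n ≃ₗᵢ[ℝ] Euc n) :
    MeasurePreserving (rotSph θ) (surf n) (surf n) := by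
  refine ⟨measurable_rotSph θ, Measure.ext fun A hA => ?_⟩
  rw [Measure.map_apply (measurable_rotSph θ) hA, surf_apply hA,
    surf_apply (measurable_rotSph θ hA)]
  congr 1
  have e : Set.Ioo (0 : ℝ) 1 • ((↑) '' (rotSph θ ⁻¹' A) : Set (Euc n))
      = θ ⁻¹' (Set.Ioo (0 : ℝ) 1 • ((↑) '' A : Set (Euc n))) := by
    ext x
    simp only [Set.mem_smul, Set.mem_image, Set.mem_preimage]
    constructor
    · rintro ⟨r, hr, _, ⟨u, hu, rfl⟩, rfl⟩
      exact ⟨r, hr, _, ⟨_, hu, rfl⟩, by simp [rotSph]⟩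
    · rintro ⟨r, hr, _, ⟨u, hu, rfl⟩, h⟩
      refine ⟨r, hr, _, ⟨rotSph θ.symm u, ?_, rfl⟩, ?_⟩
      · convert hu
        simp [rotSph]
      · apply θ.injective
        rw [← h]
        simp [rotSph]
  rw [e]
  exact θ.measurePreserving.measure_preimage_equiv (f := θ.toMeasurableEquiv) _

theorem integral_comp_rotSph {E : Type*} [NormedAddCommGroup E] [NormedSpace ℝ E]
    (θ : Euc n ≃ₗᵢ[ℝ] Euc n) (g : Sph n → E) :
    ∫ u, g (rotSph θ u) ∂(surf n) = ∫ u, g u ∂(surf n) := by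
  have hinj : Function.Injective (rotSph θ) := fun u v h => by
    have := congrArg Subtype.val h
    exact Subtype.ext (θ.injective this)
  have hcont : Continuous (rotSph θ) := by
    apply Continuous.subtype_mk
    exact θ.continuous.comp continuous_subtype_val
  exact (measurePreserving_rotSph θ).integral_comp
    (hcont.isClosedEmbedding hinj).measurableEmbedding g

end Rotations

/-! ### Determinants of rank two perturbations of the identity -/

section RankTwo

variable {n : ℕ}

/-- The operator `a Id + b u ⊗ u + c w ⊗ w`. -/
noncomputable def rankTwo (a b c : ℝ) (u w : Euc n) : Euc n →L[ℝ] Euc n :=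
  a • ContinuousLinearMap.id ℝ (Euc n) + b • (innerSL ℝ u).smulRight u
    + c • (innerSL ℝ w).smulRight w

theorem rankTwo_apply (a b c : ℝ) (u w v : Euc n) :
    rankTwo a b c u w v = a • v + (b * ⟪u, v⟫) • u + (c * ⟪w, v⟫) • w := by
  simp [rankTwo, mul_smul]

/-- Write the matrix as `a(1 + UV)` with `U` of size `n × 2`. Then `det(1 + UV) = det(1 + VU)` is a
`2 × 2` determinant, diagonal because `u ⊥ w`. -/
theorem det_rankTwo (hn : 2 ≤ n) {a b c : ℝ} (ha : a ≠ 0) {u w : Euc n} (huw : ⟪u, w⟫ = 0) :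
    (rankTwo a b c u w).det
      = a ^ (n - 2) * ((a + b * ‖u‖ ^ 2) * (a + c * ‖w‖ ^ 2)) := by
  set B : Module.Basis (Fin n) ℝ (Euc n) := (EuclideanSpace.basisFun (Fin n) ℝ).toBasis
  have hdet : (rankTwo a b c u w).det
      = (LinearMap.toMatrix B B (rankTwo a b c u w : Euc n →ₗ[ℝ] Euc n)).det :=
    (LinearMap.det_toMatrix B _).symm
  set U : Matrix (Fin n) (Fin 2) ℝ := Matrix.of fun i j => ![b / a * u i, c / a * w i] j
  set V : Matrix (Fin 2) (Fin n) ℝ := Matrix.of fun j i => ![u i, w i] j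
  have hM : LinearMap.toMatrix B B (rankTwo a b c u w : Euc n →ₗ[ℝ] Euc n)
      = a • (1 + U * V) := by
    ext i j
    rw [LinearMap.toMatrix_apply]
    simp [B, rankTwo_apply, U, V, Matrix.mul_apply, Fin.sum_univ_two, Matrix.one_apply,
      EuclideanSpace.inner_single_right]
    split_ifs <;> field_simp <;> ring
  have huu : ∑ i, u i * u i = ‖u‖ ^ 2 := by
    rw [EuclideanSpace.norm_sq_eq]
    exact Finset.sum_congr rfl fun i _ => by rw [Real.norm_eq_abs, sq_abs, sq]
  have hww : ∑ i, w i * w i = ‖w‖ ^ 2 := by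
    rw [EuclideanSpace.norm_sq_eq]
    exact Finset.sum_congr rfl fun i _ => by rw [Real.norm_eq_abs, sq_abs, sq]
  have huw' : ∑ i, u i * w i = 0 := by
    rw [← huw, PiLp.inner_apply]
    exact Finset.sum_congr rfl fun i _ => by simp [mul_comm]
  have e00 : (V * U) 0 0 = b / a * ‖u‖ ^ 2 := by
    rw [Matrix.mul_apply, ← huu, Finset.mul_sum]
    exact Finset.sum_congr rfl fun i _ => by simp [U, V]; ring
  have e11 : (V * U) 1 1 = c / a * ‖w‖ ^ 2 := by
    rw [Matrix.mul_apply, ← hww, Finset.mul_sum]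
    exact Finset.sum_congr rfl fun i _ => by simp [U, V]; ring
  have e01 : (V * U) 0 1 = 0 := by
    rw [Matrix.mul_apply, ← mul_zero (c / a), ← huw', Finset.mul_sum]
    exact Finset.sum_congr rfl fun i _ => by simp [U, V]; ring
  rw [hdet, hM, Matrix.det_smul, Matrix.det_one_add_mul_comm, Matrix.det_fin_two, Fintype.card_fin]
  simp only [Matrix.add_apply, e00, e11, e01, Matrix.one_apply]
  obtain ⟨m, rfl⟩ : ∃ m, n = m + 2 := ⟨n - 2, by omega⟩
  simp
  field_simp
  ring

end RankTwo

/-! ### Surface area of polar caps -/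

section SurfaceOfCaps

open scoped Pointwise

variable {n : ℕ}

theorem exists_unit_orthogonal (hn : 3 ≤ n) (a : Euc n) : ∃ c : Euc n, ‖c‖ = 1 ∧ ⟪c, a⟫ = 0 := by
  obtain ⟨c, hc0, hca, -⟩ := exists_ne_zero_orthogonal hn a a
  refine ⟨‖c‖⁻¹ • c, ?_, ?_⟩
  · rw [norm_smul, norm_inv, norm_norm, inv_mul_cancel₀ (norm_ne_zero_iff.2 hc0)]
  · rw [real_inner_smul_left, hca, mul_zero]

/-- The part of the unit ball in a thin slab around a hyperplane has small volume. -/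
theorem volume_slab_le (hn : 2 ≤ n) {c : Euc n} (hc : ‖c‖ = 1) {r : ℝ} (hr : 0 < r) :
    volume {x : Euc n | ‖x‖ < 1 ∧ |⟪c, x⟫| < r}
      ≤ ENNReal.ofReal r * volume (Metric.ball (0 : Euc n) 2) := by
  set T := rankTwo 1 (r - 1) 0 c (0 : Euc n) with hT
  have hdet : T.det = r := by
    rw [hT, det_rankTwo hn one_ne_zero (by simp), hc]
    simp
  -- `T` contracts the direction `c` by the factor `r`. The preimage of a point of the slab has
  -- squared norm less than `1 + 1 < 4`.
  have hsub : {x : Euc n | ‖x‖ < 1 ∧ |⟪c, x⟫| < r} ⊆ T '' Metric.ball (0 : Euc n) 2 := by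
    rintro x ⟨hx1, hx2⟩
    refine ⟨x + ((r⁻¹ - 1) * ⟪c, x⟫) • c, ?_, ?_⟩
    · have hcc : ⟪c, c⟫ = 1 := by rw [real_inner_self_eq_norm_sq, hc]; norm_num
      have h1 : ‖x + ((r⁻¹ - 1) * ⟪c, x⟫) • c‖ ^ 2
          = ‖x‖ ^ 2 - ⟪c, x⟫ ^ 2 + (r⁻¹ * ⟪c, x⟫) ^ 2 := by
        rw [norm_add_sq_real, real_inner_smul_right, norm_smul, hc, mul_one, Real.norm_eq_abs,
          sq_abs, real_inner_comm]
        ring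
      have h2 : (r⁻¹ * ⟪c, x⟫) ^ 2 < 1 := by
        rw [sq_lt_one_iff_abs_lt_one, abs_mul, abs_of_pos (inv_pos.2 hr), inv_mul_lt_iff₀ hr,
          mul_one]
        exact hx2
      rw [mem_ball_zero_iff]
      have h3 : ‖x‖ ^ 2 < 1 := by nlinarith [norm_nonneg x]
      nlinarith [sq_nonneg ⟪c, x⟫, norm_nonneg (x + ((r⁻¹ - 1) * ⟪c, x⟫) • c)]
    · have hcc : ⟪c, c⟫ = 1 := by rw [real_inner_self_eq_norm_sq, hc]; norm_num
      rw [hT, rankTwo_apply, inner_add_right, real_inner_smul_right, hcc]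
      simp only [one_smul, zero_mul, zero_smul, add_zero, mul_one]
      rw [add_assoc, ← add_smul]
      have : (r⁻¹ - 1) * ⟪c, x⟫ + (r - 1) * (⟪c, x⟫ + (r⁻¹ - 1) * ⟪c, x⟫) = 0 := by
        field_simp
        ring
      rw [this, zero_smul, add_zero]
  refine (measure_mono hsub).trans (le_of_eq ?_)
  rw [Measure.addHaar_image_continuousLinearMap, ← ContinuousLinearMap.det, hdet, abs_of_pos hr]

/-- For a unit vector `c ⊥ e` the cone over the caps lies in the slab `|⟨c,x⟩| < r`. The exponent
`1` is crude, but it matches the cap bound for `□_n f` and is all that is needed. -/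
theorem exists_surf_polarCaps_le (hn : 3 ≤ n) (e : Sph n) :
    ∃ C : ℝ, ∀ r : ℝ, 0 < r → (surf n).real (polarCaps e r) ≤ C * r ^ (1 : ℝ) := by
  obtain ⟨c, hc, hce⟩ := exists_unit_orthogonal hn (e : Euc n)
  refine ⟨n * (volume (Metric.ball (0 : Euc n) 2)).toReal, fun r hr => ?_⟩
  have hsub : Set.Ioo (0 : ℝ) 1 • ((↑) '' (polarCaps e r) : Set (Euc n))
      ⊆ {x : Euc n | ‖x‖ < 1 ∧ |⟪c, x⟫| < r} := by
    rintro _ ⟨s, hs, _, ⟨u, hu, rfl⟩, rfl⟩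
    have hu1 : ‖(u : Euc n)‖ = 1 := norm_eq_of_mem_sphere u
    have he1 : ‖(e : Euc n)‖ = 1 := norm_eq_of_mem_sphere e
    have hcu : |⟪c, (u : Euc n)⟫| < r := by
      set t := ⟪(e : Euc n), (u : Euc n)⟫ with ht
      have h1 : ⟪c, (u : Euc n)⟫ = ⟪c, (u : Euc n) - t • (e : Euc n)⟫ := by
        rw [inner_sub_right, real_inner_smul_right, hce]
        ring
      have h2 : ‖(u : Euc n) - t • (e : Euc n)‖ ^ 2 = 1 - t ^ 2 := by
        rw [norm_sub_sq_real, real_inner_smul_right, norm_smul, hu1, he1, real_inner_comm, ← ht,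
          Real.norm_eq_abs, mul_one, sq_abs]
        ring
      have h3 : ‖(u : Euc n) - t • (e : Euc n)‖ < r := by
        refine lt_of_pow_lt_pow_left₀ 2 hr.le ?_
        rw [h2]
        exact hu
      rw [h1]
      refine (abs_real_inner_le_norm _ _).trans_lt ?_
      rwa [hc, one_mul]
    refine ⟨?_, ?_⟩
    · simp only [norm_smul, hu1, mul_one, Real.norm_eq_abs, abs_of_pos hs.1]
      exact hs.2
    · simp only [real_inner_smul_right, abs_mul, abs_of_pos hs.1]
      nlinarith [hs.1, hs.2, abs_nonneg ⟪c, (u : Euc n)⟫]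
  rw [Measure.real, surf_apply (measurableSet_polarCaps e r), Real.rpow_one, ENNReal.toReal_mul,
    ENNReal.toReal_natCast, mul_assoc]
  have h1 := (measure_mono hsub).trans (volume_slab_le (by omega) hc hr)
  have h2 : (volume (Set.Ioo (0 : ℝ) 1 • ((↑) '' (polarCaps e r) : Set (Euc n)))).toReal
      ≤ (ENNReal.ofReal r * volume (Metric.ball (0 : Euc n) 2)).toReal :=
    ENNReal.toReal_mono (ENNReal.mul_ne_top ENNReal.ofReal_ne_top measure_ball_lt_top.ne) h1
  rw [ENNReal.toReal_mul, ENNReal.toReal_ofReal hr.le] at h2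
  gcongr
  linarith

end SurfaceOfCaps

/-! ### Support functions of bodies of revolution: gradient, Hessian, convexity -/

section Profiles

variable {n : ℕ}

/-- A twice continuously differentiable function of the latitude, with its derivatives. -/
structure Profile where
  val : ℝ → ℝ
  d1 : ℝ → ℝ
  d2 : ℝ → ℝ
  hasDerivAt_val : ∀ t, HasDerivAt val (d1 t) t
  hasDerivAt_d1 : ∀ t, HasDerivAt d1 (d2 t) t
  continuous_d2 : Continuous d2

namespace Profile

variable (q : Profile)

theorem continuous_val : Continuous q.val :=
  continuous_iff_continuousAt.2 fun t => (q.hasDerivAt_val t).continuousAt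

theorem continuous_d1 : Continuous q.d1 :=
  continuous_iff_continuousAt.2 fun t => (q.hasDerivAt_d1 t).continuousAt

/-- The principal radius of curvature in the directions of the parallels. -/
def tan (t : ℝ) : ℝ := q.val t - t * q.d1 t

/-- The principal radius of curvature in the direction of the meridians. -/
def rad (t : ℝ) : ℝ := q.tan t + (1 - t ^ 2) * q.d2 t

theorem continuous_tan : Continuous q.tan := by
  have := q.continuous_val
  have := q.continuous_d1
  unfold tan
  fun_prop

theorem continuous_rad : Continuous q.rad := by
  have := q.continuous_tan
  have := q.continuous_d2
  unfold rad
  fun_prop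

theorem hasDerivAt_tan (t : ℝ) : HasDerivAt q.tan (-(t * q.d2 t)) t := by
  refine ((q.hasDerivAt_val t).sub ((hasDerivAt_id t).mul (q.hasDerivAt_d1 t))).congr_deriv ?_
  simp

/-- Profiles of support functions of convex bodies of revolution containing the origin. -/
structure IsConvex (q : Profile) : Prop where
  nonneg : ∀ t, |t| ≤ 1 → 0 ≤ q.val t
  tan_nonneg : ∀ t, |t| ≤ 1 → 0 ≤ q.tan t
  rad_nonneg : ∀ t, |t| ≤ 1 → 0 ≤ q.rad t

end Profile

/-- The latitude of `x ≠ 0` with respect to the pole `e`. -/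
noncomputable def lat (e x : Euc n) : ℝ := ⟪e, x⟫ * ‖x‖⁻¹

/-- The unit vector in the direction of `x ≠ 0`. -/
noncomputable def dir (x : Euc n) : Euc n := ‖x‖⁻¹ • x

/-- The component of the pole `e` orthogonal to `x ≠ 0`. -/
noncomputable def perp (e x : Euc n) : Euc n := e - lat e x • dir x

theorem norm_dir {x : Euc n} (hx : x ≠ 0) : ‖dir x‖ = 1 := by
  rw [dir, norm_smul, norm_inv, norm_norm, inv_mul_cancel₀ (norm_ne_zero_iff.2 hx)]

theorem inner_dir (e x : Euc n) : ⟪e, dir x⟫ = lat e x := by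
  rw [dir, real_inner_smul_right, lat, mul_comm]

theorem abs_lat_le_one {e x : Euc n} (he : ‖e‖ = 1) (hx : x ≠ 0) : |lat e x| ≤ 1 := by
  rw [← inner_dir]
  refine (abs_real_inner_le_norm _ _).trans ?_
  rw [he, norm_dir hx, mul_one]

theorem inner_dir_perp {e x : Euc n} (hx : x ≠ 0) : ⟪dir x, perp e x⟫ = 0 := by
  rw [perp, inner_sub_right, real_inner_smul_right, real_inner_self_eq_norm_sq, norm_dir hx,
    real_inner_comm, inner_dir]
  ring

theorem norm_perp_sq {e x : Euc n} (he : ‖e‖ = 1) (hx : x ≠ 0) :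
    ‖perp e x‖ ^ 2 = 1 - lat e x ^ 2 := by
  rw [perp, norm_sub_sq_real, real_inner_smul_right, inner_dir, norm_smul, norm_dir hx, he,
    Real.norm_eq_abs, mul_one, sq_abs]
  ring

theorem lat_smul {e x : Euc n} {c : ℝ} (hc : 0 < c) : lat e (c • x) = lat e x := by
  rw [lat, lat, real_inner_smul_right, norm_smul, Real.norm_of_nonneg hc.le, mul_inv]
  field_simp

theorem dir_smul {x : Euc n} {c : ℝ} (hc : 0 < c) : dir (c • x) = dir x := by
  rw [dir, dir, norm_smul, Real.norm_of_nonneg hc.le, mul_inv, smul_smul]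
  congr 1
  field_simp

theorem lat_sph (e u : Sph n) : lat (e : Euc n) u = ⟪(e : Euc n), (u : Euc n)⟫ := by
  rw [lat, norm_eq_of_mem_sphere, inv_one, mul_one]

theorem dir_sph (u : Sph n) : dir (u : Euc n) = u := by
  rw [dir, norm_eq_of_mem_sphere, inv_one, one_smul]

theorem sph_ne_zero (u : Sph n) : (u : Euc n) ≠ 0 := by
  rw [← norm_ne_zero_iff, norm_eq_of_mem_sphere]
  exact one_ne_zero

theorem hasFDerivAt_norm_euc {x : Euc n} (hx : x ≠ 0) :
    HasFDerivAt (fun y : Euc n => ‖y‖) (innerSL ℝ (dir x)) x := by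
  have hx' : ‖x‖ ≠ 0 := norm_ne_zero_iff.2 hx
  have h1 : HasFDerivAt (fun y : Euc n => ‖y‖ ^ 2) (2 • innerSL ℝ x) x :=
    (hasStrictFDerivAt_norm_sq x).hasFDerivAt
  have h2 := h1.sqrt (by positivity)
  have h3 : (fun y : Euc n => √(‖y‖ ^ 2)) = fun y => ‖y‖ := by
    funext y
    exact Real.sqrt_sq (norm_nonneg y)
  rw [h3] at h2
  refine h2.congr_fderiv ?_
  ext v
  rw [Real.sqrt_sq (norm_nonneg x)]
  simp [dir]
  field_simp

theorem hasFDerivAt_inv_norm_euc {x : Euc n} (hx : x ≠ 0) :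
    HasFDerivAt (fun y : Euc n => ‖y‖⁻¹) (-(‖x‖⁻¹ ^ 2) • innerSL ℝ (dir x)) x := by
  have hx' : ‖x‖ ≠ 0 := norm_ne_zero_iff.2 hx
  have h := (hasDerivAt_inv hx').comp_hasFDerivAt x (hasFDerivAt_norm_euc hx)
  refine h.congr_fderiv ?_
  simp

theorem hasFDerivAt_lat {e x : Euc n} (hx : x ≠ 0) :
    HasFDerivAt (lat e) (‖x‖⁻¹ • innerSL ℝ (perp e x)) x := by
  have h1 : HasFDerivAt (fun y : Euc n => ⟪e, y⟫) (innerSL ℝ e) x := (innerSL ℝ e).hasFDerivAt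
  refine (h1.mul (hasFDerivAt_inv_norm_euc hx)).congr_fderiv ?_
  ext v
  simp [perp, lat]
  ring

theorem hasFDerivAt_dir {x : Euc n} (hx : x ≠ 0) :
    HasFDerivAt dir (rankTwo ‖x‖⁻¹ (-‖x‖⁻¹) 0 (dir x) 0) x := by
  refine ((hasFDerivAt_inv_norm_euc hx).smul (hasFDerivAt_id x)).congr_fderiv ?_
  ext1 v
  rw [rankTwo_apply]
  simp [dir, smul_smul, real_inner_smul_left]
  module

/-- The `1`-homogeneous extension of a zonal function. -/
noncomputable def zonalExt (q : Profile) (e x : Euc n) : ℝ := ‖x‖ * q.val (lat e x)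

/-- The gradient of the `1`-homogeneous extension of a zonal function. -/
noncomputable def zonalGrad (q : Profile) (e x : Euc n) : Euc n :=
  q.tan (lat e x) • dir x + q.d1 (lat e x) • e

theorem hasFDerivAt_zonalExt (q : Profile) {e x : Euc n} (hx : x ≠ 0) :
    HasFDerivAt (zonalExt q e) (innerSL ℝ (zonalGrad q e x)) x := by
  have hx' : ‖x‖ ≠ 0 := norm_ne_zero_iff.2 hx
  have h := (hasFDerivAt_norm_euc hx).mul
    ((q.hasDerivAt_val (lat e x)).comp_hasFDerivAt x (hasFDerivAt_lat hx))
  refine h.congr_fderiv ?_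
  ext v
  simp [zonalGrad, Profile.tan, perp]
  field_simp
  ring

/-- The derivative of the gradient of the `1`-homogeneous extension of a zonal function. -/
noncomputable def zonalHess (q : Profile) (e x : Euc n) : Euc n →L[ℝ] Euc n :=
  rankTwo (‖x‖⁻¹ * q.tan (lat e x)) (-(‖x‖⁻¹ * q.tan (lat e x))) (‖x‖⁻¹ * q.d2 (lat e x))
    (dir x) (perp e x)

/-- By homogeneity the Hessian annihilates `dir x`. On the orthogonal complement it is `‖x‖⁻¹ (tan ·
Id + q'' w ⊗ w)` with `w = perp e x` and `‖w‖² = 1 - t²`, so `tan` (`n-2` times) and `rad` are the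
principal radii of curvature. -/
theorem hasFDerivAt_zonalGrad (q : Profile) {e x : Euc n} (hx : x ≠ 0) :
    HasFDerivAt (zonalGrad q e) (zonalHess q e x) x := by
  have h1 := (q.hasDerivAt_tan (lat e x)).comp_hasFDerivAt x (hasFDerivAt_lat hx)
  have h2 := (q.hasDerivAt_d1 (lat e x)).comp_hasFDerivAt x (hasFDerivAt_lat hx)
  have h := (h1.smul (hasFDerivAt_dir hx)).add (h2.smul_const e)
  refine h.congr_fderiv ?_
  ext1 v
  simp only [zonalHess, rankTwo_apply, add_apply,
    smul_apply, ContinuousLinearMap.smulRight_apply, Function.comp,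
    innerSL_apply_apply, smul_eq_mul]
  have : perp e x = e - lat e x • dir x := rfl
  simp only [inner_zero_left]
  set s := ⟪perp e x, v⟫
  rw [this]
  module

theorem inner_zonalGrad_self (q : Profile) {e x : Euc n} (hx : x ≠ 0) :
    ⟪zonalGrad q e x, x⟫ = zonalExt q e x := by
  have hx' : ‖x‖ ≠ 0 := norm_ne_zero_iff.2 hx
  rw [zonalGrad, inner_add_left, real_inner_smul_left, real_inner_smul_left, dir,
    real_inner_smul_left, real_inner_self_eq_norm_sq, zonalExt, Profile.tan]
  have : ⟪e, x⟫ = ‖x‖ * lat e x := by rw [lat]; field_simp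
  rw [this]
  field_simp
  ring

theorem zonalGrad_smul (q : Profile) {e x : Euc n} {c : ℝ} (hc : 0 < c) :
    zonalGrad q e (c • x) = zonalGrad q e x := by
  rw [zonalGrad, zonalGrad, lat_smul hc, dir_smul hc]

theorem zonalExt_nonneg {q : Profile} (hq : q.IsConvex) {e x : Euc n} (he : ‖e‖ = 1)
    (hx : x ≠ 0) : 0 ≤ zonalExt q e x :=
  mul_nonneg (norm_nonneg x) (hq.nonneg _ (abs_lat_le_one he hx))

/-- Only `q'' < 0` needs an argument: Cauchy–Schwarz on the complement of `dir x` replaces `⟨w,v⟩²`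
by `(1-t²)‖z‖²`, after which the nonnegative combination `tan + (1-t²) q'' = rad` appears. -/
theorem inner_zonalHess_nonneg {q : Profile} (hq : q.IsConvex) {e x : Euc n} (he : ‖e‖ = 1)
    (hx : x ≠ 0) (v : Euc n) : 0 ≤ ⟪zonalHess q e x v, v⟫ := by
  have ht := abs_lat_le_one he hx
  have h1 := hq.tan_nonneg _ ht
  have h2 := hq.rad_nonneg _ ht
  rw [Profile.rad] at h2
  set t := lat e x
  set u := dir x
  set w := perp e x
  have hu : ‖u‖ = 1 := norm_dir hx
  have hw : ‖w‖ ^ 2 = 1 - t ^ 2 := norm_perp_sq he hx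
  have huw : ⟪u, w⟫ = 0 := inner_dir_perp hx
  have e1 : ⟪zonalHess q e x v, v⟫
      = ‖x‖⁻¹ * (q.tan t * (‖v‖ ^ 2 - ⟪u, v⟫ ^ 2) + q.d2 t * ⟪w, v⟫ ^ 2) := by
    rw [zonalHess, rankTwo_apply, inner_add_left, inner_add_left, real_inner_smul_left,
      real_inner_smul_left, real_inner_smul_left, real_inner_self_eq_norm_sq]
    ring
  rw [e1]
  apply mul_nonneg (inv_nonneg.2 (norm_nonneg x))
  set z := v - ⟪u, v⟫ • u with hz
  have hz2 : ‖z‖ ^ 2 = ‖v‖ ^ 2 - ⟪u, v⟫ ^ 2 := by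
    rw [hz, norm_sub_sq_real, real_inner_smul_right, norm_smul, hu, Real.norm_eq_abs, mul_one,
      sq_abs, real_inner_comm]
    ring
  have hwz : ⟪w, v⟫ = ⟪w, z⟫ := by
    rw [hz, inner_sub_right, real_inner_smul_right, real_inner_comm u w, huw]
    ring
  have hcs : ⟪w, v⟫ ^ 2 ≤ (1 - t ^ 2) * ‖z‖ ^ 2 := by
    rw [hwz, ← hw, ← mul_pow, ← sq_abs]
    exact pow_le_pow_left₀ (abs_nonneg _) (abs_real_inner_le_norm w z) 2
  rw [← hz2]
  rcases le_or_gt 0 (q.d2 t) with h | h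
  · positivity
  · nlinarith [sq_nonneg ‖z‖]

/-- Along the segment from `x` to `y` the extension is convex by its Hessian, so it lies above its
tangent at `x`, which by Euler's relation is `⟨∇h(x), ·⟩`. -/
theorem inner_zonalGrad_le {q : Profile} (hq : q.IsConvex) {e x y : Euc n} (he : ‖e‖ = 1)
    (hx : x ≠ 0) (hy : y ≠ 0) : ⟪zonalGrad q e x, y⟫ ≤ zonalExt q e y := by
  set γ : ℝ → Euc n := fun τ => x + τ • (y - x) with hγ
  -- A segment through the origin leaves the domain of differentiability. Then `y` is a nonpositive
  -- multiple of `x`, and the claim reads nonpositive `≤` nonnegative because `h ≥ 0`.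
  by_cases h0 : ∃ τ ∈ Set.Icc (0 : ℝ) 1, γ τ = 0
  · obtain ⟨τ, hτ, h⟩ := h0
    have hτ0 : τ ≠ 0 := fun h' => hx (by simpa [hγ, h'] using h)
    have hτ1 : 0 < τ := lt_of_le_of_ne hτ.1 (Ne.symm hτ0)
    have e1 : y = (-((1 - τ) / τ)) • x := by
      have h2 : τ • y = -((1 - τ) • x) := by
        have : (1 - τ) • x + τ • y = 0 := by rw [← h, hγ]; module
        exact eq_neg_of_add_eq_zero_right this
      calc y = τ⁻¹ • (τ • y) := by rw [smul_smul, inv_mul_cancel₀ hτ0, one_smul]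
        _ = _ := by rw [h2, smul_neg, smul_smul, neg_smul, inv_mul_eq_div]
    have h3 : ⟪zonalGrad q e x, y⟫ ≤ 0 := by
      rw [e1, real_inner_smul_right, inner_zonalGrad_self q hx, neg_mul, neg_nonpos]
      apply mul_nonneg _ (zonalExt_nonneg hq he hx)
      exact div_nonneg (by linarith [hτ.2]) hτ.1
    exact h3.trans (zonalExt_nonneg hq he hy)
  · push Not at h0
    have hdγ : ∀ τ, HasDerivAt γ (y - x) τ := fun τ => by
      refine (((hasDerivAt_id τ).smul_const (y - x)).const_add x).congr_deriv ?_
      simp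
    have hg : ∀ τ ∈ Set.Icc (0 : ℝ) 1,
        HasDerivAt (fun τ => zonalExt q e (γ τ)) ⟪zonalGrad q e (γ τ), y - x⟫ τ := fun τ hτ =>
      (hasFDerivAt_zonalExt q (h0 τ hτ)).comp_hasDerivAt τ (hdγ τ)
    have hk : ∀ τ ∈ Set.Icc (0 : ℝ) 1, HasDerivAt (fun τ => ⟪zonalGrad q e (γ τ), y - x⟫)
        ⟪zonalHess q e (γ τ) (y - x), y - x⟫ τ := fun τ hτ => by
      have h1 := (hasFDerivAt_zonalGrad q (e := e) (h0 τ hτ)).comp_hasDerivAt τ (hdγ τ)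
      refine (h1.inner ℝ (hasDerivAt_const τ (y - x))).congr_deriv ?_
      simp
    have hkm : MonotoneOn (fun τ => ⟪zonalGrad q e (γ τ), y - x⟫) (Set.Icc 0 1) := by
      apply monotoneOn_of_deriv_nonneg (convex_Icc 0 1)
      · exact fun s hs => (hk s hs).continuousAt.continuousWithinAt
      · intro s hs
        rw [interior_Icc] at hs
        exact (hk s (Set.Ioo_subset_Icc_self hs)).differentiableAt.differentiableWithinAt
      · intro s hs
        rw [interior_Icc] at hs
        rw [(hk s (Set.Ioo_subset_Icc_self hs)).deriv]
        exact inner_zonalHess_nonneg hq he (h0 s (Set.Ioo_subset_Icc_self hs)) _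
    have hgm : MonotoneOn
        (fun τ => zonalExt q e (γ τ) - τ * ⟪zonalGrad q e (γ 0), y - x⟫) (Set.Icc 0 1) := by
      have hd : ∀ τ ∈ Set.Icc (0 : ℝ) 1, HasDerivAt
          (fun τ => zonalExt q e (γ τ) - τ * ⟪zonalGrad q e (γ 0), y - x⟫)
          (⟪zonalGrad q e (γ τ), y - x⟫ - ⟪zonalGrad q e (γ 0), y - x⟫) τ := fun τ hτ => by
        refine ((hg τ hτ).sub ((hasDerivAt_id τ).mul_const
          ⟪zonalGrad q e (γ 0), y - x⟫)).congr_deriv ?_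
        simp
      apply monotoneOn_of_deriv_nonneg (convex_Icc 0 1)
      · exact fun s hs => (hd s hs).continuousAt.continuousWithinAt
      · intro s hs
        rw [interior_Icc] at hs
        exact (hd s (Set.Ioo_subset_Icc_self hs)).differentiableAt.differentiableWithinAt
      · intro s hs
        rw [interior_Icc] at hs
        have hs' := Set.Ioo_subset_Icc_self hs
        rw [(hd s hs').deriv, sub_nonneg]
        exact hkm ⟨le_rfl, zero_le_one⟩ hs' hs'.1
    have h1 := hgm ⟨le_rfl, zero_le_one⟩ ⟨zero_le_one, le_rfl⟩ zero_le_one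
    have e0 : γ 0 = x := by simp [hγ]
    have e1 : γ 1 = y := by simp [hγ]
    simp only [e0, e1, zero_mul, one_mul, sub_zero, inner_sub_right,
      inner_zonalGrad_self q hx] at h1
    linarith

theorem inner_zonalGrad_sub_nonneg {q : Profile} (hq : q.IsConvex) {e x y : Euc n}
    (he : ‖e‖ = 1) (hx : x ≠ 0) (hy : y ≠ 0) :
    0 ≤ ⟪zonalGrad q e x - zonalGrad q e y, x - y⟫ := by
  have h1 := inner_zonalGrad_le hq he hx hy
  have h2 := inner_zonalGrad_le hq he hy hx
  rw [← inner_zonalGrad_self q hy] at h1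
  rw [← inner_zonalGrad_self q hx] at h2
  rw [inner_sub_left, inner_sub_right, inner_sub_right]
  linarith

end Profiles

/-! ### Bodies of revolution and their local parallel sets -/

section ZonalBodies

variable {n : ℕ}

/-- The convex body of revolution with support function `q (⟪e, ·⟫)`. -/
noncomputable def zonalBody (q : Profile) (hq : q.IsConvex) (e : Sph n) : ConvexBody (Euc n) where
  carrier := {z | ∀ u : Sph n, ⟪z, (u : Euc n)⟫ ≤ q.val ⟪(e : Euc n), (u : Euc n)⟫}
  convex' := by
    intro x hx y hy a b ha hb hab u
    rw [inner_add_left, real_inner_smul_left, real_inner_smul_left]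
    calc a * ⟪x, (u : Euc n)⟫ + b * ⟪y, (u : Euc n)⟫
        ≤ a * q.val ⟪(e : Euc n), (u : Euc n)⟫ + b * q.val ⟪(e : Euc n), (u : Euc n)⟫ := by
          gcongr
          exacts [hx u, hy u]
      _ = q.val ⟪(e : Euc n), (u : Euc n)⟫ := by rw [← add_mul, hab, one_mul]
  isCompact' := by
    apply Metric.isCompact_of_isClosed_isBounded
    · have : {z : Euc n | ∀ u : Sph n, ⟪z, (u : Euc n)⟫ ≤ q.val ⟪(e : Euc n), (u : Euc n)⟫}
          = ⋂ u : Sph n, {z | ⟪z, (u : Euc n)⟫ ≤ q.val ⟪(e : Euc n), (u : Euc n)⟫} := by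
        ext z; simp
      rw [this]
      exact isClosed_iInter fun u => isClosed_le (by fun_prop) continuous_const
    · obtain ⟨M, hM⟩ := (isCompact_Icc (a := (-1 : ℝ)) (b := 1)).exists_bound_of_continuousOn
        q.continuous_val.continuousOn
      refine (isBounded_iff_forall_norm_le).2 ⟨M, fun z hz => ?_⟩
      have hM' : ∀ u : Sph n, q.val ⟪(e : Euc n), (u : Euc n)⟫ ≤ M := fun u =>
        (le_abs_self _).trans (hM _ (abs_le.1 (abs_inner_sph_le_one e u)))
      by_cases h : z = 0
      · rw [h, norm_zero]
        exact (hq.nonneg _ (abs_inner_sph_le_one e e)).trans (hM' e)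
      · have h1 := hz ⟨dir z, by rw [mem_sphere_zero_iff_norm, norm_dir h]⟩
        have h2 : ⟪z, dir z⟫ = ‖z‖ := by
          rw [dir, real_inner_smul_right, real_inner_self_eq_norm_sq]
          have := norm_ne_zero_iff.2 h
          field_simp
        rw [h2] at h1
        exact h1.trans (hM' _)
  nonempty' := ⟨0, fun u => by
    rw [inner_zero_left]
    exact hq.nonneg _ (abs_inner_sph_le_one e u)⟩

variable {q : Profile} (hq : q.IsConvex) (e : Sph n)

theorem zonalExt_sph (q : Profile) (e u : Sph n) :
    zonalExt q (e : Euc n) u = q.val ⟪(e : Euc n), (u : Euc n)⟫ := by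
  rw [zonalExt, norm_eq_of_mem_sphere, one_mul, lat_sph]

theorem inner_le_zonalExt {z : Euc n} (hz : z ∈ zonalBody q hq e) {x : Euc n} (hx : x ≠ 0) :
    ⟪z, x⟫ ≤ zonalExt q (e : Euc n) x := by
  have h := hz ⟨dir x, by rw [mem_sphere_zero_iff_norm, norm_dir hx]⟩
  simp only [inner_dir] at h
  calc ⟪z, x⟫ = ‖x‖ * lat z x := by
        rw [lat]
        have := norm_ne_zero_iff.2 hx
        field_simp
    _ ≤ _ := mul_le_mul_of_nonneg_left h (norm_nonneg x)

theorem zonalGrad_mem_zonalBody {x : Euc n} (hx : x ≠ 0) :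
    zonalGrad q (e : Euc n) x ∈ zonalBody q hq e := fun u => by
  rw [← zonalExt_sph]
  exact inner_zonalGrad_le hq (norm_eq_of_mem_sphere e) hx (sph_ne_zero u)

theorem supp_zonalBody (u : Sph n) :
    supp (zonalBody q hq e) (u : Euc n) = q.val ⟪(e : Euc n), (u : Euc n)⟫ := by
  apply IsGreatest.csSup_eq
  constructor
  · refine ⟨zonalGrad q (e : Euc n) u, zonalGrad_mem_zonalBody hq e (sph_ne_zero u), ?_⟩
    simp only
    rw [real_inner_comm, inner_zonalGrad_self q (sph_ne_zero u), zonalExt_sph]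
  · rintro _ ⟨z, hz, rfl⟩
    simp only
    rw [real_inner_comm]
    exact hz u

/-- A point of the body that attains the support function at `x` makes `h - ⟨z,·⟩` minimal there, so
the gradient vanishes: each normal direction has a unique support point. -/
theorem eq_zonalGrad_of_inner_eq {z : Euc n} (hz : z ∈ zonalBody q hq e) {x : Euc n} (hx : x ≠ 0)
    (h : ⟪z, x⟫ = zonalExt q (e : Euc n) x) : z = zonalGrad q (e : Euc n) x := by
  have hmin : IsLocalMin (fun y => zonalExt q (e : Euc n) y - ⟪z, y⟫) x := by
    filter_upwards [isOpen_ne.mem_nhds hx] with y hy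
    rw [h, sub_self, sub_nonneg]
    exact inner_le_zonalExt hq e hz hy
  have hd : HasFDerivAt (fun y => zonalExt q (e : Euc n) y - ⟪z, y⟫)
      (innerSL ℝ (zonalGrad q (e : Euc n) x) - innerSL ℝ z) x :=
    (hasFDerivAt_zonalExt q hx).sub (innerSL ℝ z).hasFDerivAt
  have h0 := hmin.hasFDerivAt_eq_zero hd
  rw [← map_sub] at h0
  have h1 : zonalGrad q (e : Euc n) x - z = 0 := by
    rw [← inner_self_eq_zero (𝕜 := ℝ)]
    have := congrArg (fun T : Euc n →L[ℝ] ℝ => T (zonalGrad q (e : Euc n) x - z)) h0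
    exact this
  exact (sub_eq_zero.1 h1).symm

/-- The truncated cone over a subset of the sphere. -/
def truncCone (t : ℝ) (A : Set (Sph n)) : Set (Euc n) :=
  {y | ∃ u ∈ A, ∃ s : ℝ, 0 < s ∧ s ≤ t ∧ y = s • (u : Euc n)}

theorem truncCone_ne_zero {t : ℝ} {A : Set (Sph n)} {y : Euc n} (hy : y ∈ truncCone t A) :
    y ≠ 0 := by
  obtain ⟨u, -, s, hs, -, rfl⟩ := hy
  exact smul_ne_zero hs.ne' (sph_ne_zero u)

/-- A point at distance `s` with outer normal `u` is `s u + ∇h(u)`, and `∇h` is `0`-homogeneous, so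
it equals `y + ∇h(y)` for `y = s u`. -/
theorem localParallelSet_zonalBody (t : ℝ) (A : Set (Sph n)) :
    localParallelSet (zonalBody q hq e) t A
      = (fun y => y + zonalGrad q (e : Euc n) y) '' truncCone t A := by
  ext x
  constructor
  · rintro ⟨p, hp, u, hu, s, hs, hst, rfl, hdist⟩
    refine ⟨s • (u : Euc n), ⟨u, hu, s, hs, hst, rfl⟩, ?_⟩
    have hmax : ∀ z ∈ zonalBody q hq e, ⟪z, (u : Euc n)⟫ ≤ ⟪p, (u : Euc n)⟫ := by
      intro z hz
      by_contra hlt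
      push Not at hlt
      set d := z - p with hd
      have hdu : 0 < ⟪d, (u : Euc n)⟫ := by rw [hd, inner_sub_left]; linarith
      have hd0 : 0 < ‖d‖ ^ 2 := by
        have : d ≠ 0 := fun h => by rw [h, inner_zero_left] at hdu; exact lt_irrefl _ hdu
        have := norm_pos_iff.2 this
        positivity
      -- If `z` lay beyond the supporting hyperplane at `p`, moving from `p` towards `z` by this `τ`
      -- would bring the body closer to `p + s u` than `s`; the second entry bounds the quadratic
      -- term `τ²‖d‖²` by the linear gain.
      set τ := min 1 (s * ⟪d, (u : Euc n)⟫ / ‖d‖ ^ 2) with hτ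
      have hτ0 : 0 < τ := lt_min one_pos (by positivity)
      have hτ1 : τ ≤ 1 := min_le_left _ _
      have hτ2 : τ * ‖d‖ ^ 2 ≤ s * ⟪d, (u : Euc n)⟫ := by
        rw [← le_div_iff₀ hd0]; exact min_le_right _ _
      have hmem : p + τ • d ∈ zonalBody q hq e := by
        have := (zonalBody q hq e).convex hp hz (a := 1 - τ) (b := τ) (by linarith) hτ0.le (by ring)
        have e1 : p + τ • d = (1 - τ) • p + τ • z := by rw [hd]; module
        rw [e1]
        exact this
      have h1 := Metric.infDist_le_dist_of_mem (x := p + s • (u : Euc n)) hmem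
      rw [hdist, dist_eq_norm] at h1
      have h2 : p + s • (u : Euc n) - (p + τ • d) = s • (u : Euc n) - τ • d := by abel
      rw [h2] at h1
      have h3 : s ^ 2 ≤ ‖s • (u : Euc n) - τ • d‖ ^ 2 := by gcongr
      rw [norm_sub_sq_real, norm_smul, norm_smul, norm_eq_of_mem_sphere, real_inner_smul_left,
        real_inner_smul_right, real_inner_comm, Real.norm_of_nonneg hs.le,
        Real.norm_of_nonneg hτ0.le, mul_pow τ] at h3
      have h4 : τ * (τ * ‖d‖ ^ 2) ≤ τ * (s * ⟪d, (u : Euc n)⟫) := by gcongr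
      have h5 : 0 < τ * (s * ⟪d, (u : Euc n)⟫) := by positivity
      nlinarith
    have heq : ⟪p, (u : Euc n)⟫ = zonalExt q (e : Euc n) u := by
      apply le_antisymm (inner_le_zonalExt hq e hp (sph_ne_zero u))
      rw [← inner_zonalGrad_self q (sph_ne_zero u)]
      exact hmax _ (zonalGrad_mem_zonalBody hq e (sph_ne_zero u))
    have := eq_zonalGrad_of_inner_eq hq e hp (sph_ne_zero u) heq
    simp only [zonalGrad_smul q hs]
    rw [← this, add_comm]
  · rintro ⟨_, ⟨u, hu, s, hs, hst, rfl⟩, rfl⟩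
    have hmem := zonalGrad_mem_zonalBody hq e (sph_ne_zero u)
    refine ⟨zonalGrad q (e : Euc n) u, hmem, u, hu, s, hs, hst, ?_, ?_⟩
    · simp only [zonalGrad_smul q hs]
      rw [add_comm]
    · simp only [zonalGrad_smul q hs]
      set p := zonalGrad q (e : Euc n) u with hp
      apply le_antisymm
      · refine (Metric.infDist_le_dist_of_mem hmem).trans (le_of_eq ?_)
        rw [dist_eq_norm, add_sub_cancel_right, norm_smul, norm_eq_of_mem_sphere, mul_one,
          Real.norm_of_nonneg hs.le]
      · rw [Metric.le_infDist ⟨p, hmem⟩]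
        intro z hz
        have h1 : ⟪z, (u : Euc n)⟫ ≤ ⟪p, (u : Euc n)⟫ := by
          rw [hp, inner_zonalGrad_self q (sph_ne_zero u)]
          exact inner_le_zonalExt hq e hz (sph_ne_zero u)
        have h2 : s ≤ ⟪s • (u : Euc n) + p - z, (u : Euc n)⟫ := by
          rw [inner_sub_left, inner_add_left, real_inner_smul_left, real_inner_self_eq_norm_sq,
            norm_eq_of_mem_sphere]
          linarith
        have h3 := real_inner_le_norm (s • (u : Euc n) + p - z) (u : Euc n)
        rw [norm_eq_of_mem_sphere, mul_one] at h3
        rw [dist_eq_norm]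
        exact h2.trans h3

/-- The gradient of a convex function is monotone, so equal images force `-‖x-y‖² ≥ 0`. -/
theorem injOn_add_zonalGrad (hq : q.IsConvex) (e : Sph n) :
    Set.InjOn (fun y => y + zonalGrad q (e : Euc n) y) {0}ᶜ := by
  intro x hx y hy h
  have h1 := inner_zonalGrad_sub_nonneg hq (norm_eq_of_mem_sphere e) hx hy
  have h2 : zonalGrad q (e : Euc n) x - zonalGrad q (e : Euc n) y = -(x - y) := by
    simp only at h
    rw [sub_eq_iff_eq_add, neg_sub, sub_add_eq_add_sub, ← h]
    abel
  rw [h2, inner_neg_left, real_inner_self_eq_norm_sq] at h1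
  have h3 : ‖x - y‖ = 0 := by
    have := sq_nonneg ‖x - y‖
    exact pow_eq_zero_iff (two_ne_zero) |>.1 (by linarith)
  exact sub_eq_zero.1 (norm_eq_zero.1 h3)

/-- The Jacobian of `y ↦ y + ∇h(y)`: eigenvalue `1` in the radial direction, `1 + tan/s` on the
parallels and `1 + rad/s` on the meridian. -/
theorem det_id_add_zonalHess (hq : q.IsConvex) (e : Sph n) (hn : 2 ≤ n) {s : ℝ} (hs : 0 < s) (u : Sph n) :
    (ContinuousLinearMap.id ℝ (Euc n) + zonalHess q (e : Euc n) (s • (u : Euc n))).det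
      = (1 + s⁻¹ * q.tan ⟪(e : Euc n), (u : Euc n)⟫) ^ (n - 2)
        * (1 + s⁻¹ * q.rad ⟪(e : Euc n), (u : Euc n)⟫) := by
  have hne : s • (u : Euc n) ≠ 0 := smul_ne_zero hs.ne' (sph_ne_zero u)
  have hnorm : ‖s • (u : Euc n)‖ = s := by
    rw [norm_smul, norm_eq_of_mem_sphere, mul_one, Real.norm_of_nonneg hs.le]
  have hlat : lat (e : Euc n) (s • (u : Euc n)) = ⟪(e : Euc n), (u : Euc n)⟫ := by
    rw [lat_smul hs, lat_sph]
  have h1 := hq.tan_nonneg _ (abs_inner_sph_le_one e u)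
  have e1 : ContinuousLinearMap.id ℝ (Euc n) + zonalHess q (e : Euc n) (s • (u : Euc n))
      = rankTwo (1 + s⁻¹ * q.tan ⟪(e : Euc n), (u : Euc n)⟫)
        (-(s⁻¹ * q.tan ⟪(e : Euc n), (u : Euc n)⟫)) (s⁻¹ * q.d2 ⟪(e : Euc n), (u : Euc n)⟫)
        (dir (s • (u : Euc n))) (perp (e : Euc n) (s • (u : Euc n))) := by
    ext1 v
    rw [add_apply, zonalHess, rankTwo_apply, rankTwo_apply, hnorm, hlat]
    simp only [ContinuousLinearMap.id_apply]
    module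
  have hpos : 1 + s⁻¹ * q.tan ⟪(e : Euc n), (u : Euc n)⟫ ≠ 0 := by positivity
  rw [e1, det_rankTwo hn hpos (inner_dir_perp hne), norm_dir hne,
    norm_perp_sq (norm_eq_of_mem_sphere e) hne, hlat]
  congr 1
  rw [Profile.rad]
  ring

end ZonalBodies

/-! ### Local Steiner formula for bodies of revolution -/

section AreaMeasures

variable {n : ℕ}

/-- The `j`-th elementary symmetric function of `m` numbers equal to `a` and one number `b`. -/
def esymmRadii (m : ℕ) : ℕ → ℝ → ℝ → ℝ
  | 0, _, _ => 1
  | j + 1, a, b => (m.choose (j + 1) : ℝ) * a ^ (j + 1) + (m.choose j : ℝ) * b * a ^ j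

theorem esymmRadii_nonneg (m j : ℕ) {a b : ℝ} (ha : 0 ≤ a) (hb : 0 ≤ b) :
    0 ≤ esymmRadii m j a b := by
  cases j with
  | zero => exact zero_le_one
  | succ j => simp only [esymmRadii]; positivity

/-- The Steiner polynomial: the symmetric functions of the radii are the coefficients of `(s+a)^m
(s+b)`. -/
theorem sum_esymmRadii (m : ℕ) (a b s : ℝ) :
    ∑ j ∈ Finset.range (m + 2), esymmRadii m j a b * s ^ (m + 1 - j) = (s + a) ^ m * (s + b) := by
  have h1 : ∑ j ∈ Finset.range (m + 1), (m.choose j : ℝ) * a ^ j * s ^ (m - j) = (s + a) ^ m := by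
    rw [add_comm s a, add_pow]
    exact Finset.sum_congr rfl fun j _ => by ring
  have h2 : ∑ j ∈ Finset.range (m + 1), (m.choose (j + 1) : ℝ) * a ^ (j + 1) * s ^ (m - j)
      + s ^ (m + 1) = s * (s + a) ^ m := by
    have h3 : ∑ j ∈ Finset.range (m + 2), (m.choose j : ℝ) * a ^ j * s ^ (m + 1 - j)
        = s * (s + a) ^ m := by
      rw [Finset.sum_range_succ, Nat.choose_succ_self, ← h1, Finset.mul_sum]
      simp only [Nat.cast_zero, zero_mul, add_zero]
      refine Finset.sum_congr rfl fun j hj => ?_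
      have : m + 1 - j = m - j + 1 := by
        have := Finset.mem_range.1 hj
        omega
      rw [this, pow_succ]
      ring
    rw [← h3, Finset.sum_range_succ' _ (m + 1)]
    simp
  rw [Finset.sum_range_succ']
  simp only [esymmRadii, Nat.add_sub_add_right, one_mul, Nat.sub_zero]
  have h4 : ∑ j ∈ Finset.range (m + 1), ((m.choose (j + 1) : ℝ) * a ^ (j + 1)
      + (m.choose j : ℝ) * b * a ^ j) * s ^ (m - j)
      = ∑ j ∈ Finset.range (m + 1), (m.choose (j + 1) : ℝ) * a ^ (j + 1) * s ^ (m - j)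
        + b * ∑ j ∈ Finset.range (m + 1), (m.choose j : ℝ) * a ^ j * s ^ (m - j) := by
    rw [Finset.mul_sum, ← Finset.sum_add_distrib]
    exact Finset.sum_congr rfl fun j _ => by ring
  rw [h4, h1]
  linear_combination h2

/-- The radial integral in polar coordinates: the weight `s^(m+1)` clears the denominators of the
Jacobian, leaving `∫ (s+a)^m (s+b) ds` over `(0,t]`. -/
theorem lintegral_shifted_pow {m : ℕ} {a b t : ℝ} (ha : 0 ≤ a) (hb : 0 ≤ b) (ht : 0 < t) :
    ∫⁻ s : Set.Ioi (0 : ℝ) in Set.Iic ⟨t, ht⟩,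
        ENNReal.ofReal ((1 + (s : ℝ)⁻¹ * a) ^ m * (1 + (s : ℝ)⁻¹ * b))
          ∂(Measure.volumeIoiPow (m + 1))
      = ENNReal.ofReal (∑ j ∈ Finset.range (m + 2),
          esymmRadii m j a b * (t ^ (m + 2 - j) / ((m + 2 - j : ℕ) : ℝ))) := by
  have hmeas : Measurable fun r : Set.Ioi (0 : ℝ) => ENNReal.ofReal (r.1 ^ (m + 1)) := by fun_prop
  have hmeas2 : Measurable fun s : Set.Ioi (0 : ℝ) =>
      ENNReal.ofReal ((1 + (s : ℝ)⁻¹ * a) ^ m * (1 + (s : ℝ)⁻¹ * b)) := by fun_prop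
  rw [Measure.volumeIoiPow, setLIntegral_withDensity_eq_setLIntegral_mul _ hmeas hmeas2
    measurableSet_Iic]
  have e1 : ∀ s : Set.Ioi (0 : ℝ), ((fun r : Set.Ioi (0 : ℝ) => ENNReal.ofReal (r.1 ^ (m + 1))) *
      fun s : Set.Ioi (0 : ℝ) =>
        ENNReal.ofReal ((1 + (s : ℝ)⁻¹ * a) ^ m * (1 + (s : ℝ)⁻¹ * b))) s
      = ENNReal.ofReal (((s : ℝ) + a) ^ m * ((s : ℝ) + b)) := by
    intro s
    have hs : (0 : ℝ) < s := s.2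
    rw [Pi.mul_apply, ← ENNReal.ofReal_mul (by positivity)]
    congr 1
    have h1 : (s : ℝ) + a = s * (1 + (s : ℝ)⁻¹ * a) := by field_simp
    have h2 : (s : ℝ) + b = s * (1 + (s : ℝ)⁻¹ * b) := by field_simp
    rw [h1, h2, mul_pow]
    ring
  simp only [e1]
  rw [setLIntegral_subtype measurableSet_Ioi (Set.Iic ⟨t, ht⟩)
    (fun s : ℝ => ENNReal.ofReal ((s + a) ^ m * (s + b)))]
  have himg : (Subtype.val '' (Set.Iic (⟨t, ht⟩ : Set.Ioi (0 : ℝ))) : Set ℝ) = Set.Ioc 0 t := by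
    ext x
    constructor
    · rintro ⟨y, hy, rfl⟩
      exact ⟨y.2, hy⟩
    · rintro ⟨h1, h2⟩
      exact ⟨⟨x, h1⟩, h2, rfl⟩
  rw [himg, ← ofReal_integral_eq_lintegral_ofReal]
  · congr 1
    rw [← intervalIntegral.integral_of_le ht.le]
    simp only [← sum_esymmRadii]
    rw [intervalIntegral.integral_finsetSum fun j _ =>
      (by fun_prop : Continuous fun s : ℝ => esymmRadii m j a b * s ^ (m + 1 - j)).intervalIntegrable
        _ _]
    refine Finset.sum_congr rfl fun j hj => ?_
    have hj' : m + 1 - j + 1 = m + 2 - j := by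
      have := Finset.mem_range.1 hj
      omega
    rw [intervalIntegral.integral_const_mul, integral_pow, hj', zero_pow (by omega), sub_zero,
      ← hj']
    push_cast
    ring
  · exact ((by fun_prop : Continuous fun s : ℝ => (s + a) ^ m * (s + b)).integrableOn_Icc).mono_set
      Set.Ioc_subset_Icc_self
  · filter_upwards [ae_restrict_mem measurableSet_Ioc] with s hs
    have := hs.1
    positivity

theorem truncCone_eq_image {t : ℝ} (ht : 0 < t) (A : Set (Sph n)) :
    truncCone t A = Subtype.val '' (homeomorphUnitSphereProd (Euc n) ⁻¹'
      (A ×ˢ Set.Iic (⟨t, ht⟩ : Set.Ioi (0 : ℝ)))) := by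
  ext y
  constructor
  · rintro ⟨u, hu, s, hs, hst, rfl⟩
    refine ⟨(homeomorphUnitSphereProd (Euc n)).symm (u, ⟨s, hs⟩), ?_, ?_⟩
    · rw [Set.mem_preimage, Homeomorph.apply_symm_apply]
      exact ⟨hu, hst⟩
    · simp
  · rintro ⟨y, hy, rfl⟩
    obtain ⟨hy1, hy2⟩ := hy
    refine ⟨_, hy1, ‖(y : Euc n)‖, norm_pos_iff.2 y.2, ?_, ?_⟩
    · have h : (((homeomorphUnitSphereProd (Euc n)) y).2 : ℝ) ≤ t := hy2
      simpa using h
    have h0 : ‖(y : Euc n)‖ ≠ 0 := norm_ne_zero_iff.2 y.2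
    simp [smul_smul, h0]

theorem measurableSet_truncCone {t : ℝ} (ht : 0 < t) {A : Set (Sph n)} (hA : MeasurableSet A) :
    MeasurableSet (truncCone t A) := by
  rw [truncCone_eq_image ht]
  apply (MeasurableEmbedding.subtype_coe (measurableSet_singleton (0 : Euc n)).compl
    ).measurableSet_image.2
  exact (homeomorphUnitSphereProd (Euc n)).measurable (hA.prod measurableSet_Iic)

variable {q : Profile} (hq : q.IsConvex) (e : Sph n)

/-- Change of variables under the injective map `y ↦ y + ∇h(y)` on the truncated cone, followed by
polar coordinates. -/
theorem volume_localParallelSet_zonalBody (hn : 2 ≤ n) {t : ℝ} (ht : 0 < t) {A : Set (Sph n)}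
    (hA : MeasurableSet A) :
    volume (localParallelSet (zonalBody q hq e) t A)
      = ∫⁻ u in A, ENNReal.ofReal (∑ j ∈ Finset.range n,
          esymmRadii (n - 2) j (q.tan ⟪(e : Euc n), (u : Euc n)⟫) (q.rad ⟪(e : Euc n), (u : Euc n)⟫)
            * (t ^ (n - j) / ((n - j : ℕ) : ℝ))) ∂(surf n) := by
  obtain ⟨m, rfl⟩ : ∃ m, n = m + 2 := ⟨n - 2, by omega⟩
  rw [localParallelSet_zonalBody, ← lintegral_abs_det_fderiv_eq_addHaar_image volume
    (measurableSet_truncCone ht hA) (f := fun y => y + zonalGrad q (e : Euc (m + 2)) y)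
    (f' := fun y => ContinuousLinearMap.id ℝ _ + zonalHess q (e : Euc (m + 2)) y)
    (fun y hy => ((hasFDerivAt_id y).add
      (hasFDerivAt_zonalGrad q (truncCone_ne_zero hy))).hasFDerivWithinAt)
    ((injOn_add_zonalGrad hq e).mono fun y hy => truncCone_ne_zero hy),
    truncCone_eq_image ht, ← setLIntegral_subtype (measurableSet_singleton (0 : Euc (m + 2))).compl]
  set k : Sph (m + 2) × Set.Ioi (0 : ℝ) → ENNReal := fun p => ENNReal.ofReal
    ((1 + (p.2 : ℝ)⁻¹ * q.tan ⟪(e : Euc (m + 2)), (p.1 : Euc (m + 2))⟫) ^ m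
      * (1 + (p.2 : ℝ)⁻¹ * q.rad ⟪(e : Euc (m + 2)), (p.1 : Euc (m + 2))⟫)) with hk
  have htan := q.continuous_tan
  have hrad := q.continuous_rad
  have hkm : Measurable k := by
    have h1 : Measurable fun p : Sph (m + 2) × Set.Ioi (0 : ℝ) =>
        q.tan ⟪(e : Euc (m + 2)), (p.1 : Euc (m + 2))⟫ :=
      (continuous_comp_inner htan e).measurable.comp measurable_fst
    have h2 : Measurable fun p : Sph (m + 2) × Set.Ioi (0 : ℝ) =>
        q.rad ⟪(e : Euc (m + 2)), (p.1 : Euc (m + 2))⟫ :=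
      (continuous_comp_inner hrad e).measurable.comp measurable_fst
    have h3 : Measurable fun p : Sph (m + 2) × Set.Ioi (0 : ℝ) => ((p.2 : ℝ)⁻¹) :=
      (measurable_subtype_coe.comp measurable_snd).inv
    fun_prop
  have hcongr : ∀ y : ({0}ᶜ : Set (Euc (m + 2))),
      ENNReal.ofReal |(ContinuousLinearMap.id ℝ _ + zonalHess q (e : Euc (m + 2)) y).det|
        = k (homeomorphUnitSphereProd (Euc (m + 2)) y) := by
    intro y
    obtain ⟨⟨u, s⟩, rfl⟩ := (homeomorphUnitSphereProd (Euc (m + 2))).symm.surjective y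
    have hs : (0 : ℝ) < s := s.2
    have e1 : ((homeomorphUnitSphereProd (Euc (m + 2))).symm (u, s) : Euc (m + 2))
        = (s : ℝ) • (u : Euc (m + 2)) := by simp
    rw [Homeomorph.apply_symm_apply, e1, det_id_add_zonalHess hq e (by omega) hs]
    have h1 := hq.tan_nonneg _ (abs_inner_sph_le_one e u)
    have h2 := hq.rad_nonneg _ (abs_inner_sph_le_one e u)
    rw [abs_of_nonneg (by positivity)]
    rfl
  simp only [hcongr]
  have hmp := Measure.measurePreserving_homeomorphUnitSphereProd
    (volume : Measure (Euc (m + 2)))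
  rw [hmp.setLIntegral_comp_preimage_emb (homeomorphUnitSphereProd _).measurableEmbedding,
    ← Measure.prod_restrict, lintegral_prod _ hkm.aemeasurable]
  refine lintegral_congr fun u => ?_
  have hfr : Module.finrank ℝ (Euc (m + 2)) - 1 = m + 1 := by
    rw [finrank_euclideanSpace_fin]; rfl
  rw [hfr]
  exact lintegral_shifted_pow (hq.tan_nonneg _ (abs_inner_sph_le_one e u))
    (hq.rad_nonneg _ (abs_inner_sph_le_one e u)) ht

end AreaMeasures

/-! ### Area measures of bodies of revolution -/

section AreaMeasuresExistence

variable {n : ℕ}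

/-- The `j`-th elementary symmetric function of the principal radii of curvature of a body of
revolution. -/
def Profile.curv (q : Profile) (n j : ℕ) (t : ℝ) : ℝ := esymmRadii (n - 2) j (q.tan t) (q.rad t)

theorem continuous_esymmRadii (m j : ℕ) : Continuous fun p : ℝ × ℝ => esymmRadii m j p.1 p.2 := by
  cases j <;> simp only [esymmRadii] <;> fun_prop

theorem Profile.continuous_curv (q : Profile) (n j : ℕ) : Continuous (q.curv n j) :=
  (continuous_esymmRadii (n - 2) j).comp (q.continuous_tan.prodMk q.continuous_rad)

theorem Profile.IsConvex.curv_nonneg {q : Profile} (hq : q.IsConvex) (n j : ℕ) {t : ℝ}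
    (ht : |t| ≤ 1) : 0 ≤ q.curv n j t :=
  esymmRadii_nonneg _ _ (hq.tan_nonneg t ht) (hq.rad_nonneg t ht)

/-- The normalizing constant of the `j`-th area measure. -/
noncomputable def areaConst (n j : ℕ) : ℝ := n / (((n - j : ℕ) : ℝ) * n.choose j)

theorem areaConst_nonneg (n j : ℕ) : 0 ≤ areaConst n j := by
  unfold areaConst
  positivity

theorem areaConst_pos {n j : ℕ} (hj : j < n) : 0 < areaConst n j := by
  have h1 : 0 < n := by omega
  have h2 : 0 < n - j := by omega
  have h3 := Nat.choose_pos hj.le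
  unfold areaConst
  positivity

/-- The `j`-th area measure of a body of revolution. -/
noncomputable def zonalArea (q : Profile) (e : Sph n) (j : ℕ) : Measure (Sph n) :=
  (surf n).withDensity fun u =>
    ENNReal.ofReal (areaConst n j * q.curv n j ⟪(e : Euc n), (u : Euc n)⟫)

theorem continuous_density (q : Profile) (e : Sph n) (j : ℕ) :
    Continuous fun u : Sph n => areaConst n j * q.curv n j ⟪(e : Euc n), (u : Euc n)⟫ :=
  (continuous_comp_inner (q.continuous_curv n j) e).const_mul _

/-- Comparing coefficients of `t^(n-j)` in the volume formula and in the Steiner formula dictates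
the factor `areaConst n j`. -/
theorem isAreaMeasures_zonalArea {q : Profile} (hq : q.IsConvex) (e : Sph n) (hn : 2 ≤ n) :
    IsAreaMeasures (zonalBody q hq e) (zonalArea q e) where
  finite j := isFiniteMeasure_withDensity_ofReal
    (integrable_of_continuous (surf n) (continuous_density q e j)).hasFiniteIntegral
  steiner t ht A hA := by
    rw [volume_localParallelSet_zonalBody hq e hn ht hA]
    have h1 : ∀ u : Sph n, ENNReal.ofReal (∑ j ∈ Finset.range n,
        esymmRadii (n - 2) j (q.tan ⟪(e : Euc n), (u : Euc n)⟫) (q.rad ⟪(e : Euc n), (u : Euc n)⟫)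
            * (t ^ (n - j) / ((n - j : ℕ) : ℝ)))
        = ∑ j ∈ Finset.range n, ENNReal.ofReal (q.curv n j ⟪(e : Euc n), (u : Euc n)⟫
            * (t ^ (n - j) / ((n - j : ℕ) : ℝ))) := fun u => by
      rw [ENNReal.ofReal_sum_of_nonneg]
      · rfl
      · intro j _
        exact mul_nonneg (hq.curv_nonneg n j (abs_inner_sph_le_one e u)) (by positivity)
    have hcm : ∀ j, Measurable fun u : Sph n => q.curv n j ⟪(e : Euc n), (u : Euc n)⟫ := fun j =>
      (continuous_comp_inner (q.continuous_curv n j) e).measurable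
    simp only [h1]
    rw [lintegral_finsetSum _ fun j _ => ((hcm j).mul_const _).ennreal_ofReal, Finset.mul_sum]
    refine Finset.sum_congr rfl fun j hj => ?_
    have hjn : j < n := Finset.mem_range.1 hj
    rw [zonalArea, withDensity_apply _ hA, ← lintegral_const_mul _
      ((hcm j).mul_const _).ennreal_ofReal, ← lintegral_const_mul _
      ((hcm j).const_mul _).ennreal_ofReal]
    refine lintegral_congr fun u => ?_
    have hnn : (0 : ℝ) ≤ n := n.cast_nonneg
    have hch : (0 : ℝ) ≤ n.choose j := (n.choose j).cast_nonneg
    rw [← ENNReal.ofReal_natCast n, ← ENNReal.ofReal_natCast (n.choose j),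
      ← ENNReal.ofReal_mul hnn, ← ENNReal.ofReal_mul hch, ← ENNReal.ofReal_mul (by positivity)]
    congr 1
    have h2 : ((n - j : ℕ) : ℝ) ≠ 0 := by
      have : n - j ≠ 0 := by omega
      exact_mod_cast this
    have h3 : (n.choose j : ℝ) ≠ 0 := by
      have := (Nat.choose_pos hjn.le).ne'
      exact_mod_cast this
    rw [areaConst]
    field_simp

theorem eq_of_sum_pow_eq {a b : ℕ → ℝ}
    (h : ∀ t : ℝ, 0 < t → ∑ j ∈ Finset.range n, a j * t ^ (n - j)
      = ∑ j ∈ Finset.range n, b j * t ^ (n - j)) {j : ℕ} (hj : j < n) : a j = b j := by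
  set p : Polynomial ℝ := ∑ j ∈ Finset.range n, Polynomial.monomial (n - j) (a j - b j) with hp
  have hp0 : p = 0 := by
    apply Polynomial.eq_zero_of_infinite_isRoot
    refine (Set.Ioi_infinite (0 : ℝ)).mono fun t ht => ?_
    have := h t ht
    change Polynomial.eval t p = 0
    rw [hp, Polynomial.eval_finsetSum]
    simp only [Polynomial.eval_monomial, sub_mul, Finset.sum_sub_distrib]
    linarith
  have h1 : p.coeff (n - j) = a j - b j := by
    rw [hp, Polynomial.finsetSum_coeff, Finset.sum_eq_single j]
    · rw [Polynomial.coeff_monomial, if_pos rfl]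
    · intro i hi hij
      have := Finset.mem_range.1 hi
      rw [Polynomial.coeff_monomial, if_neg (by omega)]
    · intro hj'
      exact absurd (Finset.mem_range.2 hj) hj'
  rw [hp0, Polynomial.coeff_zero] at h1
  linarith

/-- Area measures are unique. -/
theorem IsAreaMeasures.unique {K : ConvexBody (Euc n)} {S S' : ℕ → Measure (Sph n)}
    (hS : IsAreaMeasures K S) (hS' : IsAreaMeasures K S') {j : ℕ} (hj : j < n) : S j = S' j := by
  have key : ∀ {S : ℕ → Measure (Sph n)}, IsAreaMeasures K S → ∀ A, MeasurableSet A →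
      ∀ t : ℝ, 0 < t → ((n : ENNReal) * volume (localParallelSet K t A)).toReal
        = ∑ j ∈ Finset.range n, ((n.choose j : ℝ) * (S j A).toReal) * t ^ (n - j) := by
    intro S hS A hA t ht
    have hfin := hS.finite
    rw [hS.steiner t ht A hA, ENNReal.toReal_sum]
    · refine Finset.sum_congr rfl fun j _ => ?_
      rw [ENNReal.toReal_mul, ENNReal.toReal_mul, ENNReal.toReal_natCast,
        ENNReal.toReal_ofReal (by positivity)]
      ring
    · intro j _
      exact ENNReal.mul_ne_top (ENNReal.mul_ne_top (ENNReal.natCast_ne_top _)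
        ENNReal.ofReal_ne_top) (measure_ne_top _ _)
  refine Measure.ext fun A hA => ?_
  have hf := hS.finite
  have hf' := hS'.finite
  have h := eq_of_sum_pow_eq (n := n) (fun t ht => (key hS A hA t ht).symm.trans
    (key hS' A hA t ht)) hj
  have hch : (n.choose j : ℝ) ≠ 0 := by
    have := (Nat.choose_pos hj.le).ne'
    exact_mod_cast this
  exact (ENNReal.toReal_eq_toReal_iff' (measure_ne_top _ _) (measure_ne_top _ _)).1
    (mul_left_cancel₀ hch h)

/-- `areaMeasure` is a choice among solutions of the Steiner formula, so the explicit solution is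
identified with it through uniqueness. -/
theorem areaMeasure_zonalBody {q : Profile} (hq : q.IsConvex) (e : Sph n) (hn : 2 ≤ n) {i : ℕ}
    (hi : i < n) : areaMeasure (zonalBody q hq e) i = zonalArea q e i := by
  have hex : ∃ S : ℕ → Measure (Sph n), IsAreaMeasures (zonalBody q hq e) S :=
    ⟨_, isAreaMeasures_zonalArea hq e hn⟩
  rw [areaMeasure, dif_pos hex]
  exact hex.choose_spec.unique (isAreaMeasures_zonalArea hq e hn) hi

theorem integral_areaMeasure_zonalBody {q : Profile} (hq : q.IsConvex) (e : Sph n) (hn : 2 ≤ n)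
    {i : ℕ} (hi : i < n) (g : Sph n → ℝ) :
    ∫ u, g u ∂(areaMeasure (zonalBody q hq e) i)
      = areaConst n i * ∫ u, q.curv n i ⟪(e : Euc n), (u : Euc n)⟫ * g u ∂(surf n) := by
  rw [areaMeasure_zonalBody hq e hn hi, zonalArea,
    integral_withDensity_eq_integral_toReal_smul
      (continuous_density q e i).measurable.ennreal_ofReal
      (Eventually.of_forall fun _ => ENNReal.ofReal_lt_top), ← integral_const_mul]
  refine integral_congr_ae (Eventually.of_forall fun u => ?_)
  simp only [smul_eq_mul]
  rw [ENNReal.toReal_ofReal (mul_nonneg (areaConst_nonneg n i)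
    (hq.curv_nonneg n i (abs_inner_sph_le_one e u))), mul_assoc]

end AreaMeasuresExistence

/-! ### Convolution of zonal functions, support functions and Steiner points -/

section ZonalConvolution

variable {n : ℕ}

theorem exists_rotSph_eq (hn : 3 ≤ n) (e u : Sph n) :
    ∃ θ : Euc n ≃ₗᵢ[ℝ] Euc n, IsRotation θ ∧ rotSph θ e = u := by
  obtain ⟨θ, h1, h2, -⟩ := exists_rotation hn (a := (e : Euc n)) (b := u) (x := 0)
    (by rw [norm_eq_of_mem_sphere, norm_eq_of_mem_sphere]) (by simp)
  exact ⟨θ, h1, Subtype.ext h2⟩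

/-- The convolution of zonal functions. -/
theorem sphConv_zonal (hn : 3 ≤ n) (e : Sph n) (g : ℝ → ℝ) {f : Sph n → ℝ} (hf : ZonalFun e f)
    (u : Sph n) :
    sphConv e (fun v => g ⟪(e : Euc n), (v : Euc n)⟫) f u
      = ∫ v, g ⟪(u : Euc n), (v : Euc n)⟫ * f v ∂(surf n) := by
  have hex := exists_rotSph_eq hn e u
  rw [sphConv, dif_pos hex]
  obtain ⟨-, h2⟩ := hex.choose_spec
  set θ := hex.choose
  have hθe : θ (e : Euc n) = u := congrArg Subtype.val h2
  -- The chosen `θ` produces the kernel `g⟨θ⁻¹e, v⟩` instead of `g⟨u, v⟩`. Since `⟨θ⁻¹e, e⟩ = ⟨e,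
  -- θe⟩ = ⟨u, e⟩`, some rotation fixing `e` carries `θ⁻¹e` to `u`, and `f` is invariant under it.
  obtain ⟨η, hη, hηa, hηe⟩ := exists_rotation hn (a := θ.symm (e : Euc n)) (b := u) (x := e)
    (by rw [θ.symm.norm_map, norm_eq_of_mem_sphere, norm_eq_of_mem_sphere])
    (by
      rw [← θ.inner_map_map, θ.apply_symm_apply, hθe, real_inner_comm])
  rw [← integral_comp_rotSph η fun v => g ⟪(u : Euc n), (v : Euc n)⟫ * f v]
  have hz := hf η hη (Subtype.ext hηe)
  refine integral_congr_ae ?_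
  filter_upwards [hz] with v hv
  rw [hv]
  congr 2
  change ⟪(e : Euc n), θ v⟫ = ⟪(u : Euc n), η v⟫
  rw [← hηa, η.inner_map_map, ← θ.inner_map_map (θ.symm _), θ.apply_symm_apply]

theorem homExt_zonal (e : Sph n) (g : ℝ → ℝ) {x : Euc n} (hx : x ≠ 0) :
    homExt (fun u : Sph n => g ⟪(e : Euc n), (u : Euc n)⟫) x = g (lat (e : Euc n) x) := by
  rw [homExt, dif_pos hx, ← inner_dir]
  rfl

theorem contDiffAt_lat (e : Euc n) {x : Euc n} (hx : x ≠ 0) {m : WithTop ℕ∞} :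
    ContDiffAt ℝ m (lat e) x := by
  have h1 : ContDiffAt ℝ m (fun y : Euc n => ⟪e, y⟫) x := (innerSL ℝ e).contDiff.contDiffAt
  exact h1.mul ((contDiffAt_norm ℝ hx).inv (norm_ne_zero_iff.2 hx))

theorem smoothSph_zonal (e : Sph n) {g : ℝ → ℝ} (hg : ContDiff ℝ ∞ g) :
    SmoothSph fun u : Sph n => g ⟪(e : Euc n), (u : Euc n)⟫ := by
  have h : ContDiffOn ℝ ∞ (fun x => g (lat (e : Euc n) x)) {0}ᶜ := fun x hx =>
    (hg.contDiffAt.comp x (contDiffAt_lat (e : Euc n) hx)).contDiffWithinAt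
  exact h.congr fun x hx => homExt_zonal e g hx

theorem bddAbove_inner_image (K : ConvexBody (Euc n)) (x : Euc n) :
    BddAbove ((fun y : Euc n => ⟪x, y⟫) '' (K : Set (Euc n))) :=
  (K.isCompact.image (by fun_prop)).bddAbove

theorem supp_mono {K L : ConvexBody (Euc n)} (h : (K : Set (Euc n)) ⊆ L) (x : Euc n) :
    supp K x ≤ supp L x :=
  csSup_le_csSup (bddAbove_inner_image L x) (K.nonempty.image _) (Set.image_mono h)

theorem continuous_supp (K : ConvexBody (Euc n)) : Continuous (supp K) := by
  obtain ⟨M, hM⟩ := (isBounded_iff_forall_norm_le).1 K.isCompact.isBounded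
  have hM0 : 0 ≤ M := by
    obtain ⟨z, hz⟩ := K.nonempty
    exact (norm_nonneg z).trans (hM z hz)
  have key : ∀ x y, supp K x ≤ supp K y + M * dist x y := by
    intro x y
    refine csSup_le (K.nonempty.image _) ?_
    rintro _ ⟨z, hz, rfl⟩
    have h1 : ⟪y, z⟫ ≤ supp K y := le_csSup (bddAbove_inner_image K y) ⟨z, hz, rfl⟩
    have h2 : ⟪x - y, z⟫ ≤ dist x y * M := by
      rw [dist_eq_norm]
      exact (real_inner_le_norm _ _).trans (mul_le_mul_of_nonneg_left (hM z hz) (norm_nonneg _))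
    rw [inner_sub_left] at h2
    simp only
    linarith
  exact (LipschitzWith.of_le_add_mul ⟨M, hM0⟩ key).continuous

/-- The reflection in `w^⊥` fixes `e` and changes the sign of the integrand. -/
theorem integral_zonal_inner_eq_zero (e : Sph n) {g : ℝ → ℝ} (w : Euc n)
    (hw : ⟪(e : Euc n), w⟫ = 0) :
    ∫ u : Sph n, g ⟪(e : Euc n), (u : Euc n)⟫ * ⟪(u : Euc n), w⟫ ∂(surf n) = 0 := by
  set R := (ℝ ∙ w)ᗮ.reflection
  have hRe : R (e : Euc n) = e := reflection_eq_self_of_inner (by rw [real_inner_comm]; exact hw)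
  have hRw : R w = -w := Submodule.reflection_orthogonalComplement_singleton_eq_neg w
  have h := integral_comp_rotSph R
    fun u => g ⟪(e : Euc n), (u : Euc n)⟫ * ⟪(u : Euc n), w⟫
  have h2 : ∀ u : Sph n, g ⟪(e : Euc n), (rotSph R u : Euc n)⟫ * ⟪(rotSph R u : Euc n), w⟫
      = -(g ⟪(e : Euc n), (u : Euc n)⟫ * ⟪(u : Euc n), w⟫) := by
    intro u
    have e1 : ⟪(e : Euc n), (rotSph R u : Euc n)⟫ = ⟪(e : Euc n), (u : Euc n)⟫ := by
      change ⟪(e : Euc n), R u⟫ = _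
      rw [← R.inner_map_map (e : Euc n) u, hRe]
    have e2 : ⟪(rotSph R u : Euc n), w⟫ = -⟪(u : Euc n), w⟫ := by
      change ⟪R u, w⟫ = _
      rw [← R.inner_map_map (u : Euc n) w, hRw, inner_neg_right, neg_neg]
    rw [e1, e2]
    ring
  simp only [h2, integral_neg] at h
  linarith

/-- A profile is centered if it is orthogonal to the linear function `t`. -/
def Profile.IsCentered (q : Profile) (e : Sph n) : Prop :=
  ∫ u : Sph n, q.val ⟪(e : Euc n), (u : Euc n)⟫ * ⟪(e : Euc n), (u : Euc n)⟫ ∂(surf n) = 0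

/-- By symmetry the Steiner point lies on the axis, and its axial component is the integral that
vanishes for a centered profile. -/
theorem steinerPoint_zonalBody {q : Profile} (hq : q.IsConvex) (e : Sph n)
    (hc : q.IsCentered e) : steinerPoint (zonalBody q hq e) = 0 := by
  have hint : Integrable (fun u : Sph n =>
      supp (zonalBody q hq e) (u : Euc n) • (u : Euc n)) (surf n) := by
    apply integrable_of_continuous
    exact ((continuous_supp _).comp continuous_subtype_val).smul continuous_subtype_val
  rw [← inner_self_eq_zero (𝕜 := ℝ)]
  have h1 : ∀ y : Euc n, ⟪y, steinerPoint (zonalBody q hq e)⟫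
      = ∫ u : Sph n, q.val ⟪(e : Euc n), (u : Euc n)⟫ * ⟪(u : Euc n), y⟫ ∂(surf n) := by
    intro y
    rw [steinerPoint, ← integral_inner hint]
    refine integral_congr_ae (Eventually.of_forall fun u => ?_)
    simp only [real_inner_smul_right, supp_zonalBody, real_inner_comm y]
  set y := steinerPoint (zonalBody q hq e)
  rw [h1]
  set w := y - ⟪(e : Euc n), y⟫ • (e : Euc n) with hw
  have hew : ⟪(e : Euc n), w⟫ = 0 := by
    rw [hw, inner_sub_right, real_inner_smul_right, real_inner_self_eq_norm_sq,
      norm_eq_of_mem_sphere]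
    ring
  have h2 := integral_zonal_inner_eq_zero e (g := q.val) w hew
  have hcont := continuous_comp_inner q.continuous_val e
  have h3 : ∀ u : Sph n, q.val ⟪(e : Euc n), (u : Euc n)⟫ * ⟪(u : Euc n), y⟫
      = q.val ⟪(e : Euc n), (u : Euc n)⟫ * ⟪(u : Euc n), w⟫ + ⟪(e : Euc n), y⟫ *
        (q.val ⟪(e : Euc n), (u : Euc n)⟫ * ⟪(e : Euc n), (u : Euc n)⟫) := by
    intro u
    rw [hw, inner_sub_right, real_inner_smul_right, real_inner_comm (e : Euc n) (u : Euc n)]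
    ring
  simp only [h3]
  rw [integral_add, h2, integral_const_mul, hc]
  · ring
  · exact integrable_of_continuous _ (hcont.mul (by fun_prop))
  · exact integrable_of_continuous _ ((hcont.mul (by fun_prop)).const_mul _)

end ZonalConvolution

/-! ### Weak monotonicity in terms of the generating function -/

section Monotonicity

variable {n : ℕ}

instance [NeZero n] : (surf n).IsOpenPosMeasure :=
  inferInstanceAs (Measure.IsOpenPosMeasure (Measure.toSphere _))

theorem integral_comp_inner_eq (hn : 3 ≤ n) (g : ℝ → ℝ) (e v : Sph n) :
    ∫ u : Sph n, g ⟪(u : Euc n), (v : Euc n)⟫ ∂(surf n)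
      = ∫ u : Sph n, g ⟪(u : Euc n), (e : Euc n)⟫ ∂(surf n) := by
  obtain ⟨θ, -, hθ⟩ := exists_rotSph_eq hn e v
  rw [← integral_comp_rotSph θ]
  refine integral_congr_ae (Eventually.of_forall fun u => ?_)
  change g ⟪θ u, (v : Euc n)⟫ = _
  rw [← hθ]
  change g ⟪θ u, θ e⟫ = _
  rw [θ.inner_map_map]

theorem abs_inner_sub_inner_le (e u v : Sph n) :
    |⟪(e : Euc n), (u : Euc n)⟫ - ⟪(e : Euc n), (v : Euc n)⟫|
      ≤ √(2 * (1 - ⟪(u : Euc n), (v : Euc n)⟫)) := by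
  rw [← inner_sub_right]
  refine (abs_real_inner_le_norm _ _).trans ?_
  rw [norm_eq_of_mem_sphere, one_mul]
  apply Real.le_sqrt_of_sq_le
  rw [norm_sub_sq_real, norm_eq_of_mem_sphere, norm_eq_of_mem_sphere]
  linarith

theorem continuous_integral_kernel_mul {g : ℝ → ℝ} (hg : Continuous g) {f : Sph n → ℝ}
    (hf : Integrable f (surf n)) :
    Continuous fun u : Sph n => ∫ v, g ⟪(u : Euc n), (v : Euc n)⟫ * f v ∂(surf n) := by
  obtain ⟨M, hM⟩ := (isCompact_Icc (a := (-1 : ℝ)) (b := 1)).exists_bound_of_continuousOn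
    hg.continuousOn
  refine continuous_of_dominated (bound := fun v => M * |f v|) (fun u => ?_) (fun u => ?_)
    (hf.abs.const_mul M) ?_
  · exact (continuous_comp_inner hg u).aestronglyMeasurable.mul hf.aestronglyMeasurable
  · refine Eventually.of_forall fun v => ?_
    rw [norm_mul]
    exact mul_le_mul_of_nonneg_right (hM _ (abs_le.1 (abs_inner_sph_le_one u v))) (norm_nonneg _)
  · exact Eventually.of_forall fun v => by fun_prop

/-- Continuous functions are recovered from their averages over small caps. -/
theorem integral_mul_nonneg_of_kernel (hn : 3 ≤ n) (e : Sph n) {f : Sph n → ℝ}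
    (hf : Integrable f (surf n)) {D : ℝ → ℝ} (hD : Continuous D)
    (h : ∀ g : ℝ → ℝ, ContDiff ℝ ∞ g → (∀ t, 0 ≤ g t) →
      0 ≤ ∫ u, D ⟪(e : Euc n), (u : Euc n)⟫ *
        (∫ v, g ⟪(u : Euc n), (v : Euc n)⟫ * f v ∂(surf n)) ∂(surf n)) :
    0 ≤ ∫ v, f v * D ⟪(e : Euc n), (v : Euc n)⟫ ∂(surf n) := by
  have : NeZero n := ⟨by omega⟩
  have hDe := continuous_comp_inner hD e
  have hfD : Integrable (fun v => f v * D ⟪(e : Euc n), (v : Euc n)⟫) (surf n) := by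
    obtain ⟨M, hM⟩ := isCompact_univ.exists_bound_of_continuousOn hDe.continuousOn
    exact hf.mul_bdd (c := M) hDe.aestronglyMeasurable (Eventually.of_forall fun v => hM v trivial)
  suffices hε : ∀ ε : ℝ, 0 < ε → 0 ≤ ∫ v, f v * D ⟪(e : Euc n), (v : Euc n)⟫ ∂(surf n)
      + ε * ∫ v, |f v| ∂(surf n) by
    by_contra hneg
    push Not at hneg
    set I := ∫ v, f v * D ⟪(e : Euc n), (v : Euc n)⟫ ∂(surf n)
    set N := ∫ v, |f v| ∂(surf n)
    have hN : 0 ≤ N := integral_nonneg fun v => abs_nonneg _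
    have h1 := hε (-I / (2 * (N + 1))) (div_pos (by linarith) (by linarith))
    have h2 : -I / (2 * (N + 1)) * N ≤ -I / 2 := by
      rw [div_mul_eq_mul_div, div_le_div_iff₀ (by linarith) (by norm_num)]
      nlinarith
    linarith
  intro ε hε
  obtain ⟨δ, hδ, hunif⟩ := Metric.uniformContinuousOn_iff.1
    ((isCompact_Icc (a := (-1 : ℝ)) (b := 1)).uniformContinuousOn_of_continuous hD.continuousOn)
    ε hε
  -- Since `‖u - v‖² = 2(1 - ⟨u,v⟩)`, the kernel `g` lives on pairs at distance less than `δ`, where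
  -- `D` varies by less than `ε`.
  set η := δ ^ 2 / 2 with hη
  have hη0 : 0 < η := by positivity
  set g : ℝ → ℝ := fun t => Real.smoothTransition (t - (1 - η)) with hg
  have hgs : ContDiff ℝ ∞ g := Real.smoothTransition.contDiff.comp (contDiff_id.sub contDiff_const)
  have hgc := hgs.continuous
  have hg0 : ∀ t, 0 ≤ g t := fun t => Real.smoothTransition.nonneg _
  have hclose : ∀ u v : Sph n, |g ⟪(u : Euc n), (v : Euc n)⟫ *
      (D ⟪(e : Euc n), (u : Euc n)⟫ - D ⟪(e : Euc n), (v : Euc n)⟫)|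
        ≤ ε * g ⟪(u : Euc n), (v : Euc n)⟫ := by
    intro u v
    rw [abs_mul, abs_of_nonneg (hg0 _), mul_comm]
    rcases le_or_gt ⟪(u : Euc n), (v : Euc n)⟫ (1 - η) with h1 | h1
    · have : g ⟪(u : Euc n), (v : Euc n)⟫ = 0 :=
        Real.smoothTransition.zero_of_nonpos (by linarith)
      rw [this, mul_zero, mul_zero]
    · apply mul_le_mul_of_nonneg_right _ (hg0 _)
      have h2 := hunif _ (abs_le.1 (abs_inner_sph_le_one e u)) _
        (abs_le.1 (abs_inner_sph_le_one e v)) ?_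
      · rw [Real.dist_eq] at h2
        exact h2.le
      · rw [Real.dist_eq]
        refine (abs_inner_sub_inner_le e u v).trans_lt ?_
        rw [Real.sqrt_lt' hδ]
        linarith
  set c := ∫ u : Sph n, g ⟪(u : Euc n), (e : Euc n)⟫ ∂(surf n) with hc
  have hcont_u : ∀ v : Sph n, Continuous fun u : Sph n => g ⟪(u : Euc n), (v : Euc n)⟫ :=
    fun v => by fun_prop
  have hcpos : 0 < c := by
    apply (hcont_u e).integral_pos_of_hasCompactSupport_nonneg_nonzero
      (HasCompactSupport.of_compactSpace _) (fun u => hg0 _) (x := e)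
    rw [real_inner_self_eq_norm_sq, norm_eq_of_mem_sphere]
    exact (Real.smoothTransition.pos_of_pos (by linarith)).ne'
  have hcv : ∀ v : Sph n, ∫ u : Sph n, g ⟪(u : Euc n), (v : Euc n)⟫ ∂(surf n) = c :=
    fun v => integral_comp_inner_eq hn g e v
  -- By Fubini the smoothing moves from `f` to `D`. The average `H` of `D` is within `ε c` of `c D`,
  -- with `c` independent of the centre by rotation invariance, so only integrability of `f` is
  -- needed.
  set H : Sph n → ℝ := fun v => ∫ u : Sph n, g ⟪(u : Euc n), (v : Euc n)⟫
    * D ⟪(e : Euc n), (u : Euc n)⟫ ∂(surf n) with hH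
  have hHle : ∀ v, |H v - c * D ⟪(e : Euc n), (v : Euc n)⟫| ≤ ε * c := by
    intro v
    have e1 : H v - c * D ⟪(e : Euc n), (v : Euc n)⟫ = ∫ u : Sph n, g ⟪(u : Euc n), (v : Euc n)⟫ *
        (D ⟪(e : Euc n), (u : Euc n)⟫ - D ⟪(e : Euc n), (v : Euc n)⟫) ∂(surf n) := by
      rw [← hcv v, ← integral_mul_const, hH]
      simp only
      rw [← integral_sub]
      · exact integral_congr_ae (Eventually.of_forall fun u => by simp only; ring)
      · exact integrable_of_continuous _ ((hcont_u v).mul hDe)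
      · exact integrable_of_continuous _ ((hcont_u v).mul_const _)
    rw [e1]
    refine (abs_integral_le_integral_abs).trans ?_
    rw [← hcv v, ← integral_const_mul]
    apply integral_mono
    · exact integrable_of_continuous _ (((hcont_u v).mul (hDe.sub continuous_const)).abs)
    · exact integrable_of_continuous _ ((hcont_u v).const_mul _)
    · exact fun u => hclose u v
  have hker : Continuous fun p : Sph n × Sph n =>
      D ⟪(e : Euc n), (p.1 : Euc n)⟫ * g ⟪(p.1 : Euc n), (p.2 : Euc n)⟫ := by fun_prop
  have hprod : Integrable (fun p : Sph n × Sph n => (D ⟪(e : Euc n), (p.1 : Euc n)⟫ *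
      g ⟪(p.1 : Euc n), (p.2 : Euc n)⟫) * f p.2) ((surf n).prod (surf n)) := by
    obtain ⟨M, hM⟩ := isCompact_univ.exists_bound_of_continuousOn hker.continuousOn
    exact (hf.comp_snd (surf n)).bdd_mul (c := M) hker.aestronglyMeasurable
      (Eventually.of_forall fun p => hM p trivial)
  have hinner : ∀ v : Sph n, ∫ u : Sph n, (D ⟪(e : Euc n), (u : Euc n)⟫ *
      g ⟪(u : Euc n), (v : Euc n)⟫) * f v ∂(surf n) = f v * H v := by
    intro v
    simp only [hH]
    rw [← integral_const_mul]
    exact integral_congr_ae (Eventually.of_forall fun u => by simp only; ring)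
  have hfH : Integrable (fun v => f v * H v) (surf n) := by
    have := hprod.integral_prod_right
    simpa only [hinner] using this
  have hswap : ∫ u, D ⟪(e : Euc n), (u : Euc n)⟫ *
        (∫ v, g ⟪(u : Euc n), (v : Euc n)⟫ * f v ∂(surf n)) ∂(surf n)
      = ∫ v, f v * H v ∂(surf n) := by
    have h1 := integral_integral_swap (f := fun u v : Sph n => (D ⟪(e : Euc n), (u : Euc n)⟫ *
      g ⟪(u : Euc n), (v : Euc n)⟫) * f v) hprod
    have h2 : ∀ u : Sph n, D ⟪(e : Euc n), (u : Euc n)⟫ *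
        (∫ v, g ⟪(u : Euc n), (v : Euc n)⟫ * f v ∂(surf n))
        = ∫ v, (D ⟪(e : Euc n), (u : Euc n)⟫ * g ⟪(u : Euc n), (v : Euc n)⟫) * f v ∂(surf n) := by
      intro u
      rw [← integral_const_mul]
      exact integral_congr_ae (Eventually.of_forall fun v => by simp only; ring)
    simp only [h2]
    rw [h1]
    exact integral_congr_ae (Eventually.of_forall hinner)
  have hpos := h g hgs hg0
  rw [hswap] at hpos
  have hle : ∫ v, f v * H v ∂(surf n) ≤ ∫ v, (c * (f v * D ⟪(e : Euc n), (v : Euc n)⟫)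
      + (ε * c) * |f v|) ∂(surf n) := by
    apply integral_mono hfH ((hfD.const_mul _).add (hf.abs.const_mul _))
    intro v
    have h1 : f v * (H v - c * D ⟪(e : Euc n), (v : Euc n)⟫) ≤ |f v| * (ε * c) := by
      refine (le_abs_self _).trans ?_
      rw [abs_mul]
      exact mul_le_mul_of_nonneg_left (hHle v) (abs_nonneg _)
    simp only [Pi.add_apply]
    linarith
  rw [integral_add (hfD.const_mul _) (hf.abs.const_mul _), integral_const_mul,
    integral_const_mul] at hle
  have h3 : 0 ≤ c * (∫ v, f v * D ⟪(e : Euc n), (v : Euc n)⟫ ∂(surf n)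
      + ε * ∫ v, |f v| ∂(surf n)) := by
    rw [mul_add]
    linarith
  exact nonneg_of_mul_nonneg_right h3 hcpos

/-- Weak monotonicity of `Φ`, expressed through its generating function. -/
theorem integral_mul_curv_mono (hn : 3 ≤ n) (e : Sph n) {i : ℕ} (hi : i < n)
    {Φ : ConvexBody (Euc n) → ConvexBody (Euc n)} {f : Sph n → ℝ} (hΦ : WeaklyMonotone Φ)
    (hf : IsGeneratingFunction e i Φ f) {p q : Profile} (hp : p.IsConvex) (hq : q.IsConvex)
    (hpc : p.IsCentered e) (hqc : q.IsCentered e) (hpq : ∀ t, |t| ≤ 1 → p.val t ≤ q.val t) :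
    ∫ v, f v * p.curv n i ⟪(e : Euc n), (v : Euc n)⟫ ∂(surf n)
      ≤ ∫ v, f v * q.curv n i ⟪(e : Euc n), (v : Euc n)⟫ ∂(surf n) := by
  have hint : ∀ r : Profile,
      Integrable (fun v => f v * r.curv n i ⟪(e : Euc n), (v : Euc n)⟫) (surf n) := fun r => by
    have hr := continuous_comp_inner (r.continuous_curv n i) e
    obtain ⟨M, hM⟩ := isCompact_univ.exists_bound_of_continuousOn hr.continuousOn
    exact hf.integrable.mul_bdd (c := M) hr.aestronglyMeasurable
      (Eventually.of_forall fun v => hM v trivial)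
  rw [← sub_nonneg, ← integral_sub (hint q) (hint p)]
  -- The representation of `h(Φ K)` holds only in the sense of distributions. Tested against `g ≥
  -- 0`, the inclusion `Φ K ⊆ Φ L` gives exactly the smoothed inequality required here.
  have key := integral_mul_nonneg_of_kernel hn e hf.integrable
    (D := fun t => q.curv n i t - p.curv n i t)
    ((q.continuous_curv n i).sub (p.continuous_curv n i)) ?_
  · simpa only [mul_sub] using key
  intro g hg hg0
  have hsub : (Φ (zonalBody p hp e) : Set (Euc n)) ⊆ Φ (zonalBody q hq e) := by
    refine hΦ _ _ (fun z hz u => ?_) (steinerPoint_zonalBody hp e hpc)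
      (steinerPoint_zonalBody hq e hqc)
    exact (hz u).trans (hpq _ (abs_inner_sph_le_one e u))
  have hrep : ∀ (r : Profile) (hr : r.IsConvex),
      ∫ u : Sph n, g ⟪(e : Euc n), (u : Euc n)⟫ * supp (Φ (zonalBody r hr e)) (u : Euc n) ∂(surf n)
        = areaConst n i * ∫ u : Sph n, r.curv n i ⟪(e : Euc n), (u : Euc n)⟫
          * (∫ v, g ⟪(u : Euc n), (v : Euc n)⟫ * f v ∂(surf n)) ∂(surf n) := by
    intro r hr
    rw [hf.representation (zonalBody r hr e) (fun u => g ⟪(e : Euc n), (u : Euc n)⟫)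
      (smoothSph_zonal e hg), integral_areaMeasure_zonalBody hr e (by omega) hi]
    simp only [sphConv_zonal hn e g hf.zonal]
  have hgc := continuous_comp_inner hg.continuous e
  have hle : ∫ u : Sph n, g ⟪(e : Euc n), (u : Euc n)⟫ *
      supp (Φ (zonalBody p hp e)) (u : Euc n) ∂(surf n)
      ≤ ∫ u : Sph n, g ⟪(e : Euc n), (u : Euc n)⟫ *
        supp (Φ (zonalBody q hq e)) (u : Euc n) ∂(surf n) := by
    apply integral_mono
    · exact integrable_of_continuous _
        (hgc.mul ((continuous_supp _).comp continuous_subtype_val))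
    · exact integrable_of_continuous _
        (hgc.mul ((continuous_supp _).comp continuous_subtype_val))
    · exact fun u => mul_le_mul_of_nonneg_left (supp_mono hsub _) (hg0 _)
  rw [hrep p hp, hrep q hq] at hle
  have hle' := le_of_mul_le_mul_left hle (areaConst_pos hi)
  have hconv : Continuous fun u : Sph n => ∫ v, g ⟪(u : Euc n), (v : Euc n)⟫ * f v ∂(surf n) :=
    continuous_integral_kernel_mul hg.continuous hf.integrable
  rw [← sub_nonneg, ← integral_sub] at hle'
  · simpa only [sub_mul] using hle'
  · exact integrable_of_continuous _
      ((continuous_comp_inner (q.continuous_curv n i) e).mul hconv)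
  · exact integrable_of_continuous _
      ((continuous_comp_inner (p.continuous_curv n i) e).mul hconv)

end Monotonicity

/-! ### First variation of area densities -/

section Variation

variable {n : ℕ}

namespace Profile

/-- The constant profile. -/
def const (c : ℝ) : Profile where
  val _ := c
  d1 _ := 0
  d2 _ := 0
  hasDerivAt_val t := hasDerivAt_const t c
  hasDerivAt_d1 t := hasDerivAt_const t 0
  continuous_d2 := continuous_const

/-- The profile `q + ε p`. -/
def addSmul (q : Profile) (ε : ℝ) (p : Profile) : Profile where
  val t := q.val t + ε * p.val t
  d1 t := q.d1 t + ε * p.d1 t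
  d2 t := q.d2 t + ε * p.d2 t
  hasDerivAt_val t := (q.hasDerivAt_val t).add ((p.hasDerivAt_val t).const_mul ε)
  hasDerivAt_d1 t := (q.hasDerivAt_d1 t).add ((p.hasDerivAt_d1 t).const_mul ε)
  continuous_d2 := q.continuous_d2.add (p.continuous_d2.const_mul ε)

/-- The profile given by a smooth function. -/
noncomputable def ofContDiff (g : ℝ → ℝ) (hg : ContDiff ℝ ∞ g) : Profile where
  val := g
  d1 := deriv g
  d2 := deriv (deriv g)
  hasDerivAt_val t := (hg.differentiable (by simp) t).hasDerivAt
  hasDerivAt_d1 t := ((contDiff_infty_iff_deriv.1 hg).2.differentiable (by simp) t).hasDerivAt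
  continuous_d2 := (contDiff_infty_iff_deriv.1 (contDiff_infty_iff_deriv.1 hg).2).2.continuous

theorem tan_addSmul (q : Profile) (ε : ℝ) (p : Profile) (t : ℝ) :
    (q.addSmul ε p).tan t = q.tan t + ε * p.tan t := by
  simp only [tan, addSmul]
  ring

theorem rad_addSmul (q : Profile) (ε : ℝ) (p : Profile) (t : ℝ) :
    (q.addSmul ε p).rad t = q.rad t + ε * p.rad t := by
  simp only [rad, tan_addSmul]
  simp only [addSmul]
  ring

theorem tan_const (c t : ℝ) : (const c).tan t = c := by simp [tan, const]

theorem rad_const (c t : ℝ) : (const c).rad t = c := by simp [rad, tan_const]; simp [const]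

theorem isConvex_const {c : ℝ} (hc : 0 ≤ c) : (const c).IsConvex where
  nonneg _ _ := hc
  tan_nonneg t _ := by rwa [tan_const]
  rad_nonneg t _ := by rwa [rad_const]

/-- The operator `(n - 1) □_n` applied to a zonal function. -/
def box (n : ℕ) (q : Profile) (t : ℝ) : ℝ := ((n : ℝ) - 1) * q.tan t + (1 - t ^ 2) * q.d2 t

theorem continuous_box (n : ℕ) (q : Profile) : Continuous (q.box n) := by
  have := q.continuous_tan
  have := q.continuous_d2
  unfold box
  fun_prop

theorem box_eq (hn : 2 ≤ n) (q : Profile) (t : ℝ) :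
    q.box n t = ((n - 2 : ℕ) : ℝ) * q.tan t + q.rad t := by
  rw [box, rad, Nat.cast_sub hn]
  push_cast
  ring

theorem IsConvex.addSmul {q p : Profile} (hq : q.IsConvex) (hp : p.IsConvex) {ε : ℝ}
    (hε : 0 ≤ ε) : (q.addSmul ε p).IsConvex where
  nonneg t ht := add_nonneg (hq.nonneg t ht) (mul_nonneg hε (hp.nonneg t ht))
  tan_nonneg t ht := by
    rw [tan_addSmul]
    exact add_nonneg (hq.tan_nonneg t ht) (mul_nonneg hε (hp.tan_nonneg t ht))
  rad_nonneg t ht := by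
    rw [rad_addSmul]
    exact add_nonneg (hq.rad_nonneg t ht) (mul_nonneg hε (hp.rad_nonneg t ht))

/-- Small perturbations of the unit ball are convex. -/
theorem exists_isConvex_const_one_addSmul (p : Profile) (hp : ∀ t, |t| ≤ 1 → 0 ≤ p.val t) :
    ∃ δ : ℝ, 0 < δ ∧ ∀ ε : ℝ, 0 ≤ ε → ε ≤ δ → ((const 1).addSmul ε p).IsConvex := by
  obtain ⟨M, hM⟩ := (isCompact_Icc (a := (-1 : ℝ)) (b := 1)).exists_bound_of_continuousOn
    p.continuous_tan.continuousOn
  obtain ⟨N, hN⟩ := (isCompact_Icc (a := (-1 : ℝ)) (b := 1)).exists_bound_of_continuousOn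
    p.continuous_rad.continuousOn
  set B := |M| + |N| + 1 with hB
  have hB0 : 0 < B := by positivity
  refine ⟨B⁻¹, inv_pos.2 hB0, fun ε h0 h1 => ?_⟩
  have hεB : ε * B ≤ 1 := by
    calc ε * B ≤ B⁻¹ * B := by gcongr
      _ = 1 := inv_mul_cancel₀ hB0.ne'
  have key : ∀ x : ℝ, |x| ≤ B → 0 ≤ 1 + ε * x := by
    intro x hx
    have : ε * (-x) ≤ ε * B := mul_le_mul_of_nonneg_left ((neg_le_abs x).trans hx) h0
    linarith
  refine ⟨fun t ht => ?_, fun t ht => ?_, fun t ht => ?_⟩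
  · exact add_nonneg zero_le_one (mul_nonneg h0 (hp t ht))
  · rw [tan_addSmul, tan_const]
    apply key
    have := hM t (abs_le.1 ht)
    rw [Real.norm_eq_abs] at this
    linarith [le_abs_self M, abs_nonneg N]
  · rw [rad_addSmul, rad_const]
    apply key
    have := hN t (abs_le.1 ht)
    rw [Real.norm_eq_abs] at this
    linarith [le_abs_self N, abs_nonneg M]

end Profile

theorem esymmRadii_mul (m j : ℕ) (c a b : ℝ) :
    esymmRadii m j (c * a) (c * b) = c ^ j * esymmRadii m j a b := by
  cases j with
  | zero => simp [esymmRadii]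
  | succ j =>
    simp only [esymmRadii]
    ring

theorem hasDerivAt_esymmRadii (m j : ℕ) (a a' b b' ε : ℝ) :
    HasDerivAt (fun s => esymmRadii m (j + 1) (a + s * a') (b + s * b'))
      ((m.choose (j + 1) : ℝ) * (((j : ℝ) + 1) * (a + ε * a') ^ j * a')
        + ((m.choose j : ℝ) * b' * (a + ε * a') ^ j
          + (m.choose j : ℝ) * (b + ε * b') * (j * (a + ε * a') ^ (j - 1) * a'))) ε := by
  have ha : HasDerivAt (fun s : ℝ => a + s * a') a' ε := by
    refine (((hasDerivAt_id ε).mul_const a').const_add a).congr_deriv ?_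
    simp
  have hb : HasDerivAt (fun s : ℝ => b + s * b') b' ε := by
    refine (((hasDerivAt_id ε).mul_const b').const_add b).congr_deriv ?_
    simp
  simp only [esymmRadii]
  refine (((ha.pow (j + 1)).const_mul _).add ((hb.const_mul _).mul (ha.pow j))).congr_deriv ?_
  simp

variable {f : Sph n → ℝ}

theorem integrable_mul_zonal (e : Sph n) (hf : Integrable f (surf n)) {g : ℝ → ℝ}
    (hg : Continuous g) : Integrable (fun v => f v * g ⟪(e : Euc n), (v : Euc n)⟫) (surf n) := by
  have hr := continuous_comp_inner hg e
  obtain ⟨M, hM⟩ := isCompact_univ.exists_bound_of_continuousOn hr.continuousOn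
  exact hf.mul_bdd (c := M) hr.aestronglyMeasurable (Eventually.of_forall fun v => hM v trivial)

/-- The first variation of the integral of `f` against an area measure, where the variation takes
place in a region in which the principal radii of curvature are all equal to `R`. -/
theorem hasDerivAt_integral_curv (hn : 2 ≤ n) (e : Sph n) (hf : Integrable f (surf n))
    (q p : Profile) (j : ℕ) {R : ℝ}
    (hR : ∀ t, |t| ≤ 1 → (q.tan t = R ∧ q.rad t = R) ∨ (p.tan t = 0 ∧ p.rad t = 0)) :
    HasDerivAt (fun ε => ∫ v, f v *
        (q.addSmul ε p).curv n (j + 1) ⟪(e : Euc n), (v : Euc n)⟫ ∂(surf n))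
      (((n - 2).choose j : ℝ) * R ^ j *
        ∫ v, f v * p.box n ⟪(e : Euc n), (v : Euc n)⟫ ∂(surf n)) 0 := by
  set m := n - 2 with hm
  set B : ℝ → ℝ → ℝ := fun ε t => (m.choose (j + 1) : ℝ) *
      (((j : ℝ) + 1) * (q.tan t + ε * p.tan t) ^ j * p.tan t)
        + ((m.choose j : ℝ) * p.rad t * (q.tan t + ε * p.tan t) ^ j
          + (m.choose j : ℝ) * (q.rad t + ε * p.rad t)
            * (j * (q.tan t + ε * p.tan t) ^ (j - 1) * p.tan t)) with hB
  have hqt := q.continuous_tan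
  have hqr := q.continuous_rad
  have hpt := p.continuous_tan
  have hpr := p.continuous_rad
  have hBc : Continuous fun x : ℝ × ℝ => B x.1 x.2 := by
    simp only [hB]
    fun_prop
  have hder : ∀ t ε, HasDerivAt (fun ε => (q.addSmul ε p).curv n (j + 1) t) (B ε t) ε := by
    intro t ε
    simp only [Profile.curv, Profile.tan_addSmul, Profile.rad_addSmul]
    exact hasDerivAt_esymmRadii m j _ _ _ _ ε
  obtain ⟨M, hM⟩ := ((isCompact_Icc (a := (-1 : ℝ)) (b := 1)).prod
    (isCompact_Icc (a := (-1 : ℝ)) (b := 1))).exists_bound_of_continuousOn hBc.continuousOn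
  -- Where all radii equal `R`, the derivative of the symmetric function of order `j+1` is `C(n-2,j)
  -- R^j` times the trace of the perturbation, that is, `box`; this uses `(j+1) C(m,j+1) = (m-j)
  -- C(m,j)`. Where the perturbation has vanishing radii, both sides are zero.
  have hB0 : ∀ t, |t| ≤ 1 → B 0 t = (m.choose j : ℝ) * R ^ j * p.box n t := by
    intro t ht
    rw [Profile.box_eq hn, ← hm]
    simp only [hB, zero_mul, add_zero]
    rcases hR t ht with ⟨h1, h2⟩ | ⟨h1, h2⟩
    · rw [h1, h2]
      have hch : (m.choose (j + 1) : ℝ) * ((j : ℝ) + 1) = m.choose j * ((m : ℝ) - j) := by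
        rcases le_or_gt j m with hle | hlt
        · rw [← Nat.cast_sub hle]
          exact_mod_cast Nat.choose_succ_right_eq m j
        · rw [Nat.choose_eq_zero_of_lt hlt, Nat.choose_eq_zero_of_lt (by omega)]
          simp
      have hpow : R * (j * R ^ (j - 1)) = j * R ^ j := by
        cases j with
        | zero => simp
        | succ j => simp only [Nat.add_sub_cancel]; ring
      linear_combination R ^ j * p.tan t * hch + (m.choose j : ℝ) * p.tan t * hpow
    · rw [h1, h2]
      ring
  have h := hasDerivAt_integral_of_dominated_loc_of_deriv_le (μ := surf n) (𝕜 := ℝ)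
    (F := fun ε v => f v * (q.addSmul ε p).curv n (j + 1) ⟪(e : Euc n), (v : Euc n)⟫)
    (F' := fun ε v => f v * B ε ⟪(e : Euc n), (v : Euc n)⟫) (x₀ := 0)
    (s := Metric.ball 0 1) (bound := fun v => |f v| * M) (Metric.ball_mem_nhds 0 one_pos)
    (Eventually.of_forall fun ε =>
      (integrable_mul_zonal e hf ((q.addSmul ε p).continuous_curv n (j + 1))).aestronglyMeasurable)
    (integrable_mul_zonal e hf ((q.addSmul 0 p).continuous_curv n (j + 1)))
    (integrable_mul_zonal e hf
      (hBc.comp (continuous_const.prodMk continuous_id))).aestronglyMeasurable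
    (Eventually.of_forall fun v ε hε => by
      rw [norm_mul]
      refine mul_le_mul_of_nonneg_left (hM (ε, _) ⟨?_, abs_le.1 (abs_inner_sph_le_one e v)⟩)
        (norm_nonneg _)
      rw [mem_ball_zero_iff, Real.norm_eq_abs] at hε
      exact abs_le.1 hε.le)
    (hf.abs.mul_const M)
    (Eventually.of_forall fun v ε _ => (hder _ ε).const_mul (f v))
  refine h.2.congr_deriv ?_
  rw [← integral_const_mul]
  refine integral_congr_ae (Eventually.of_forall fun v => ?_)
  simp only [hB0 _ (abs_inner_sph_le_one e v)]
  ring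

theorem HasDerivAt.nonneg_of_le_right {F : ℝ → ℝ} {F' δ : ℝ} (h : HasDerivAt F F' 0)
    (hδ : 0 < δ) (hle : ∀ ε, 0 < ε → ε ≤ δ → F 0 ≤ F ε) : 0 ≤ F' := by
  refine ge_of_tendsto h.tendsto_slope_zero_right ?_
  filter_upwards [Ioc_mem_nhdsGT hδ] with ε hε
  rw [zero_add, smul_eq_mul]
  exact mul_nonneg (inv_nonneg.2 hε.1.le) (sub_nonneg.2 (hle ε hε.1 hε.2))

end Variation

/-! ### Positivity of the distribution `□_n f` -/

section Positivity

variable {n : ℕ} {f : Sph n → ℝ} {Φ : ConvexBody (Euc n) → ConvexBody (Euc n)}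

theorem Profile.isCentered_of_even (e : Sph n) {q : Profile} (h : ∀ t, q.val (-t) = q.val t) :
    q.IsCentered e := by
  have h1 := integral_comp_rotSph (LinearIsometryEquiv.neg ℝ)
    fun u : Sph n => q.val ⟪(e : Euc n), (u : Euc n)⟫ * ⟪(e : Euc n), (u : Euc n)⟫
  have h2 : ∀ u : Sph n, ⟪(e : Euc n), (rotSph (LinearIsometryEquiv.neg ℝ) u : Euc n)⟫
      = -⟪(e : Euc n), (u : Euc n)⟫ := fun u => by
    change ⟪(e : Euc n), -(u : Euc n)⟫ = _
    rw [inner_neg_right]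
  simp only [h2, h, mul_neg, integral_neg] at h1
  rw [IsCentered]
  linarith

theorem Profile.IsCentered.addSmul {e : Sph n} {q p : Profile} (hq : q.IsCentered e)
    (hp : p.IsCentered e) (ε : ℝ) : (q.addSmul ε p).IsCentered e := by
  rw [IsCentered] at *
  simp only [Profile.addSmul, add_mul, mul_assoc]
  rw [integral_add, integral_const_mul, hq, hp]
  · ring
  · exact integrable_of_continuous _ ((continuous_comp_inner q.continuous_val e).mul (by fun_prop))
  · exact integrable_of_continuous _
      (((continuous_comp_inner p.continuous_val e).mul (by fun_prop)).const_mul ε)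

/-- The distribution `□_n f` is positive on nonnegative centered zonal functions. -/
theorem integral_mul_box_nonneg (hn : 3 ≤ n) (e : Sph n) {i : ℕ} (hi1 : 1 ≤ i) (hi : i < n)
    (hΦ : WeaklyMonotone Φ) (hf : IsGeneratingFunction e i Φ f) {p : Profile}
    (hp : ∀ t, |t| ≤ 1 → 0 ≤ p.val t) (hpc : p.IsCentered e) :
    0 ≤ ∫ v, f v * p.box n ⟪(e : Euc n), (v : Euc n)⟫ ∂(surf n) := by
  obtain ⟨j, rfl⟩ : ∃ j, i = j + 1 := ⟨i - 1, by omega⟩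
  obtain ⟨δ, hδ, hconv⟩ := p.exists_isConvex_const_one_addSmul hp
  have hder := hasDerivAt_integral_curv (by omega) e hf.integrable (Profile.const 1) p j (R := 1)
    fun t _ => Or.inl ⟨Profile.tan_const 1 t, Profile.rad_const 1 t⟩
  have h1c : (Profile.const 1).IsCentered e := Profile.isCentered_of_even e fun t => rfl
  -- The bodies `1 + ε p` contain the unit ball, and centering puts their Steiner points at the
  -- origin, where weak monotonicity applies.
  have h := HasDerivAt.nonneg_of_le_right hder hδ fun ε h0 h1 =>
    integral_mul_curv_mono hn e hi hΦ hf (hconv 0 le_rfl hδ.le) (hconv ε h0.le h1)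
      (h1c.addSmul hpc 0) (h1c.addSmul hpc ε) fun t ht => by
        simp only [Profile.addSmul, zero_mul, add_zero]
        linarith [mul_nonneg h0.le (hp t ht)]
  have hch : 0 < ((n - 2).choose j : ℝ) * 1 ^ j := by
    have := Nat.choose_pos (n := n - 2) (k := j) (by omega)
    rw [one_pow, mul_one]
    exact_mod_cast this
  exact nonneg_of_mul_nonneg_right h hch

end Positivity

/-! ### Gluing functions along a point -/

section Gluing

theorem continuous_ite_lt {f g : ℝ → ℝ} {c : ℝ} (hf : ∀ x, x ≤ c → ContinuousAt f x)
    (hg : ∀ x, c ≤ x → ContinuousAt g x) (h0 : f c = g c) :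
    Continuous fun x => if x < c then f x else g x := by
  refine continuous_iff_continuousAt.2 fun x => ?_
  rcases lt_trichotomy x c with h | rfl | h
  · refine (hf x h.le).congr ?_
    filter_upwards [Iio_mem_nhds h] with y hy
    rw [if_pos (Set.mem_Iio.1 hy)]
  · have h1 : ContinuousWithinAt (fun y => if y < x then f y else g y) (Set.Iic x) x := by
      refine (hf x le_rfl).continuousWithinAt.congr (fun y hy => ?_) (by simp [h0])
      split_ifs with h
      · rfl
      · rw [le_antisymm hy (not_lt.1 h), h0]
    have h2 : ContinuousWithinAt (fun y => if y < x then f y else g y) (Set.Ici x) x :=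
      (hg x le_rfl).continuousWithinAt.congr (fun y hy => if_neg (not_lt.2 hy)) (by simp)
    have h := h1.union h2
    rwa [Set.Iic_union_Ici, continuousWithinAt_univ] at h
  · refine (hg x h.le).congr ?_
    filter_upwards [Ioi_mem_nhds h] with y hy
    rw [if_neg (not_lt.2 (le_of_lt hy))]

theorem hasDerivAt_ite_lt {f g f' g' : ℝ → ℝ} {c : ℝ}
    (hf : ∀ x, x ≤ c → HasDerivAt f (f' x) x) (hg : ∀ x, c ≤ x → HasDerivAt g (g' x) x)
    (h0 : f c = g c) (h1 : f' c = g' c) (x : ℝ) :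
    HasDerivAt (fun x => if x < c then f x else g x) (if x < c then f' x else g' x) x := by
  rcases lt_trichotomy x c with h | rfl | h
  · rw [if_pos h]
    refine (hf x h.le).congr_of_eventuallyEq ?_
    filter_upwards [Iio_mem_nhds h] with y hy
    rw [if_pos (Set.mem_Iio.1 hy)]
  · rw [if_neg (lt_irrefl x)]
    have h1 : HasDerivWithinAt (fun y => if y < x then f y else g y) (g' x) (Set.Iic x) x := by
      rw [← h1]
      refine (hf x le_rfl).hasDerivWithinAt.congr (fun y hy => ?_) (by simp [h0])
      split_ifs with h
      · rfl
      · rw [le_antisymm hy (not_lt.1 h), h0]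
    have h2 : HasDerivWithinAt (fun y => if y < x then f y else g y) (g' x) (Set.Ici x) x :=
      (hg x le_rfl).hasDerivWithinAt.congr (fun y hy => if_neg (not_lt.2 hy)) (by simp)
    have h := h1.union h2
    rwa [Set.Iic_union_Ici, hasDerivWithinAt_univ] at h
  · rw [if_neg (not_lt.2 h.le)]
    refine (hg x h.le).congr_of_eventuallyEq ?_
    filter_upwards [Ioi_mem_nhds h] with y hy
    rw [if_neg (not_lt.2 (le_of_lt hy))]

end Gluing

/-! ### The lens-shaped test body -/

section Lens

/-- The support function of the lens as a function of `1 - t ^ 2`. -/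
noncomputable def lensFun (σ w : ℝ) : ℝ :=
  if w < σ ^ 2 then 1 / σ - √(1 - σ ^ 2) ^ 3 / σ * √(1 - w)
  else (3 / 2 - σ ^ 2) * √w + σ ^ 2 / 2 * (√w)⁻¹

/-- The first derivative of `lensFun`. -/
noncomputable def lensDeriv (σ w : ℝ) : ℝ :=
  if w < σ ^ 2 then √(1 - σ ^ 2) ^ 3 / σ * (2 * √(1 - w))⁻¹
  else (3 / 2 - σ ^ 2) / 2 * (√w)⁻¹ - σ ^ 2 / 4 * (√w ^ 3)⁻¹

/-- The second derivative of `lensFun`. -/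
noncomputable def lensDerivTwo (σ w : ℝ) : ℝ :=
  if w < σ ^ 2 then √(1 - σ ^ 2) ^ 3 / σ * (4 * √(1 - w) ^ 3)⁻¹
  else -(3 / 2 - σ ^ 2) / 4 * (√w ^ 3)⁻¹ + 3 * σ ^ 2 / 8 * (√w ^ 5)⁻¹

variable {σ : ℝ}

theorem hasDerivAt_sqrt_one_sub {w : ℝ} (hw : w < 1) :
    HasDerivAt (fun x => √(1 - x)) (-(2 * √(1 - w))⁻¹) w := by
  refine (((hasDerivAt_id w).const_sub 1).sqrt (by simp only [id]; linarith)).congr_deriv ?_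
  simp [neg_div]

theorem hasDerivAt_sqrt_pos {w : ℝ} (hw : 0 < w) : HasDerivAt (fun x => √x) ((2 * √w)⁻¹) w := by
  refine ((hasDerivAt_id w).sqrt hw.ne').congr_deriv ?_
  simp

/-- Near the poles the body is bounded by pieces of spheres of radius `1/σ`, with support function
`1/σ - c|t|`. The constants `c = (1-σ²)^(3/2)/σ`, `3/2 - σ²` and `σ²/2` make value, first and second
derivative agree at `1 - t² = σ²`. Using the variable `w = 1 - t²` avoids the kink of `|t|`, as `t =
0` falls in the other branch. -/
theorem hasDerivAt_lensFun (h0 : 0 < σ) (h1 : σ < 1) (w : ℝ) :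
    HasDerivAt (lensFun σ) (lensDeriv σ w) w := by
  have hσ : σ ^ 2 < 1 := by nlinarith
  have ht : 0 < √(1 - σ ^ 2) := Real.sqrt_pos.2 (by linarith)
  have ht2 : √(1 - σ ^ 2) ^ 2 = 1 - σ ^ 2 := Real.sq_sqrt (by linarith)
  change HasDerivAt (fun w => lensFun σ w) _ _
  simp only [lensFun, lensDeriv]
  refine hasDerivAt_ite_lt (f' := fun w => √(1 - σ ^ 2) ^ 3 / σ * (2 * √(1 - w))⁻¹)
    (g' := fun w => (3 / 2 - σ ^ 2) / 2 * (√w)⁻¹ - σ ^ 2 / 4 * (√w ^ 3)⁻¹)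
    (fun x hx => ?_) (fun x hx => ?_) ?_ ?_ w
  · refine (((hasDerivAt_sqrt_one_sub (hx.trans_lt hσ)).const_mul
      (√(1 - σ ^ 2) ^ 3 / σ)).const_sub (1 / σ)).congr_deriv ?_
    ring
  · have hx0 : 0 < x := lt_of_lt_of_le (by positivity) hx
    have hs : 0 < √x := Real.sqrt_pos.2 hx0
    refine (((hasDerivAt_sqrt_pos hx0).const_mul (3 / 2 - σ ^ 2)).add
      (((hasDerivAt_sqrt_pos hx0).inv hs.ne').const_mul (σ ^ 2 / 2))).congr_deriv ?_
    field_simp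
    ring
  · rw [Real.sqrt_sq h0.le]
    field_simp
    linear_combination (-2 * √(1 - σ ^ 2) ^ 2 - 2 * (1 - σ ^ 2)) * ht2
  · rw [Real.sqrt_sq h0.le]
    field_simp
    linear_combination ht2 * 8

theorem hasDerivAt_lensDeriv (h0 : 0 < σ) (h1 : σ < 1) (w : ℝ) :
    HasDerivAt (lensDeriv σ) (lensDerivTwo σ w) w := by
  have hσ : σ ^ 2 < 1 := by nlinarith
  have ht : 0 < √(1 - σ ^ 2) := Real.sqrt_pos.2 (by linarith)
  have ht2 : √(1 - σ ^ 2) ^ 2 = 1 - σ ^ 2 := Real.sq_sqrt (by linarith)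
  change HasDerivAt (fun w => lensDeriv σ w) _ _
  simp only [lensDeriv, lensDerivTwo]
  refine hasDerivAt_ite_lt (f' := fun w => √(1 - σ ^ 2) ^ 3 / σ * (4 * √(1 - w) ^ 3)⁻¹)
    (g' := fun w => -(3 / 2 - σ ^ 2) / 4 * (√w ^ 3)⁻¹ + 3 * σ ^ 2 / 8 * (√w ^ 5)⁻¹)
    (fun x hx => ?_) (fun x hx => ?_) ?_ ?_ w
  · have hs : 0 < √(1 - x) := Real.sqrt_pos.2 (by linarith)
    refine ((((hasDerivAt_sqrt_one_sub (hx.trans_lt hσ)).const_mul 2).inv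
      (by positivity)).const_mul (√(1 - σ ^ 2) ^ 3 / σ)).congr_deriv ?_
    field_simp
    ring
  · have hx0 : 0 < x := lt_of_lt_of_le (by positivity) hx
    have hs : 0 < √x := Real.sqrt_pos.2 hx0
    refine ((((hasDerivAt_sqrt_pos hx0).inv hs.ne').const_mul ((3 / 2 - σ ^ 2) / 2)).sub
      ((((hasDerivAt_sqrt_pos hx0).pow 3).inv (pow_pos hs 3).ne').const_mul
        (σ ^ 2 / 4))).congr_deriv ?_
    simp only [Pi.pow_apply]
    field_simp
    ring
  · rw [Real.sqrt_sq h0.le]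
    field_simp
    linear_combination ht2 * 8
  · rw [Real.sqrt_sq h0.le]
    field_simp
    ring

theorem continuous_lensDerivTwo (h0 : 0 < σ) (h1 : σ < 1) : Continuous (lensDerivTwo σ) := by
  have hσ : σ ^ 2 < 1 := by nlinarith
  have ht : 0 < √(1 - σ ^ 2) := Real.sqrt_pos.2 (by linarith)
  change Continuous fun w => lensDerivTwo σ w
  simp only [lensDerivTwo]
  refine continuous_ite_lt (fun x hx => ?_) (fun x hx => ?_) ?_
  · have hs : 0 < √(1 - x) := Real.sqrt_pos.2 (by linarith)
    have hs' : 4 * √(1 - x) ^ 3 ≠ 0 := by positivity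
    have hc : ContinuousAt (fun x => 4 * √(1 - x) ^ 3) x := by fun_prop
    exact continuousAt_const.mul (hc.inv₀ hs')
  · have hs : 0 < √x := Real.sqrt_pos.2 (lt_of_lt_of_le (by positivity) hx)
    have h3 : ContinuousAt (fun x => √x ^ 3) x := by fun_prop
    have h5 : ContinuousAt (fun x => √x ^ 5) x := by fun_prop
    exact (continuousAt_const.mul (h3.inv₀ (pow_pos hs 3).ne')).add
      (continuousAt_const.mul (h5.inv₀ (pow_pos hs 5).ne'))
  · rw [Real.sqrt_sq h0.le]
    field_simp
    ring

theorem hasDerivAt_one_sub_sq (t : ℝ) : HasDerivAt (fun t : ℝ => 1 - t ^ 2) (-(2 * t)) t := by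
  refine (((hasDerivAt_id t).pow 2).const_sub 1).congr_deriv ?_
  simp

/-- The lens: a convex body of revolution whose principal radii of curvature around the poles are
equal to `1 / σ`, while its support function is at most `2`. -/
noncomputable def Profile.lens (σ : ℝ) (h0 : 0 < σ) (h1 : σ < 1) : Profile where
  val t := lensFun σ (1 - t ^ 2)
  d1 t := lensDeriv σ (1 - t ^ 2) * (-(2 * t))
  d2 t := lensDerivTwo σ (1 - t ^ 2) * (-(2 * t)) * (-(2 * t)) + lensDeriv σ (1 - t ^ 2) * (-2)
  hasDerivAt_val t := (hasDerivAt_lensFun h0 h1 (1 - t ^ 2)).comp (h₂ := lensFun σ) t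
    (hasDerivAt_one_sub_sq t)
  hasDerivAt_d1 t := by
    refine (((hasDerivAt_lensDeriv h0 h1 (1 - t ^ 2)).comp t (hasDerivAt_one_sub_sq t)).mul
      ((hasDerivAt_id t).const_mul 2).neg).congr_deriv ?_
    simp
  continuous_d2 := by
    have h := continuous_lensDerivTwo h0 h1
    have h' : Continuous (lensDeriv σ) :=
      continuous_iff_continuousAt.2 fun w => (hasDerivAt_lensDeriv h0 h1 w).continuousAt
    fun_prop

namespace Profile

theorem lens_even (h0 : 0 < σ) (h1 : σ < 1) (t : ℝ) :
    (lens σ h0 h1).val (-t) = (lens σ h0 h1).val t := by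
  simp only [lens, neg_sq]

theorem tan_lens_of_lt (h0 : 0 < σ) (h1 : σ < 1) {t : ℝ} (ht : 1 - t ^ 2 < σ ^ 2) :
    (lens σ h0 h1).tan t = 1 / σ := by
  have ht0 : 0 < |t| := abs_pos.2 fun h => by subst h; nlinarith
  simp only [tan, lens, lensFun, lensDeriv, if_pos ht, sub_sub_cancel, Real.sqrt_sq_eq_abs]
  field_simp
  rw [← sq_abs t]
  ring

theorem rad_lens_of_lt (h0 : 0 < σ) (h1 : σ < 1) {t : ℝ} (ht : 1 - t ^ 2 < σ ^ 2) :
    (lens σ h0 h1).rad t = 1 / σ := by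
  have ht0 : 0 < |t| := abs_pos.2 fun h => by subst h; nlinarith
  have hd : (lens σ h0 h1).d2 t = 0 := by
    simp only [lens, lensDeriv, lensDerivTwo, if_pos ht, sub_sub_cancel, Real.sqrt_sq_eq_abs]
    field_simp
    rw [← sq_abs t]
    ring
  rw [rad, tan_lens_of_lt h0 h1 ht, hd]
  ring

theorem tan_lens_of_le (h0 : 0 < σ) (h1 : σ < 1) {t : ℝ} (ht : σ ^ 2 ≤ 1 - t ^ 2) :
    (lens σ h0 h1).tan t
      = (3 * √(1 - t ^ 2) ^ 2 - σ ^ 2) / (2 * √(1 - t ^ 2) ^ 3) := by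
  have hw : 0 < 1 - t ^ 2 := lt_of_lt_of_le (by positivity) ht
  have hs : 0 < √(1 - t ^ 2) := Real.sqrt_pos.2 hw
  have hs2 : t ^ 2 = 1 - √(1 - t ^ 2) ^ 2 := by rw [Real.sq_sqrt hw.le]; ring
  simp only [tan, lens, lensFun, lensDeriv, if_neg (not_lt.2 ht)]
  set s := √(1 - t ^ 2)
  field_simp
  linear_combination (4 * s ^ 2 * (3 - 2 * σ ^ 2) - 4 * σ ^ 2) * hs2

/-- Away from the poles both radii stay nonnegative, and at `√(1-t²) = σ` both equal `1/σ`, the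
common value on the spherical caps. -/
theorem rad_lens_of_le (h0 : 0 < σ) (h1 : σ < 1) {t : ℝ} (ht : σ ^ 2 ≤ 1 - t ^ 2) :
    (lens σ h0 h1).rad t = σ ^ 2 / √(1 - t ^ 2) ^ 3 := by
  have hw : 0 < 1 - t ^ 2 := lt_of_lt_of_le (by positivity) ht
  have hs : 0 < √(1 - t ^ 2) := Real.sqrt_pos.2 hw
  have hs2 : 1 - t ^ 2 = √(1 - t ^ 2) ^ 2 := by rw [Real.sq_sqrt hw.le]
  have ht2 : t ^ 2 = 1 - √(1 - t ^ 2) ^ 2 := by rw [Real.sq_sqrt hw.le]; ring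
  rw [rad, tan_lens_of_le h0 h1 ht]
  simp only [lens, lensDeriv, lensDerivTwo, if_neg (not_lt.2 ht)]
  set s := √(1 - t ^ 2)
  rw [hs2, mul_assoc, show -(2 * t) * -(2 * t) = 4 * t ^ 2 by ring, ht2]
  field_simp
  ring

/-- The bound is uniform in `σ` although the radii at the poles blow up: with `τ = √(1-σ²) ≤ |t|`
the polar value is at most `(1-τ⁴)/σ = 2σ - σ³`, and the equatorial branch is a sum of at most `3/2`
and `1/2`. -/
theorem lens_mem_Icc (h0 : 0 < σ) (h1 : σ < 1) {t : ℝ} (ht : |t| ≤ 1) :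
    0 ≤ (lens σ h0 h1).val t ∧ (lens σ h0 h1).val t ≤ 2 := by
  have hσ : σ ^ 2 < 1 := by nlinarith
  have hτ : 0 < √(1 - σ ^ 2) := Real.sqrt_pos.2 (by linarith)
  have hτ2 : √(1 - σ ^ 2) ^ 2 = 1 - σ ^ 2 := Real.sq_sqrt (by linarith)
  have htsq : t ^ 2 ≤ 1 := by rw [← sq_abs]; exact pow_le_one₀ (abs_nonneg t) ht
  simp only [lens, lensFun]
  split_ifs with h
  · rw [sub_sub_cancel, Real.sqrt_sq_eq_abs, div_mul_eq_mul_div, ← sub_div]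
    set τ := √(1 - σ ^ 2)
    have hτ1 : τ ≤ 1 := by nlinarith
    have hτt : τ ≤ |t| := by
      refine abs_le_of_sq_le_sq' ?_ (abs_nonneg t) |>.2
      rw [sq_abs]
      linarith
    have h3 : τ ^ 3 * |t| ≤ 1 := mul_le_one₀ (pow_le_one₀ hτ.le hτ1) (abs_nonneg t) ht
    have h4 : τ ^ 4 ≤ τ ^ 3 * |t| := by
      rw [pow_succ τ 3]
      exact mul_le_mul_of_nonneg_left hτt (by positivity)
    refine ⟨div_nonneg (by linarith) h0.le, ?_⟩
    rw [div_le_iff₀ h0]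
    have h5 : τ ^ 4 = (1 - σ ^ 2) ^ 2 := by rw [← hτ2]; ring
    nlinarith
  · push Not at h
    have hw : 0 < 1 - t ^ 2 := lt_of_lt_of_le (by positivity) h
    have hσs : σ ≤ √(1 - t ^ 2) := Real.le_sqrt_of_sq_le h
    have hs1 : √(1 - t ^ 2) ≤ 1 := Real.sqrt_le_one.2 (by nlinarith)
    set s := √(1 - t ^ 2)
    have hs : 0 < s := h0.trans_le hσs
    have h5 : σ ^ 2 / 2 * s⁻¹ ≤ 1 / 2 := by
      rw [← div_eq_mul_inv, div_le_iff₀ hs]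
      nlinarith
    constructor
    · have : 0 < 3 / 2 - σ ^ 2 := by linarith
      positivity
    · nlinarith

theorem isConvex_lens (h0 : 0 < σ) (h1 : σ < 1) : (lens σ h0 h1).IsConvex where
  nonneg t ht := (lens_mem_Icc h0 h1 ht).1
  tan_nonneg t ht := by
    rcases lt_or_ge (1 - t ^ 2) (σ ^ 2) with h | h
    · rw [tan_lens_of_lt h0 h1 h]
      positivity
    · have hw : 0 < 1 - t ^ 2 := lt_of_lt_of_le (by positivity) h
      rw [tan_lens_of_le h0 h1 h, Real.sq_sqrt hw.le]
      exact div_nonneg (by linarith) (by positivity)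
  rad_nonneg t ht := by
    rcases lt_or_ge (1 - t ^ 2) (σ ^ 2) with h | h
    · rw [rad_lens_of_lt h0 h1 h]
      positivity
    · rw [rad_lens_of_le h0 h1 h]
      positivity

end Profile

end Lens

/-! ### Smooth cutoffs of polar caps -/

section Cutoff

/-- A smooth cutoff function for the polar caps of radius `r`. -/
noncomputable def capCutoff (r t : ℝ) : ℝ := Real.smoothTransition (2 - (1 - t ^ 2) / r ^ 2)

theorem contDiff_capCutoff (r : ℝ) : ContDiff ℝ ∞ (capCutoff r) :=
  Real.smoothTransition.contDiff.comp (by fun_prop)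

/-- The profile of the smooth cutoff function for the polar caps of radius `r`. -/
noncomputable def Profile.cap (r : ℝ) : Profile := Profile.ofContDiff _ (contDiff_capCutoff r)

theorem Profile.cap_nonneg (r t : ℝ) : 0 ≤ (Profile.cap r).val t := Real.smoothTransition.nonneg _

theorem Profile.cap_le_one (r t : ℝ) : (Profile.cap r).val t ≤ 1 := Real.smoothTransition.le_one _

theorem Profile.cap_even (r t : ℝ) : (Profile.cap r).val (-t) = (Profile.cap r).val t := by
  simp only [cap, ofContDiff, capCutoff, neg_sq]

theorem Profile.cap_eq_one {r t : ℝ} (hr : 0 < r) (ht : 1 - t ^ 2 ≤ r ^ 2) :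
    (Profile.cap r).val t = 1 := by
  apply Real.smoothTransition.one_of_one_le
  have : (1 - t ^ 2) / r ^ 2 ≤ 1 := (div_le_one (by positivity)).2 ht
  linarith

theorem Profile.tan_cap_eq_zero {r t : ℝ} (hr : 0 < r) (ht : 2 * r ^ 2 < 1 - t ^ 2) :
    (Profile.cap r).tan t = 0 ∧ (Profile.cap r).rad t = 0 := by
  have h0 : capCutoff r =ᶠ[nhds t] fun _ => 0 := by
    have hc : ContinuousAt (fun t : ℝ => 1 - t ^ 2) t := by fun_prop
    filter_upwards [hc.eventually (lt_mem_nhds ht)] with s hs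
    apply Real.smoothTransition.zero_of_nonpos
    have : 2 ≤ (1 - s ^ 2) / r ^ 2 := (le_div_iff₀ (by positivity)).2 hs.le
    linarith
  have h1 : deriv (capCutoff r) =ᶠ[nhds t] fun _ => 0 := by
    refine h0.deriv.trans ?_
    simp
  have h2 : deriv (deriv (capCutoff r)) t = 0 := by
    rw [h1.deriv_eq]
    simp
  have h3 : (Profile.cap r).tan t = 0 := by
    simp only [tan, cap, ofContDiff]
    rw [h0.eq_of_nhds, h1.eq_of_nhds]
    simp
  refine ⟨h3, ?_⟩
  rw [rad, h3]
  simp only [cap, ofContDiff]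
  rw [h2]
  simp

end Cutoff

/-! ### Mass of `□_n f` on small polar caps -/

section CapBound

variable {n : ℕ} {f : Sph n → ℝ} {Φ : ConvexBody (Euc n) → ConvexBody (Euc n)}

theorem Profile.curv_addSmul_self (q : Profile) (n i : ℕ) (ε t : ℝ) :
    (q.addSmul ε q).curv n i t = (1 + ε) ^ i * q.curv n i t := by
  rw [curv, curv, tan_addSmul, rad_addSmul, ← esymmRadii_mul]
  congr 1 <;> ring

theorem Profile.curv_const_mul (n i : ℕ) (c t : ℝ) :
    (const c).curv n i t = c ^ i * (const 1).curv n i t := by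
  simp only [curv, tan_const, rad_const]
  rw [← esymmRadii_mul, mul_one]

theorem integral_mul_box_addSmul (e : Sph n) (hf : Integrable f (surf n)) (q p : Profile)
    (ε : ℝ) :
    ∫ v, f v * (q.addSmul ε p).box n ⟪(e : Euc n), (v : Euc n)⟫ ∂(surf n)
      = ∫ v, f v * q.box n ⟪(e : Euc n), (v : Euc n)⟫ ∂(surf n)
        + ε * ∫ v, f v * p.box n ⟪(e : Euc n), (v : Euc n)⟫ ∂(surf n) := by
  rw [← integral_const_mul, ← integral_add (integrable_mul_zonal e hf (q.continuous_box n))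
    ((integrable_mul_zonal e hf (p.continuous_box n)).const_mul ε)]
  refine integral_congr_ae (Eventually.of_forall fun v => ?_)
  simp only [Profile.box, Profile.tan_addSmul]
  simp only [Profile.addSmul]
  ring

/-- The total `f`-mass of the first variation of the area measure is bounded by the energy. -/
theorem choose_mul_integral_mul_box_le (hn : 3 ≤ n) (e : Sph n) {j : ℕ} (hj : j + 1 < n)
    (hΦ : WeaklyMonotone Φ) (hf : IsGeneratingFunction e (j + 1) Φ f) {q p : Profile} {R : ℝ}
    (hq : q.IsConvex) (hqc : q.IsCentered e) (hpc : p.IsCentered e)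
    (hpq : ∀ t, |t| ≤ 1 → p.val t ≤ q.val t)
    (hR : ∀ t, |t| ≤ 1 → (q.tan t = R ∧ q.rad t = R) ∨ (p.tan t = 0 ∧ p.rad t = 0))
    {δ : ℝ} (hδ : 0 < δ) (hconv : ∀ ε, 0 ≤ ε → ε ≤ δ → (q.addSmul ε p).IsConvex) :
    ((n - 2).choose j : ℝ) * R ^ j * ∫ v, f v * p.box n ⟪(e : Euc n), (v : Euc n)⟫ ∂(surf n)
      ≤ ((j : ℝ) + 1) *
        ∫ v, f v * q.curv n (j + 1) ⟪(e : Euc n), (v : Euc n)⟫ ∂(surf n) := by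
  have hder := hasDerivAt_integral_curv (by omega) e hf.integrable q p j hR
  set E := ∫ v, f v * q.curv n (j + 1) ⟪(e : Euc n), (v : Euc n)⟫ ∂(surf n) with hE
  have hpow : HasDerivAt (fun ε : ℝ => (1 + ε) ^ (j + 1) * E) (((j : ℝ) + 1) * E) 0 := by
    refine ((((hasDerivAt_id (0 : ℝ)).const_add 1).pow (j + 1)).mul_const E).congr_deriv ?_
    simp
  -- Since `p ≤ q`, the body `q + ε p` lies in `(1+ε) q`, whose area integral is `(1+ε)^(j+1) E`.
  -- Equality holds at `ε = 0`, so the derivatives there compare.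
  have h := HasDerivAt.nonneg_of_le_right (hpow.sub hder) hδ fun ε h0 h1 => by
    have hself : ∫ v, f v * (q.addSmul ε q).curv n (j + 1) ⟪(e : Euc n), (v : Euc n)⟫ ∂(surf n)
        = (1 + ε) ^ (j + 1) * E := by
      rw [hE, ← integral_const_mul]
      refine integral_congr_ae (Eventually.of_forall fun v => ?_)
      simp only [Profile.curv_addSmul_self]
      ring
    have hmono := integral_mul_curv_mono hn e hj hΦ hf (hconv ε h0.le h1) (hq.addSmul hq h0.le)
      (hqc.addSmul hpc ε) (hqc.addSmul hqc ε) fun t ht => by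
        simp only [Profile.addSmul]
        have := mul_le_mul_of_nonneg_left (hpq t ht) h0.le
        linarith
    rw [hself] at hmono
    have hz : ∫ v, f v * (q.addSmul 0 p).curv n (j + 1) ⟪(e : Euc n), (v : Euc n)⟫ ∂(surf n)
        = E := by
      simp only [hE, Profile.curv, Profile.tan_addSmul, Profile.rad_addSmul, zero_mul, add_zero]
    simp only [Pi.sub_apply]
    rw [hz]
    simp only [add_zero, one_pow, one_mul, sub_self]
    linarith
  linarith

/-- The distribution `□_n f` has mass `O(r)` on the polar caps of radius `r`. -/
theorem exists_integral_mul_box_cap_le (hn : 3 ≤ n) (e : Sph n) {i : ℕ} (hi1 : 1 < i)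
    (hi : i < n) (hΦ : WeaklyMonotone Φ) (hf : IsGeneratingFunction e i Φ f) :
    ∃ C : ℝ, 0 ≤ C ∧ ∀ r : ℝ, 0 < r → r ≤ 1 →
      ∫ v, f v * (Profile.cap r).box n ⟪(e : Euc n), (v : Euc n)⟫ ∂(surf n) ≤ C * r := by
  obtain ⟨j, rfl⟩ : ∃ j, i = j + 1 := ⟨i - 1, by omega⟩
  set E := ∫ v, f v * (Profile.const 1).curv n (j + 1) ⟪(e : Euc n), (v : Euc n)⟫ ∂(surf n)
    with hE
  set B := ∫ v, f v * (Profile.const 1).box n ⟪(e : Euc n), (v : Euc n)⟫ ∂(surf n) with hB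
  have hchoose : (1 : ℝ) ≤ (n - 2).choose j := by
    exact_mod_cast Nat.choose_pos (n := n - 2) (k := j) (by omega)
  have h1c : (Profile.const 1).IsCentered e := Profile.isCentered_of_even e fun t => rfl
  have hcapc : ∀ r, (Profile.cap r).IsCentered e := fun r =>
    Profile.isCentered_of_even e (Profile.cap_even r)
  have hcap0 : ∀ r, 0 ≤ ∫ v, f v * (Profile.cap r).box n ⟪(e : Euc n), (v : Euc n)⟫ ∂(surf n) :=
    fun r => integral_mul_box_nonneg hn e (by omega) hi hΦ hf
      (fun t _ => Profile.cap_nonneg r t) (hcapc r)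
  refine ⟨2 * |((j : ℝ) + 1) * (3 ^ (j + 1) * E)| + 2 * |B|, by positivity, fun r hr hr1 => ?_⟩
  set X := ∫ v, f v * (Profile.cap r).box n ⟪(e : Euc n), (v : Euc n)⟫ ∂(surf n) with hX
  have hA0 := abs_nonneg (((j : ℝ) + 1) * (3 ^ (j + 1) * E))
  have hBa := abs_nonneg B
  rcases lt_or_ge (2 * r) 1 with hr2 | hr2
  · have h0 : 0 < 2 * r := by linarith
    -- The lens parameter `2r` makes the umbilic region `1 - t² < 4r²` contain the support `1 - t² ≤
    -- 2r²` of the cutoff. The added unit ball ensures `q ≥ 1 ≥ cap` and absorbs small perturbations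
    -- while keeping convexity.
    set q := (Profile.lens (2 * r) h0 hr2).addSmul 1 (Profile.const 1) with hq
    have hlens := Profile.isConvex_lens h0 hr2
    have hqconv : q.IsConvex := hlens.addSmul (Profile.isConvex_const zero_le_one) zero_le_one
    have hqc : q.IsCentered e :=
      (Profile.isCentered_of_even e (Profile.lens_even h0 hr2)).addSmul h1c 1
    have hqval : ∀ t, |t| ≤ 1 → 1 ≤ q.val t ∧ q.val t ≤ 3 := by
      intro t ht
      have := Profile.lens_mem_Icc h0 hr2 ht
      simp only [hq, Profile.addSmul, Profile.const]
      constructor <;> linarith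
    obtain ⟨δ, hδ, hconv⟩ := (Profile.cap r).exists_isConvex_const_one_addSmul
      fun t _ => Profile.cap_nonneg r t
    have hmain := choose_mul_integral_mul_box_le hn e hi hΦ hf (R := 1 / (2 * r) + 1) hqconv hqc
      (hcapc r) (fun t ht => (Profile.cap_le_one r t).trans (hqval t ht).1)
      (fun t ht => by
        rcases lt_or_ge (2 * r ^ 2) (1 - t ^ 2) with h | h
        · exact Or.inr (Profile.tan_cap_eq_zero hr h)
        · left
          have h' : 1 - t ^ 2 < (2 * r) ^ 2 := by nlinarith [pow_pos hr 2]
          rw [hq, Profile.tan_addSmul, Profile.rad_addSmul, Profile.tan_lens_of_lt h0 hr2 h',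
            Profile.rad_lens_of_lt h0 hr2 h', Profile.tan_const, Profile.rad_const, mul_one]
          exact ⟨rfl, rfl⟩)
      hδ (fun ε hε0 hε1 => by
        have heq : q.addSmul ε (Profile.cap r) = (Profile.lens (2 * r) h0 hr2).addSmul 1
            ((Profile.const 1).addSmul ε (Profile.cap r)) := by
          simp only [hq, Profile.addSmul, one_mul, add_assoc]
        rw [heq]
        exact hlens.addSmul (hconv ε hε0 hε1) zero_le_one)
    -- The energy of `q` is bounded independently of `r`, because the body lies in the ball of
    -- radius `3`.
    have hmono := integral_mul_curv_mono hn e hi hΦ hf hqconv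
      (Profile.isConvex_const (c := 3) (by norm_num)) hqc
      (Profile.isCentered_of_even e fun t => rfl) fun t ht => (hqval t ht).2
    have h3 : ∫ v, f v * (Profile.const 3).curv n (j + 1) ⟪(e : Euc n), (v : Euc n)⟫ ∂(surf n)
        = 3 ^ (j + 1) * E := by
      rw [hE, ← integral_const_mul]
      refine integral_congr_ae (Eventually.of_forall fun v => ?_)
      simp only
      rw [Profile.curv_const_mul]
      ring
    rw [h3] at hmono
    have hX0 : 0 ≤ X := hcap0 r
    -- Here `i > 1` enters: `j ≥ 1` gives `R^j ≥ R`, so the radius produces a full factor `1/r`.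
    have hR1 : 1 / (2 * r) ≤ ((n - 2).choose j : ℝ) * (1 / (2 * r) + 1) ^ j := by
      have hR0 : 0 < 1 / (2 * r) := by positivity
      have h4 : 1 / (2 * r) + 1 ≤ (1 / (2 * r) + 1) ^ j :=
        le_self_pow₀ (by linarith) (by omega)
      nlinarith
    have h5 : 1 / (2 * r) * X ≤ |((j : ℝ) + 1) * (3 ^ (j + 1) * E)| := by
      refine (mul_le_mul_of_nonneg_right hR1 hX0).trans (hmain.trans ?_)
      refine le_trans ?_ (le_abs_self _)
      exact mul_le_mul_of_nonneg_left hmono (by positivity)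
    rw [div_mul_eq_mul_div, one_mul, div_le_iff₀ h0] at h5
    nlinarith [mul_nonneg hBa hr.le]
  -- For `r ≥ 1/2` no smallness is needed: `cap ≤ 1` and positivity bound the mass by that of the
  -- constant function.
  · have hdiff : 0 ≤ ∫ v, f v * ((Profile.const 1).addSmul (-1) (Profile.cap r)).box n
        ⟪(e : Euc n), (v : Euc n)⟫ ∂(surf n) :=
      integral_mul_box_nonneg hn e (by omega) hi hΦ hf
        (fun t _ => by
          simp only [Profile.addSmul, Profile.const]
          linarith [Profile.cap_le_one r t])
        (h1c.addSmul (hcapc r) (-1))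
    have hsub : ∫ v, f v * ((Profile.const 1).addSmul (-1) (Profile.cap r)).box n
        ⟪(e : Euc n), (v : Euc n)⟫ ∂(surf n) = B - X := by
      rw [integral_mul_box_addSmul e hf.integrable]
      ring
    have hle : X ≤ |B| := (by linarith : X ≤ B).trans (le_abs_self B)
    nlinarith [mul_nonneg hA0 hr.le]

end CapBound

/-! ### The spherical Laplacian and box operator on zonal functions -/

section ZonalLaplacian

variable {n : ℕ}

theorem hasFDerivAt_perp {e x : Euc n} (hx : x ≠ 0) :
    HasFDerivAt (perp e) (-(lat e x • rankTwo ‖x‖⁻¹ (-‖x‖⁻¹) 0 (dir x) 0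
      + (‖x‖⁻¹ • innerSL ℝ (perp e x)).smulRight (dir x))) x :=
  ((hasFDerivAt_lat hx).smul (hasFDerivAt_dir hx)).const_sub e

/-- The second derivative of the `0`-homogeneous extension of a zonal function. -/
theorem fderiv_fderiv_comp_lat (e u : Sph n) {g : ℝ → ℝ} (hg : ContDiff ℝ ∞ g) (v : Euc n) :
    fderiv ℝ (fderiv ℝ fun x => g (lat (e : Euc n) x)) (u : Euc n) v v
      = deriv (deriv g) ⟪(e : Euc n), (u : Euc n)⟫ * ⟪perp (e : Euc n) u, v⟫ ^ 2
        - 2 * deriv g ⟪(e : Euc n), (u : Euc n)⟫ * (⟪perp (e : Euc n) u, v⟫ * ⟪(u : Euc n), v⟫)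
        - ⟪(e : Euc n), (u : Euc n)⟫ * deriv g ⟪(e : Euc n), (u : Euc n)⟫
          * (‖v‖ ^ 2 - ⟪(u : Euc n), v⟫ ^ 2) := by
  have hu := sph_ne_zero u
  set V : Euc n → Euc n := fun x => (deriv g (lat (e : Euc n) x) * ‖x‖⁻¹) • perp (e : Euc n) x
    with hV
  have hg1 : ∀ t, HasDerivAt g (deriv g t) t := fun t =>
    (hg.differentiable (by simp) t).hasDerivAt
  have hg2 : ∀ t, HasDerivAt (deriv g) (deriv (deriv g) t) t := fun t =>
    ((contDiff_infty_iff_deriv.1 hg).2.differentiable (by simp) t).hasDerivAt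
  have h1 : (fderiv ℝ fun x => g (lat (e : Euc n) x)) =ᶠ[nhds (u : Euc n)]
      fun x => innerSL ℝ (V x) := by
    filter_upwards [isOpen_ne.mem_nhds hu] with x hx
    refine (((hg1 _).comp_hasFDerivAt x (hasFDerivAt_lat hx)).congr_fderiv ?_).fderiv
    ext w
    simp [hV]
    ring
  have h2 := ((((hg2 _).comp_hasFDerivAt (u : Euc n) (hasFDerivAt_lat (e := (e : Euc n)) hu)).mul
    (hasFDerivAt_inv_norm_euc hu)).smul (hasFDerivAt_perp (e := (e : Euc n)) hu))
  have h3 := ((innerSL ℝ).hasFDerivAt (x := V u)).comp (u : Euc n) h2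
  rw [h1.fderiv_eq]
  have h4 : fderiv ℝ (fun x => innerSL ℝ (V x)) (u : Euc n) = _ := h3.fderiv
  rw [h4, ContinuousLinearMap.comp_apply, innerSL_apply_apply]
  simp only [add_apply, neg_apply, smul_apply, ContinuousLinearMap.smulRight_apply,
    innerSL_apply_apply, rankTwo_apply, smul_eq_mul, Function.comp, lat_sph, dir_sph,
    norm_eq_of_mem_sphere, Pi.mul_apply, inner_add_left, inner_neg_left, real_inner_smul_left,
    inner_zero_left, real_inner_self_eq_norm_sq]
  ring

/-- The spherical Laplacian of a zonal function. -/
theorem sphLaplacian_zonal (e u : Sph n) {g : ℝ → ℝ} (hg : ContDiff ℝ ∞ g) :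
    sphLaplacian (fun v : Sph n => g ⟪(e : Euc n), (v : Euc n)⟫) u
      = (1 - ⟪(e : Euc n), (u : Euc n)⟫ ^ 2) * deriv (deriv g) ⟪(e : Euc n), (u : Euc n)⟫
        - ((n : ℝ) - 1) * ⟪(e : Euc n), (u : Euc n)⟫ * deriv g ⟪(e : Euc n), (u : Euc n)⟫ := by
  have hu := sph_ne_zero u
  have hcongr : homExt (fun v : Sph n => g ⟪(e : Euc n), (v : Euc n)⟫) =ᶠ[nhds (u : Euc n)]
      fun x => g (lat (e : Euc n) x) := by
    filter_upwards [isOpen_ne.mem_nhds hu] with x hx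
    exact homExt_zonal e g hx
  rw [sphLaplacian, (InnerProductSpace.laplacian_congr_nhds hcongr).eq_of_nhds,
    InnerProductSpace.laplacian_eq_iteratedFDeriv_orthonormalBasis _
      (EuclideanSpace.basisFun (Fin n) ℝ)]
  set b := EuclideanSpace.basisFun (Fin n) ℝ
  have hsq : ∀ x y : Euc n, ∑ j, ⟪x, b j⟫ * ⟪y, b j⟫ = ⟪x, y⟫ := fun x y => by
    simp only [real_inner_comm (b _) y]
    exact b.sum_inner_mul_inner x y
  have hterm : ∀ j, iteratedFDeriv ℝ 2 (fun x => g (lat (e : Euc n) x)) (u : Euc n) ![b j, b j]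
      = deriv (deriv g) ⟪(e : Euc n), (u : Euc n)⟫
          * (⟪perp (e : Euc n) u, b j⟫ * ⟪perp (e : Euc n) u, b j⟫)
        - 2 * deriv g ⟪(e : Euc n), (u : Euc n)⟫
          * (⟪perp (e : Euc n) u, b j⟫ * ⟪(u : Euc n), b j⟫)
        - ⟪(e : Euc n), (u : Euc n)⟫ * deriv g ⟪(e : Euc n), (u : Euc n)⟫
          * (1 - ⟪(u : Euc n), b j⟫ * ⟪(u : Euc n), b j⟫) := fun j => by
    rw [iteratedFDeriv_two_apply]
    simp only [Matrix.cons_val_zero, Matrix.cons_val_one]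
    rw [fderiv_fderiv_comp_lat e u hg, b.orthonormal.1 j]
    ring
  simp only [hterm]
  rw [Finset.sum_sub_distrib, Finset.sum_sub_distrib, ← Finset.mul_sum, ← Finset.mul_sum,
    ← Finset.mul_sum, Finset.sum_sub_distrib, hsq, hsq, hsq, real_inner_self_eq_norm_sq,
    real_inner_self_eq_norm_sq, norm_perp_sq (norm_eq_of_mem_sphere e) hu, lat_sph,
    real_inner_comm (u : Euc n) (perp _ _)]
  have h0 : ⟪(u : Euc n), perp (e : Euc n) u⟫ = 0 := by
    have := inner_dir_perp (e := (e : Euc n)) hu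
    rwa [dir_sph] at this
  rw [h0, norm_eq_of_mem_sphere]
  simp
  ring

theorem boxOp_zonal (hn : 2 ≤ n) (e u : Sph n) {g : ℝ → ℝ} (hg : ContDiff ℝ ∞ g) :
    boxOp (fun v : Sph n => g ⟪(e : Euc n), (v : Euc n)⟫) u
      = 1 / ((n : ℝ) - 1) * (Profile.ofContDiff g hg).box n ⟪(e : Euc n), (u : Euc n)⟫ := by
  have hn' : (n : ℝ) - 1 ≠ 0 := by
    have : (2 : ℝ) ≤ n := by exact_mod_cast hn
    linarith
  rw [boxOp, sphLaplacian_zonal e u hg]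
  simp only [Profile.box, Profile.tan, Profile.ofContDiff]
  field_simp
  ring

theorem multiplier_boxPairing (hn : 2 ≤ n) (e : Sph n) (f : Sph n → ℝ) (k : ℕ) :
    multiplier e (boxPairing f) k = 1 / ((n : ℝ) - 1) * ∫ v, f v *
      (Profile.ofContDiff _ (contDiff_legendre n k)).box n ⟪(e : Euc n), (v : Euc n)⟫ ∂(surf n) := by
  rw [multiplier, boxPairing, ← integral_const_mul]
  refine integral_congr_ae (Eventually.of_forall fun v => ?_)
  simp only
  rw [boxOp_zonal hn e v (contDiff_legendre n k)]
  ring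

end ZonalLaplacian

/-! ### Multipliers of `□_n f`: part (2) -/

section BoxMultipliers

variable {n : ℕ} {f : Sph n → ℝ} {Φ : ConvexBody (Euc n) → ConvexBody (Euc n)}

/-- Positivity applied to `q + p` and `q - p`: on centered profiles `□_n f` behaves like a positive
measure. -/
theorem abs_integral_mul_box_le (hn : 3 ≤ n) (e : Sph n) {i : ℕ} (hi1 : 1 ≤ i) (hi : i < n)
    (hΦ : WeaklyMonotone Φ) (hf : IsGeneratingFunction e i Φ f) {p q : Profile}
    (hpc : p.IsCentered e) (hqc : q.IsCentered e) (hpq : ∀ t, |t| ≤ 1 → |p.val t| ≤ q.val t) :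
    |∫ v, f v * p.box n ⟪(e : Euc n), (v : Euc n)⟫ ∂(surf n)|
      ≤ ∫ v, f v * q.box n ⟪(e : Euc n), (v : Euc n)⟫ ∂(surf n) := by
  have key : ∀ s : ℝ, (∀ t, |t| ≤ 1 → 0 ≤ q.val t + s * p.val t) →
      0 ≤ ∫ v, f v * q.box n ⟪(e : Euc n), (v : Euc n)⟫ ∂(surf n)
        + s * ∫ v, f v * p.box n ⟪(e : Euc n), (v : Euc n)⟫ ∂(surf n) := fun s hs => by
    rw [← integral_mul_box_addSmul e hf.integrable]
    exact integral_mul_box_nonneg hn e hi1 hi hΦ hf hs (hqc.addSmul hpc s)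
  have h1 := key 1 fun t ht => by linarith [(abs_le.1 (hpq t ht)).1]
  have h2 := key (-1) fun t ht => by linarith [(abs_le.1 (hpq t ht)).2]
  rw [abs_le]
  constructor <;> linarith

/-- The sum of the cutoff functions of the polar caps of radii `2 ^ j / k` with weights
`a ^ j`. -/
noncomputable def Profile.dyadicCaps (a : ℝ) (k : ℕ) : ℕ → Profile
  | 0 => const 0
  | J + 1 => (dyadicCaps a k J).addSmul (a ^ J) (cap (2 ^ J / k))

theorem Profile.dyadicCaps_val (a : ℝ) (k J : ℕ) (t : ℝ) :
    (dyadicCaps a k J).val t = ∑ j ∈ Finset.range J, a ^ j * (cap (2 ^ j / k)).val t := by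
  induction J with
  | zero => simp [dyadicCaps, const]
  | succ J ih =>
    rw [Finset.sum_range_succ, ← ih]
    simp only [dyadicCaps, addSmul]

theorem Profile.box_const (n : ℕ) (c t : ℝ) : (const c).box n t = ((n : ℝ) - 1) * c := by
  rw [box, tan_const]
  simp [const]

/-- The condition `2^J < 2k` keeps all radii `2^j/k` with `j < J` at most `1`, where the linear cap
bound is available. -/
theorem integral_mul_box_dyadicCaps_le (e : Sph n) (hf : Integrable f (surf n)) {C : ℝ}
    (hcap : ∀ r : ℝ, 0 < r → r ≤ 1 →
      ∫ v, f v * (Profile.cap r).box n ⟪(e : Euc n), (v : Euc n)⟫ ∂(surf n) ≤ C * r)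
    {a : ℝ} (ha : 0 ≤ a) {k : ℕ} (hk : 1 ≤ k) {J : ℕ} (hJ : 2 ^ J < 2 * k) :
    ∫ v, f v * (Profile.dyadicCaps a k J).box n ⟪(e : Euc n), (v : Euc n)⟫ ∂(surf n)
      ≤ C * ∑ j ∈ Finset.range J, a ^ j * ((2 : ℝ) ^ j / k) := by
  have hk' : (0 : ℝ) < k := by exact_mod_cast hk
  induction J with
  | zero => simp [Profile.dyadicCaps, Profile.box_const]
  | succ J ih =>
    have hJ' : 2 ^ J ≤ k := by rw [pow_succ] at hJ; omega
    rw [Profile.dyadicCaps, integral_mul_box_addSmul e hf, Finset.sum_range_succ, mul_add]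
    refine add_le_add (ih (by omega)) ?_
    have hr1 : (2 : ℝ) ^ J / k ≤ 1 := (div_le_one hk').2 (by exact_mod_cast hJ')
    have := mul_le_mul_of_nonneg_left (hcap ((2 : ℝ) ^ J / k) (by positivity) hr1)
      (pow_nonneg ha J)
    linarith

theorem contDiff_id_infty : ContDiff ℝ ∞ fun t : ℝ => t := contDiff_id

theorem Profile.box_linear (n : ℕ) (t : ℝ) :
    (Profile.ofContDiff _ contDiff_id_infty).box n t = 0 := by
  simp [box, tan, ofContDiff]

theorem integral_inner_sq_pos (hn : 3 ≤ n) (e : Sph n) :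
    0 < ∫ u : Sph n, ⟪(e : Euc n), (u : Euc n)⟫ ^ 2 ∂(surf n) := by
  have : NeZero n := ⟨by omega⟩
  have hc : Continuous fun u : Sph n => ⟪(e : Euc n), (u : Euc n)⟫ ^ 2 := by fun_prop
  apply hc.integral_pos_of_hasCompactSupport_nonneg_nonzero (HasCompactSupport.of_compactSpace _)
    (fun u => sq_nonneg _) (x := e)
  rw [real_inner_self_eq_norm_sq, norm_eq_of_mem_sphere]
  norm_num

/-- The linear part of a Legendre polynomial is dominated by its `L¹`-norm. -/
theorem exists_abs_linear_coeff_legendre_le (hn : 3 ≤ n) (e : Sph n) {b : ℝ} (hb0 : 0 ≤ b)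
    (hb : b ≤ ((n : ℝ) - 2) / 2) :
    ∃ D : ℝ, 0 ≤ D ∧ ∀ k J : ℕ, 1 ≤ k → ∃ c : ℝ, |c| ≤ D * dyadicSum b 1 k J ∧
      ((Profile.ofContDiff _ (contDiff_legendre n k)).addSmul (-c)
        (Profile.ofContDiff _ contDiff_id_infty)).IsCentered e := by
  obtain ⟨C, hC⟩ := exists_surf_polarCaps_le hn e
  obtain ⟨D, hD, hbound⟩ := exists_integral_abs_legendre_le hn e (surf n) hb0 hb hC
  have hpos := integral_inner_sq_pos hn e
  set Q := ∫ u : Sph n, ⟪(e : Euc n), (u : Euc n)⟫ ^ 2 ∂(surf n) with hQ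
  refine ⟨D / Q, by positivity, fun k J hk => ?_⟩
  have hP := continuous_comp_inner (contDiff_legendre n k).continuous e
  have ht : Continuous fun u : Sph n => ⟪(e : Euc n), (u : Euc n)⟫ := by fun_prop
  set I := ∫ u : Sph n, legendre n k ⟪(e : Euc n), (u : Euc n)⟫ * ⟪(e : Euc n), (u : Euc n)⟫
    ∂(surf n) with hI
  -- The coefficient of the orthogonal projection of `P_k` onto the linear function `t`. A bound for
  -- it by the `L¹`-norm of `P_k` is enough, so orthogonality of Legendre polynomials does not
  -- enter.
  refine ⟨I / Q, ?_, ?_⟩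
  · rw [abs_div, abs_of_pos hpos, div_mul_eq_mul_div]
    refine div_le_div_of_nonneg_right (le_trans ?_ (hbound k J hk)) hpos.le
    refine (abs_integral_le_integral_abs).trans (integral_mono
      (integrable_of_continuous _ (hP.mul ht).abs) (integrable_of_continuous _ hP.abs) fun u => ?_)
    simp only [abs_mul]
    exact mul_le_of_le_one_right (abs_nonneg _) (abs_inner_sph_le_one e u)
  · rw [Profile.IsCentered]
    simp only [Profile.addSmul, Profile.ofContDiff, add_mul, mul_assoc]
    have hPt : Integrable (fun u : Sph n => legendre n k ⟪(e : Euc n), (u : Euc n)⟫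
        * ⟪(e : Euc n), (u : Euc n)⟫) (surf n) := integrable_of_continuous _ (hP.mul ht)
    have htt : Integrable (fun u : Sph n => -(I / Q) * (⟪(e : Euc n), (u : Euc n)⟫
        * ⟪(e : Euc n), (u : Euc n)⟫)) (surf n) :=
      integrable_of_continuous _ ((ht.mul ht).const_mul _)
    rw [integral_add hPt htt, integral_const_mul]
    simp only [← pow_two]
    rw [← hI, ← hQ]
    field_simp
    ring

theorem multiplier_boxPairing_isBigO (hn : 3 ≤ n) (e : Sph n) {i : ℕ} (hi1 : 1 < i) (hi : i < n)
    (hΦ : WeaklyMonotone Φ) (hf : IsGeneratingFunction e i Φ f) :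
    multiplier e (boxPairing f) =O[atTop] fun k : ℕ => (k : ℝ) ^ (-(1 / 2) : ℝ) := by
  have hn' : (3 : ℝ) ≤ n := by exact_mod_cast hn
  have hb : (1 / 2 : ℝ) ≤ ((n : ℝ) - 2) / 2 := by linarith
  obtain ⟨C, hC, hcap⟩ := exists_integral_mul_box_cap_le hn e hi1 hi hΦ hf
  obtain ⟨A, hA, hmaj⟩ := exists_legendre_majorant n hn (b := 1 / 2) (by norm_num) hb
  obtain ⟨D, hD, hlin⟩ := exists_abs_linear_coeff_legendre_le hn e (b := 1 / 2) (by norm_num) hb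
  -- The cap bound has exponent `α = 1`. The choice `b = 1/2` is admissible for every `n ≥ 3` and
  -- lies strictly below `α`, so no logarithm appears.
  obtain ⟨M, hM⟩ := exists_dyadicSum_le_of_gt (b := 1 / 2) (α := 1) (by norm_num) (by norm_num)
  set B := ∫ v, f v * (Profile.const 1).box n ⟪(e : Euc n), (v : Euc n)⟫ ∂(surf n) with hB
  have h1c : ∀ c, (Profile.const c).IsCentered e := fun c =>
    Profile.isCentered_of_even e fun t => rfl
  have hB0 : 0 ≤ B := integral_mul_box_nonneg hn e (by omega) hi hΦ hf
    (fun t _ => zero_le_one) (h1c 1)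
  set a := (2 : ℝ) ^ (-(1 / 2) : ℝ) with ha
  have ha0 : 0 < a := by positivity
  refine IsBigO.of_bound (1 / ((n : ℝ) - 1) * ((A * (C + B) + B * D) * M)) ?_
  filter_upwards [eventually_ge_atTop 1] with k hk
  obtain ⟨J, hJ, hJ'⟩ := exists_two_pow_between hk
  have hk' : (0 : ℝ) < k := by exact_mod_cast hk
  obtain ⟨c, hc, hcent⟩ := hlin k J hk
  set P := Profile.ofContDiff _ (contDiff_legendre n k)
  set ℓ := Profile.ofContDiff _ contDiff_id_infty
  -- An even, hence centered, majorant of `|P_k - c t|`: the dyadic majorant with smooth cutoffs in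
  -- place of indicators, plus `|c|` for the linear correction.
  set q := ((Profile.const 0).addSmul (A * a ^ J + |c|) (Profile.const 1)).addSmul A
    (Profile.dyadicCaps a k J) with hq
  have hqc : q.IsCentered e := by
    apply Profile.isCentered_of_even
    intro t
    simp only [hq, Profile.addSmul, Profile.dyadicCaps_val, Profile.cap_even, Profile.const]
  have hdom : ∀ t, |t| ≤ 1 → |(P.addSmul (-c) ℓ).val t| ≤ q.val t := by
    intro t ht
    have h1 := hmaj k t J (fun j => (Profile.cap (2 ^ j / k)).val t) hk ht
      (fun j => Profile.cap_nonneg _ t) (fun j hj => by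
        refine (Profile.cap_eq_one (by positivity) ?_).ge
        rw [div_pow, le_div_iff₀ (by positivity), ← pow_mul, mul_comm j, pow_mul]
        norm_num
        linarith)
    have h2 : |c * t| ≤ |c| := by
      rw [abs_mul]
      exact mul_le_of_le_one_right (abs_nonneg c) ht
    have h3 : (P.addSmul (-c) ℓ).val t = legendre n k t - c * t := by
      simp only [P, ℓ, Profile.addSmul, Profile.ofContDiff]
      ring
    have h4 : q.val t = A * (∑ j ∈ Finset.range J, a ^ j * (Profile.cap (2 ^ j / k)).val t
        + a ^ J) + |c| := by
      simp only [hq, Profile.addSmul, Profile.dyadicCaps_val, Profile.const]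
      ring
    rw [h3, h4]
    exact (abs_sub _ _).trans (add_le_add h1 h2)
  have hmain := abs_integral_mul_box_le hn e (by omega) hi hΦ hf hcent hqc hdom
  -- The box operator annihilates linear functions, so the centering correction does not change the
  -- multiplier.
  have hz : ∀ c' : ℝ, c' * ∫ v, f v * ℓ.box n ⟪(e : Euc n), (v : Euc n)⟫ ∂(surf n) = 0 := by
    intro c'
    simp only [ℓ, Profile.box_linear, mul_zero, integral_zero]
  have h0 : ∫ v, f v * (Profile.const 0).box n ⟪(e : Euc n), (v : Euc n)⟫ ∂(surf n) = 0 := by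
    simp only [Profile.box_const, mul_zero, integral_zero]
  rw [integral_mul_box_addSmul e hf.integrable, hz, add_zero, hq,
    integral_mul_box_addSmul e hf.integrable, integral_mul_box_addSmul e hf.integrable, h0,
    ← hB, zero_add] at hmain
  have hcaps := integral_mul_box_dyadicCaps_le e hf.integrable hcap ha0.le hk hJ'
  have hS : dyadicSum (1 / 2) 1 k J
      = ∑ j ∈ Finset.range J, a ^ j * ((2 : ℝ) ^ j / k) + a ^ J := by
    simp only [dyadicSum, Real.rpow_one, ha]
  set T := ∑ j ∈ Finset.range J, a ^ j * ((2 : ℝ) ^ j / k)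
  have hT0 : 0 ≤ T := Finset.sum_nonneg fun j _ => by positivity
  have haJ : 0 < a ^ J := by positivity
  set S := dyadicSum (1 / 2) 1 k J
  have hfin : |∫ v, f v * P.box n ⟪(e : Euc n), (v : Euc n)⟫ ∂(surf n)|
      ≤ (A * (C + B) + B * D) * (M * (k : ℝ) ^ (-(1 / 2) : ℝ)) := by
    calc _ ≤ (A * a ^ J + |c|) * B + A * (C * T) :=
          hmain.trans (add_le_add le_rfl (mul_le_mul_of_nonneg_left hcaps hA.le))
      _ ≤ (A * a ^ J + D * S) * B + A * (C * T) := by gcongr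
      _ ≤ (A * S + D * S) * B + A * (C * S) := by
          gcongr
          · linarith
          · linarith
      _ = (A * (C + B) + B * D) * S := by ring
      _ ≤ _ := by
          gcongr
          exact hM k J hk hJ hJ'
  rw [multiplier_boxPairing (by omega), Real.norm_eq_abs, Real.norm_of_nonneg (by positivity),
    abs_mul, abs_of_pos (by apply one_div_pos.2; linarith), mul_assoc, mul_assoc]
  exact mul_le_mul_of_nonneg_left hfin (one_div_nonneg.2 (by linarith))

end BoxMultipliers

end ZonalMultipliers

theorem mainTheorem10 (n : ℕ) (hn : 3 ≤ n) (e : ZonalMultipliers.Sph n) :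
    (∀ (μ : SignedMeasure (ZonalMultipliers.Sph n)) (C α : ℝ),
      ZonalMultipliers.ZonalMeasure e μ → 0 < C → 0 ≤ α →
      (∀ r : ℝ, 0 ≤ r →
        μ.totalVariation.real
          {u | Real.cos r < |⟪(e : ZonalMultipliers.Euc n), (u : ZonalMultipliers.Euc n)⟫|}
            ≤ C * r ^ α) →
      (α < ((n : ℝ) - 2) / 2 →
        ZonalMultipliers.multiplier e (ZonalMultipliers.measurePairing μ)
          =O[atTop] fun k : ℕ => (k : ℝ) ^ (-α)) ∧
      (α = ((n : ℝ) - 2) / 2 →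
        ZonalMultipliers.multiplier e (ZonalMultipliers.measurePairing μ)
          =O[atTop] fun k : ℕ => (k : ℝ) ^ (-(((n : ℝ) - 2) / 2)) * Real.log k) ∧
      (((n : ℝ) - 2) / 2 < α →
        ZonalMultipliers.multiplier e (ZonalMultipliers.measurePairing μ)
          =O[atTop] fun k : ℕ => (k : ℝ) ^ (-(((n : ℝ) - 2) / 2)))) ∧
    (∀ (i : ℕ) (Φ : ConvexBody (ZonalMultipliers.Euc n) → ConvexBody (ZonalMultipliers.Euc n))
      (f : ZonalMultipliers.Sph n → ℝ),
      1 < i → i ≤ n - 1 → ZonalMultipliers.IsMVal i Φ → ZonalMultipliers.WeaklyMonotone Φ →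
      ZonalMultipliers.IsGeneratingFunction e i Φ f →
      ZonalMultipliers.multiplier e (ZonalMultipliers.boxPairing f)
        =O[atTop] fun k : ℕ => (k : ℝ) ^ (-(1 / 2) : ℝ)) := by
  refine ⟨fun μ C α _ hC hα hμ =>
    ZonalMultipliers.multiplier_measurePairing_isBigO hn e μ hC hα hμ, ?_⟩
  intro i Φ f hi1 hi _ hΦ hf
  exact ZonalMultipliers.multiplier_boxPairing_isBigO hn e hi1 (by omega) hΦ hf
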